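/- Let $a<c$ be real numbers and let $b,t$ be smooth real functions on $(a,c)$ with $b(x_1)<t(x_1)$. Put $$\mathcal X=\{(x_1,x_2): a<x_1<c,\ b(x_1)<x_2<t(x_1)\},\qquad \mathcal S=\{(x_1,t(x_1)): a<x_1<c\},$$ $$\varepsilon(x_1)=\tfrac{c-a}{2}-\bigl|x_1-\tfrac{a+c}{2}\bigr| .$$ Let $f$ be a real-valued function that is real analytic on $\mathcal X\cup\mathcal S\cup\{(x_1,b(x_1)):a<x_1<c\}$, and let $u$ be a real-valued function, real analytic on $\mathcal X\cup\mathcal S$, which solves the Cauchy problem $$\Delta u=f\ \text{ in }\mathcal X,\qquad u=u_0,\quad \frac{\partial u}{\partial x_2}=u_1\ \text{ on }\mathcal S .$$ Here (real analytic on a set means real analytic in a neighbourhood of each of its points) the data $u_0,u_1$ are given as functions of $(x_1,x_2)$ near $\mathcal S$, and the initial conditions hold together with all derivatives in $x_2$, i.e. $u=u_0$ and $\partial u/\partial x_2=u_1$ near $\mathcal S$. For $x_1\in(a,c)$ and $0<\varepsilon\le\varepsilon(x_1)$ let $T_\varepsilon(x_1)\subset\mathbb C$ be the open triangle with vertices $b(x_1)$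 and $t(x_1)\mp i\varepsilon$. We say that $u(x_1,\cdot)$ *extends to* $T_\varepsilon(x_1)$ if there is a function $U(x_1,x_2,y_2)=u(x_1,x_2+iy_2)$, holomorphic in $z_2=x_2+iy_2\in T_\varepsilon(x_1)$ and continuous on the closed triangle with the vertex $b(x_1)$ removed, with $U(x_1,x_2,0)=u(x_1,x_2)$ for $b(x_1)<x_2<t(x_1)$. We say that *the data continue for* $\varepsilon$ if $u_0,u_1$ are real analytic at all points $(x_1',t(x_1))$ with $|x_1'-x_1|<\varepsilon$, and $f$ has a continuation $f(x_1',z_2)$ (equal to $f$ at the real points near $(x_1,t(x_1))$) that is real analytic in $(x_1',z_2)$ and holomorphic in $z_2$ near all points $(x_1',t(x_1)+iy)$ with $|x_1'-x_1|+|y|<\varepsilon$. Then for every $x_1\in(a,c)$: 1. There is $\varepsilon_0\in(0,\varepsilon(x_1)]$ such that for every $\varepsilon\in(0,\varepsilon_0]$ the function $u(x_1,\cdot)$ extends to $T_\varepsilon(x_1)$ and the data continue for $\varepsilon$. 2. For every $\varepsilon\in(0,\varepsilon(x_1)]$ (in particular for $\varepsilon=\varepsilon(x_1)$) such that $u(x_1,\cdot)$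 extends to $T_\varepsilon(x_1)$: (a) if the data continue for $\varepsilon$, then for all real $y_2$ with $|y_2|<\varepsilon$ $$U(x_1,t(x_1),y_2)=-\frac12\int_0^{y_2}\!dy_2'\int_{x_1-y_2'}^{x_1+y_2'} f\bigl(x_1',t(x_1)+i(y_2-y_2')\bigr)\,dx_1'+\frac{u_0(x_1+y_2,t(x_1))+u_0(x_1-y_2,t(x_1))}{2}+\frac i2\int_{x_1-y_2}^{x_1+y_2}u_1(x_1',t(x_1))\,dx_1';$$ (b) for every $x_2$ with $(x_1,x_2)\in\mathcal X$, the integrals below converge and $$u(x_1,x_2)=\lim_{N\to\infty}\frac1{2\pi}\int_{-\varepsilon}^{\varepsilon}U(x_1,t(x_1),y_2)\,\exp\!\left(N\left(\Bigl(\frac{t(x_1)-b(x_1)+iy_2}{x_2-b(x_1)}\Bigr)^{1/\alpha}-1\right)\right)\frac{dy_2}{t(x_1)-x_2+iy_2},$$ where $N$ runs through the positive integers, $\alpha=\frac2\pi\arctan\frac{\varepsilon}{t(x_1)-b(x_1)}$ and the power is the principal branch. -/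

import Mathlib

open Set Filter Topology

/-- The strip domain `𝒳`: all `x = (x₁, x₂)` with `a < x₁ < c` and `bot x₁ < x₂ < top x₁`. -/
def stripDomain (a c : ℝ) (bot top : ℝ → ℝ) : Set (ℝ × ℝ) :=
  {x | x.1 ∈ Ioo a c ∧ bot x.1 < x.2 ∧ x.2 < top x.1}

/-- The graph of `g` over `(a, c)`. For `g = top` this is the curve `𝒮` carrying the data. -/
def graphOver (a c : ℝ) (g : ℝ → ℝ) : Set (ℝ × ℝ) :=
  {x | x.1 ∈ Ioo a c ∧ x.2 = g x.1}

/-- `ε(x₁) = (c - a)/2 - |x₁ - (a + c)/2|`, the distance from `x₁ ∈ (a, c)` to `{a, c}`. -/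
noncomputable def halfWidth (a c x₁ : ℝ) : ℝ := (c - a) / 2 - |x₁ - (a + c) / 2|

/-- The partial derivative `∂u/∂x₂`. -/
noncomputable def partialTwo (u : ℝ × ℝ → ℝ) (x : ℝ × ℝ) : ℝ :=
  deriv (fun s : ℝ => u (x.1, s)) x.2

/-- The Laplace operator in the plane, `∂²u/∂x₁² + ∂²u/∂x₂²`. -/
noncomputable def planarLaplacian (u : ℝ × ℝ → ℝ) (x : ℝ × ℝ) : ℝ :=
  iteratedDeriv 2 (fun s : ℝ => u (s, x.2)) x.1 + iteratedDeriv 2 (fun s : ℝ => u (x.1, s)) x.2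

/-- `u` is a solution of the Cauchy problem `Δu = f` in `𝒳`, `u = u₀` and `∂u/∂x₂ = u₁` on `𝒮`,
which is real analytic up to `𝒮`. The data are functions of both variables near `𝒮`, and the
initial conditions hold on `𝒮` together with all derivatives in `x₂`; for analytic functions this
is equality near each point of `𝒮`. -/
structure IsAnalyticCauchySolution (X S : Set (ℝ × ℝ)) (f u₀ u₁ u : ℝ × ℝ → ℝ) : Prop where
  analytic : AnalyticOnNhd ℝ u (X ∪ S)
  equation : ∀ x ∈ X, planarLaplacian u x = f x
  value : ∀ x ∈ S, ∀ᶠ p in 𝓝 x, u p = u₀ p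
  slope : ∀ x ∈ S, ∀ᶠ p in 𝓝 x, partialTwo u p = u₁ p

/-- The open triangle with vertices `b`, `t - iε`, `t + iε` (for `b < t`, `0 < ε`). -/
def openTriangle (b t ε : ℝ) : Set ℂ :=
  {z | b < z.re ∧ z.re < t ∧ |z.im| * (t - b) < ε * (z.re - b)}

/-- The closed triangle with vertices `b`, `t - iε`, `t + iε`, without its vertex `b`. -/
def closedTriangleMinusVertex (b t ε : ℝ) : Set ℂ :=
  {z | b < z.re ∧ z.re ≤ t ∧ |z.im| * (t - b) ≤ ε * (z.re - b)}

/-- `U` extends the function `g` on `(b, t)` holomorphically to the triangle with vertices `b`,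
`t ∓ iε`, continuously up to the boundary except possibly at the vertex `b`. -/
structure IsTriangleExtension (g : ℝ → ℝ) (b t ε : ℝ) (U : ℂ → ℂ) : Prop where
  holomorphic : DifferentiableOn ℂ U (openTriangle b t ε)
  continuous : ContinuousOn U (closedTriangleMinusVertex b t ε)
  extends_real : ∀ s ∈ Ioo b t, U (s : ℂ) = (g s : ℂ)

/-- The points `(x₁', t + iy)` of `ℝ × ℂ` with `|x₁' - x₁| + |y| < ε`: the characteristic
triangles of the wave equation in `(x₁', y)`, for the parameter value `x₂ = t`. -/
def characteristicSquare (x₁ t ε : ℝ) : Set (ℝ × ℂ) :=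
  {p | p.2.re = t ∧ |p.1 - x₁| + |p.2.im| < ε}

/-- The data of the wave equation do not lead beyond their domains for `x₂ = t` and `|y| < ε`:
`u₀`, `u₁` are analytic along the horizontal segment of half-length `ε` centred at `(x₁, t)`, and
`F (x₁', z₂)` is an analytic continuation of `f`, holomorphic in `z₂`, to the characteristic
square. -/
structure IsContinuedData (f u₀ u₁ : ℝ × ℝ → ℝ) (F : ℝ × ℂ → ℂ) (x₁ t ε : ℝ) : Prop where
  analytic_value : ∀ r, |r - x₁| < ε → AnalyticAt ℝ u₀ (r, t)
  analytic_slope : ∀ r, |r - x₁| < ε → AnalyticAt ℝ u₁ (r, t)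
  analytic_source : AnalyticOnNhd ℝ F (characteristicSquare x₁ t ε)
  holomorphic_source : ∀ p ∈ characteristicSquare x₁ t ε,
    ∀ᶠ q in 𝓝 p, DifferentiableAt ℂ (fun z : ℂ => F (q.1, z)) q.2
  extends_source : ∀ᶠ x in 𝓝 ((x₁, t) : ℝ × ℝ), F (x.1, (x.2 : ℂ)) = (f x : ℂ)

/-- The source term
`(Gf)(x₁, x₂, y) = -1/2 ∫_0^y ds ∫_{x₁ - s}^{x₁ + s} f(r, x₂ + i(y - s)) dr`. -/
noncomputable def sourceTerm (F : ℝ × ℂ → ℂ) (x₁ x₂ y : ℝ) : ℂ :=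
  -(1 / 2 : ℂ) * ∫ s in (0 : ℝ)..y, ∫ r in (x₁ - s)..(x₁ + s),
    F (r, (x₂ : ℂ) + Complex.I * ((y - s : ℝ) : ℂ))

/-- The d'Alembert term
`P(u₀, u₁) = (u₀(x₁ + y, x₂) + u₀(x₁ - y, x₂))/2 + i/2 ∫_{x₁ - y}^{x₁ + y} u₁(r, x₂) dr`. -/
noncomputable def dAlembertTerm (u₀ u₁ : ℝ × ℝ → ℝ) (x₁ x₂ y : ℝ) : ℂ :=
  ((u₀ (x₁ + y, x₂) : ℂ) + (u₀ (x₁ - y, x₂) : ℂ)) / 2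
    + Complex.I / 2 * ∫ r in (x₁ - y)..(x₁ + y), (u₁ (r, x₂) : ℂ)

/-- `α = (2/π) arctan (ε/(t - b))`; the angle of the triangle at its vertex `b` is `απ`. -/
noncomputable def vertexAngleRatio (b t ε : ℝ) : ℝ := 2 / Real.pi * Real.arctan (ε / (t - b))

/-- The kernel
`exp (N (((t - b + iy)/(x₂ - b))^(1/α) - 1)) / (t - x₂ + iy)`, with the principal power. -/
noncomputable def carlemanKernel (N : ℕ) (b t ε x₂ y : ℝ) : ℂ :=
  Complex.exp ((N : ℂ) *
      (((((t - b : ℝ) : ℂ) + Complex.I * (y : ℂ)) / ((x₂ - b : ℝ) : ℂ)) ^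
        ((1 / vertexAngleRatio b t ε : ℝ) : ℂ) - 1))
    / (((t - x₂ : ℝ) : ℂ) + Complex.I * (y : ℂ))

/-! For `z₂ = t + iy` the Poisson equation turns into a wave equation in `(x₁, y)`, whose Cauchy
problem on `y = 0` is solved by d'Alembert's formula. The data therefore determine the continuation
of `u (x₁, ·)` on the vertical side of the triangle, and Carleman's formula recovers `u` inside from
that side alone.

Boundary values: near `(x₁, t)` the function `u` is the restriction of a holomorphic `v` of two
variables (`AnalyticAt.exists_complexification`), and `v` satisfies the complexified equation on a
neighbourhood in `ℝ × ℂ` (`eventually_complex_poisson`). Integration along the two characteristics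
gives the formula for small `y` (`eventually_eq_dAlembert`). The right side is real analytic for
`|y| < ε`, the left side is the boundary value of a holomorphic function, and an open-closed
argument along the side carries the equality to all `|y| < ε` (`eq_on_edge_of_eventuallyEq`).

Carleman's formula: apply Cauchy's formula on a trapezoid to `U` times `exp (N (((z - b)/(x -
b))^(1/α) - 1))`. This factor is `1` at `x`. The power opens the angle `απ` at `b` to a half-plane,
so it is purely imaginary on the slanted sides, and it is small near `b`; hence every side except
the one opposite to `b` contributes a geometrically small term. The cut near `b` stays fixed as `N →
∞`, so no growth condition on `U` at the vertex is needed (`carleman_formula`).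

Existence: a local holomorphic solution `v` of the complexified equation makes `u - Re v` harmonic.
A harmonic function on a disc is the real part of a holomorphic one, so `u (x₁, ·)` extends to a
complex disc of the same radius (`extendsToDisc_of_poisson`). Since `bot` is differentiable at `x₁`,
near the bottom point these radii can be taken proportional to the height above it; elsewhere
compactness suffices, and the discs glue to a triangle (`exists_isTriangleExtension`). -/

/-! ### Complexification of real analytic functions. -/

/-- The complexification of a continuous multilinear map on `ℝ × ℝ`. -/
noncomputable def complexifyMultilinear {n : ℕ} (p : ContinuousMultilinearMap ℝ (fun _ : Fin n => ℝ × ℝ) ℂ) :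
    ContinuousMultilinearMap ℂ (fun _ : Fin n => ℂ × ℂ) ℂ :=
  ∑ φ : Fin n → Bool,
    p (fun i => if φ i then (1, 0) else (0, 1)) •
      (ContinuousMultilinearMap.mkPiAlgebra ℂ (Fin n) ℂ).compContinuousLinearMap
        (fun i => if φ i then ContinuousLinearMap.fst ℂ ℂ ℂ else ContinuousLinearMap.snd ℂ ℂ ℂ)

theorem norm_complexifyMultilinear_le {n : ℕ}
    (p : ContinuousMultilinearMap ℝ (fun _ : Fin n => ℝ × ℝ) ℂ) :
    ‖complexifyMultilinear p‖ ≤ 2 ^ n * ‖p‖ := by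
  refine (norm_sum_le _ _).trans ?_
  have hcard : (2 : ℝ) ^ n * ‖p‖ = ∑ _φ : Fin n → Bool, ‖p‖ := by
    simp
  rw [hcard]
  refine Finset.sum_le_sum fun φ _ => ?_
  rw [norm_smul]
  have h1 : ‖p (fun i => if φ i then (1, 0) else (0, 1))‖ ≤ ‖p‖ := by
    refine (p.le_opNorm _).trans ?_
    refine mul_le_of_le_one_right (norm_nonneg _) (Finset.prod_le_one (fun _ _ => norm_nonneg _) ?_)
    intro i _
    split_ifs <;> simp
  have h2 : ‖(ContinuousMultilinearMap.mkPiAlgebra ℂ (Fin n) ℂ).compContinuousLinearMap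
        (fun i => if φ i then ContinuousLinearMap.fst ℂ ℂ ℂ
          else ContinuousLinearMap.snd ℂ ℂ ℂ)‖ ≤ 1 := by
    refine (ContinuousMultilinearMap.norm_compContinuousLinearMap_le _ _).trans ?_
    rw [ContinuousMultilinearMap.norm_mkPiAlgebra, one_mul]
    refine Finset.prod_le_one (fun _ _ => norm_nonneg _) fun i _ => ?_
    split_ifs
    · exact ContinuousLinearMap.norm_fst_le ℂ ℂ ℂ
    · exact ContinuousLinearMap.norm_snd_le ℂ ℂ ℂ
  exact (mul_le_mul h1 h2 (norm_nonneg _) (norm_nonneg _)).trans (by simp)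

/-- Expanding every argument in the basis `(1, 0)`, `(0, 1)` and using multilinearity of `p`
produces exactly the sum over words `φ`. -/
theorem complexifyMultilinear_apply_real {n : ℕ}
    (p : ContinuousMultilinearMap ℝ (fun _ : Fin n => ℝ × ℝ) ℂ) (v : Fin n → ℝ × ℝ) :
    complexifyMultilinear p (fun i => (((v i).1 : ℂ), ((v i).2 : ℂ))) = p v := by
  have hv : v = fun i => ∑ j : Bool,
      (if j then (v i).1 else (v i).2) • (if j then ((1 : ℝ), (0 : ℝ)) else (0, 1)) := by
    funext i
    simp
  conv_rhs => rw [hv]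
  have := p.toMultilinearMap.map_sum (fun i (j : Bool) =>
      (if j then (v i).1 else (v i).2) • (if j then ((1 : ℝ), (0 : ℝ)) else (0, 1)))
  simp only [ContinuousMultilinearMap.coe_coe] at this
  rw [this]
  simp only [complexifyMultilinear, sum_apply,
    smul_apply, ContinuousMultilinearMap.compContinuousLinearMap_apply,
    ContinuousMultilinearMap.mkPiAlgebra_apply]
  refine Finset.sum_congr rfl fun φ _ => ?_
  rw [ContinuousMultilinearMap.map_smul_univ, smul_eq_mul, Complex.real_smul, Complex.ofReal_prod, mul_comm]
  congr 1
  refine Finset.prod_congr rfl fun i _ => ?_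
  cases φ i <;> simp

theorem exists_pos_le_radius_of_norm_le {𝕜 E F : Type*} [NontriviallyNormedField 𝕜]
    [NormedAddCommGroup E] [NormedSpace 𝕜 E] [NormedAddCommGroup F] [NormedSpace 𝕜 F]
    (q : FormalMultilinearSeries 𝕜 E F) {C R : ℝ} (hR : 0 < R)
    (h : ∀ n, ‖q n‖ * R ^ n ≤ C) : ENNReal.ofReal R ≤ q.radius := by
  have := q.le_radius_of_bound (r := R.toNNReal) C (fun n => by
    rw [Real.coe_toNNReal R hR.le]; exact h n)
  exact this

/-- A real analytic function of two variables is locally the restriction of a holomorphic one. -/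
theorem AnalyticAt.exists_complexification {f : ℝ × ℝ → ℂ} {x : ℝ × ℝ} (hf : AnalyticAt ℝ f x) :
    ∃ G : ℂ × ℂ → ℂ, AnalyticAt ℂ G ((x.1 : ℂ), (x.2 : ℂ)) ∧
      ∀ᶠ p in 𝓝 x, G ((p.1 : ℂ), (p.2 : ℂ)) = f p := by
  obtain ⟨p, r, hp⟩ := hf
  obtain ⟨ρ, hρ0, hρ⟩ := ENNReal.lt_iff_exists_nnreal_btwn.1 hp.r_pos
  have hρ0' : 0 < ρ := by exact_mod_cast hρ0
  obtain ⟨C, hC0, hC⟩ := p.norm_mul_pow_le_of_lt_radius (lt_of_lt_of_le hρ hp.r_le)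
  let q : FormalMultilinearSeries ℂ (ℂ × ℂ) ℂ := fun n => complexifyMultilinear (p n)
  -- Complexification multiplies the norm of the `n`-th term by at most `2 ^ n`, so half of the
  -- radius survives.
  have hR : (0 : ℝ) < ρ / 2 := by positivity
  have hrad : ENNReal.ofReal (ρ / 2) ≤ q.radius := by
    refine exists_pos_le_radius_of_norm_le q hR (C := C) fun n => ?_
    refine le_trans ?_ (hC n)
    calc ‖q n‖ * ((ρ : ℝ) / 2) ^ n ≤ (2 ^ n * ‖p n‖) * ((ρ : ℝ) / 2) ^ n := by
          gcongr; exact norm_complexifyMultilinear_le _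
      _ = ‖p n‖ * (ρ : ℝ) ^ n := by
          rw [div_pow]; field_simp
  have hpos : 0 < q.radius := lt_of_lt_of_le (by simpa using hR) hrad
  have hq := q.hasFPowerSeriesOnBall hpos
  refine ⟨fun z => q.sum (z - ((x.1 : ℂ), (x.2 : ℂ))), ?_, ?_⟩
  · have := (hq.comp_sub ((x.1 : ℂ), (x.2 : ℂ))).analyticAt
    simpa using this
  · have hmem : Metric.eball x r ∈ 𝓝 x := Metric.eball_mem_nhds x hp.r_pos
    filter_upwards [hmem] with y hy
    have hs := hp.hasSum_sub hy
    rw [← hs.tsum_eq]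
    simp only [FormalMultilinearSeries.sum]
    refine tsum_congr fun n => ?_
    rw [← complexifyMultilinear_apply_real]
    simp [q, Prod.mk_sub_mk]

/-- A real analytic function of one variable is locally the restriction of a holomorphic one. -/
theorem AnalyticAt.exists_complexification_real {g : ℝ → ℂ} {s : ℝ} (hg : AnalyticAt ℝ g s) :
    ∃ G : ℂ → ℂ, AnalyticAt ℂ G (s : ℂ) ∧ ∀ᶠ t : ℝ in 𝓝 s, G (t : ℂ) = g t := by
  have h : AnalyticAt ℝ (fun p : ℝ × ℝ => g p.2) ((0 : ℝ), s) :=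
    AnalyticAt.comp (g := g) (f := Prod.snd) hg analyticAt_snd
  obtain ⟨G, hG, hGe⟩ := h.exists_complexification
  refine ⟨fun z => G (0, z), ?_, ?_⟩
  · have h2 : AnalyticAt ℂ (fun z : ℂ => ((0 : ℂ), z)) (s : ℂ) := by fun_prop
    exact AnalyticAt.comp (g := G) (by simpa using hG) h2
  · have : Tendsto (fun t : ℝ => ((0 : ℝ), t)) (𝓝 s) (𝓝 ((0 : ℝ), s)) := by
      exact (Continuous.prodMk_right (0 : ℝ)).tendsto s
    filter_upwards [this.eventually hGe] with t ht
    simpa using ht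

/-! ### Analytic primitives in one variable of several. -/

section Primitive

variable {𝕜 : Type*} [RCLike 𝕜] {E F : Type*} [NormedAddCommGroup E] [NormedSpace 𝕜 E]
  [NormedAddCommGroup F] [NormedSpace ℝ F] [NormedSpace 𝕜 F] [SMulCommClass 𝕜 ℝ F]

/-- Composing the `n`-th homogeneous term with a contraction does not increase its norm, so the
averaged terms obey the same bounds, and dominated convergence allows summation under the integral.
-/
theorem AnalyticAt.integral_comp_contraction {H : E → F} {x : E} (hH : AnalyticAt 𝕜 H x)
    {L : ℝ → E →L[𝕜] E} (hLc : Continuous L) (hL : ∀ s ∈ Icc (0 : ℝ) 1, ‖L s‖ ≤ 1) :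
    AnalyticAt 𝕜 (fun y => ∫ s in (0 : ℝ)..1, H (x + L s (y - x))) x := by
  obtain ⟨p, r, hp⟩ := hH
  obtain ⟨ρ, hρ0, hρ⟩ := ENNReal.lt_iff_exists_nnreal_btwn.1 hp.r_pos
  have hρ0' : (0 : ℝ) < ρ := by exact_mod_cast hρ0
  obtain ⟨C, hC0, hC⟩ := p.norm_mul_pow_le_of_lt_radius (lt_of_lt_of_le hρ hp.r_le)
  let φ : ∀ n : ℕ, ℝ → ContinuousMultilinearMap 𝕜 (fun _ : Fin n => E) F :=
    fun n s => (p n).compContinuousLinearMap (fun _ => L s)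
  have hφc : ∀ n, Continuous (φ n) := fun n => by
    have h1 : Continuous fun s => (ContinuousMultilinearMap.compContinuousLinearMapContinuousMultilinear
        𝕜 (fun _ : Fin n => E) (fun _ : Fin n => E) F) (fun _ => L s) :=
      (ContinuousMultilinearMap.cont _).comp (continuous_pi fun _ => hLc)
    exact h1.clm_apply continuous_const
  have hφn : ∀ n, ∀ s ∈ Icc (0 : ℝ) 1, ‖φ n s‖ ≤ ‖p n‖ := fun n s hs => by
    refine (ContinuousMultilinearMap.norm_compContinuousLinearMap_le _ _).trans ?_
    exact mul_le_of_le_one_right (norm_nonneg _)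
      (Finset.prod_le_one (fun _ _ => norm_nonneg _) fun _ _ => hL s hs)
  let q : FormalMultilinearSeries 𝕜 E F := fun n => ∫ s in (0 : ℝ)..1, φ n s
  have hq : ∀ n, ‖q n‖ ≤ ‖p n‖ := fun n => by
    have := intervalIntegral.norm_integral_le_of_norm_le_const (a := (0 : ℝ)) (b := 1)
      (f := φ n) (C := ‖p n‖) (fun s hs => hφn n s (by
        rw [uIoc_of_le zero_le_one] at hs; exact ⟨hs.1.le, hs.2⟩))
    simpa using this
  have hrad : ENNReal.ofReal ρ ≤ q.radius :=
    exists_pos_le_radius_of_norm_le q hρ0' (C := C) fun n =>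
      (mul_le_mul_of_nonneg_right (hq n) (by positivity)).trans (hC n)
  refine ⟨q, ENNReal.ofReal ρ, hrad, by simpa using hρ0, ?_⟩
  intro y hy
  have hyρ : ‖y‖ < ρ := by
    rw [Metric.mem_eball, edist_zero_right, ← ofReal_norm] at hy
    exact (ENNReal.ofReal_lt_ofReal_iff hρ0').1 hy
  have hqy : ∀ n, q n (fun _ => y) = ∫ s in (0 : ℝ)..1, φ n s (fun _ => y) := fun n => by
    simp only [q, intervalIntegral.integral_of_le (zero_le_one' ℝ)]
    exact ContinuousMultilinearMap.integral_apply
      ((hφc n).intervalIntegrable 0 1).1 _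
  simp only [hqy, add_sub_cancel_left]
  have hsum : Summable fun n => ‖p n‖ * ‖y‖ ^ n := by
    have hlt : (‖y‖₊ : ENNReal) < p.radius :=
      lt_of_lt_of_le (lt_trans (by exact_mod_cast hyρ) hρ) hp.r_le
    simpa using p.summable_norm_mul_pow hlt
  refine intervalIntegral.hasSum_integral_of_dominated_convergence
    (fun n _ => ‖p n‖ * ‖y‖ ^ n) (fun n => ?_) (fun n => ?_) ?_ ?_ ?_
  · exact Continuous.aestronglyMeasurable
      ((ContinuousMultilinearMap.apply 𝕜 (fun _ : Fin n => E) F (fun _ => y)).continuous.comp (hφc n))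
  · refine Eventually.of_forall fun s hs => ?_
    rw [uIoc_of_le zero_le_one] at hs
    refine ((φ n s).le_opNorm _).trans ?_
    simp only [Finset.prod_const, Finset.card_univ, Fintype.card_fin]
    exact mul_le_mul_of_nonneg_right (hφn n s ⟨hs.1.le, hs.2⟩) (by positivity)
  · exact Eventually.of_forall fun s _ => hsum
  · simp
  · refine Eventually.of_forall fun s hs => ?_
    rw [uIoc_of_le zero_le_one] at hs
    have hmem : L s y ∈ Metric.eball (0 : E) r := by
      have h1 : ‖L s y‖ < ρ := lt_of_le_of_lt (((L s).le_opNorm y).trans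
        (mul_le_of_le_one_left (norm_nonneg _) (hL s ⟨hs.1.le, hs.2⟩))) hyρ
      rw [Metric.mem_eball, edist_zero_right]
      refine lt_trans ?_ hρ
      rw [← ofReal_norm, ENNReal.ofReal_lt_coe_iff (by positivity)]
      exact_mod_cast h1
    exact hp.hasSum hmem

/-- A function which is analytic at a point of a product has a primitive in the first variable
which is analytic there. -/
theorem AnalyticAt.exists_primitive_fst [CompleteSpace F] [IsScalarTower ℝ 𝕜 F] {H : 𝕜 × E → F}
    {x : 𝕜 × E} (hH : AnalyticAt 𝕜 H x) :
    ∃ V : 𝕜 × E → F, AnalyticAt 𝕜 V x ∧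
      ∀ᶠ p in 𝓝 x, HasDerivAt (fun k => V (k, p.2)) (H p) p.1 := by
  -- `L s` shrinks only the first coordinate. Thus `g p` below is the mean of `H` over the segment
  -- from `(x.1, p.2)` to `p`, and the primitive is `(p.1 - x.1) • g p`.
  let L : ℝ → 𝕜 × E →L[𝕜] 𝕜 × E := fun s =>
    (s : 𝕜) • (ContinuousLinearMap.inl 𝕜 𝕜 E).comp (ContinuousLinearMap.fst 𝕜 𝕜 E) +
      (ContinuousLinearMap.inr 𝕜 𝕜 E).comp (ContinuousLinearMap.snd 𝕜 𝕜 E)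
  have hLapp : ∀ s (v : 𝕜 × E), L s v = ((s : 𝕜) * v.1, v.2) := fun s v => by simp [L]
  have hLc : Continuous L := by
    have : Continuous fun s : ℝ => (s : 𝕜) := RCLike.continuous_ofReal
    fun_prop
  have hL : ∀ s ∈ Icc (0 : ℝ) 1, ‖L s‖ ≤ 1 := fun s hs => by
    refine ContinuousLinearMap.opNorm_le_bound _ zero_le_one fun v => ?_
    rw [hLapp, one_mul, Prod.norm_def, Prod.norm_def]
    refine max_le_max ?_ le_rfl
    rw [norm_mul, RCLike.norm_ofReal, abs_of_nonneg hs.1]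
    exact mul_le_of_le_one_left (norm_nonneg _) hs.2
  set g : 𝕜 × E → F := fun y => ∫ s in (0 : ℝ)..1, H (x + L s (y - x)) with hg
  have hga : AnalyticAt 𝕜 g x := hH.integral_comp_contraction hLc hL
  have hcoef : AnalyticAt 𝕜 (fun p : 𝕜 × E => p.1 - x.1) x :=
    analyticAt_fst.sub analyticAt_const
  refine ⟨fun p => (p.1 - x.1) • g p, hcoef.smul hga, ?_⟩
  obtain ⟨δ, hδ, hball⟩ := Metric.eventually_nhds_iff_ball.1
    (hH.eventually_analyticAt.and hga.eventually_analyticAt)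
  filter_upwards [Metric.ball_mem_nhds x hδ] with p hp
  have hsec : AnalyticAt 𝕜 (fun k : 𝕜 => (k, p.2)) p.1 := by fun_prop
  have hgd : DifferentiableAt 𝕜 (fun k => g (k, p.2)) p.1 :=
    ((hball p hp).2.comp (f := fun k : 𝕜 => (k, p.2)) hsec).differentiableAt
  have hVd : HasDerivAt (fun k => (k - x.1) • g (k, p.2))
      ((p.1 - x.1) • deriv (fun k => g (k, p.2)) p.1 + (1 : 𝕜) • g (p.1, p.2)) p.1 :=
    ((hasDerivAt_id p.1).sub_const x.1).smul hgd.hasDerivAt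
  -- The `𝕜`-derivative exists by analyticity, so only its value is in question. If `p.1 = x.1`, the
  -- product rule gives it at once. Otherwise it is computed along the real ray from `x.1` through
  -- `p.1`, where a substitution turns the primitive into `κ` times an ordinary integral and the
  -- factor `κ` cancels.
  rcases eq_or_ne p.1 x.1 with h0 | h0
  · convert hVd using 1
    have : ∀ s : ℝ, x + L s (p - x) = p := fun s => by
      rw [hLapp]; ext <;> simp [h0]
    have hgp : g (p.1, p.2) = H p := by
      simp only [hg, Prod.mk.eta, this, intervalIntegral.integral_const, sub_zero, one_smul]
    rw [hgp, h0, sub_self, zero_smul, zero_add, one_smul]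
  · set κ : 𝕜 := p.1 - x.1 with hκ
    have hκ0 : κ ≠ 0 := sub_ne_zero.2 h0
    let ψ : ℝ → F := fun s => H (x.1 + (s : 𝕜) * κ, p.2)
    have hpath : Continuous fun s : ℝ => (x.1 + (s : 𝕜) * κ, p.2) := by
      have : Continuous fun s : ℝ => (s : 𝕜) := RCLike.continuous_ofReal
      fun_prop
    have hin : ∀ s ∈ Icc (0 : ℝ) 1, (x.1 + (s : 𝕜) * κ, p.2) ∈ Metric.ball x δ := fun s hs => by
      rw [Metric.mem_ball, dist_eq_norm] at hp ⊢
      refine lt_of_le_of_lt ?_ hp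
      rw [Prod.norm_def, Prod.norm_def]
      refine max_le_max ?_ le_rfl
      simp only [Prod.fst_sub, add_sub_cancel_left]
      rw [norm_mul, RCLike.norm_ofReal, abs_of_nonneg hs.1]
      exact mul_le_of_le_one_left (norm_nonneg _) hs.2
    let O : Set ℝ := (fun s : ℝ => (x.1 + (s : 𝕜) * κ, p.2)) ⁻¹' Metric.ball x δ
    have hO : IsOpen O := Metric.isOpen_ball.preimage hpath
    have hψc : ContinuousOn ψ O := fun s hs =>
      ((hball _ hs).1.continuousAt.comp (f := fun s : ℝ => (x.1 + (s : 𝕜) * κ, p.2))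
        hpath.continuousAt).continuousWithinAt
    have hunit : Icc (0 : ℝ) 1 ⊆ O := fun s hs => hin s hs
    have hint : IntervalIntegrable ψ MeasureTheory.volume 0 1 :=
      (hψc.mono (by rwa [uIcc_of_le zero_le_one])).intervalIntegrable
    have hmeas : StronglyMeasurableAtFilter ψ (𝓝 1) MeasureTheory.volume :=
      ContinuousOn.stronglyMeasurableAtFilter hO hψc 1 (hunit (by simp))
    have hFTC : HasDerivAt (fun σ : ℝ => ∫ s in (0 : ℝ)..σ, ψ s) (ψ 1) 1 :=
      intervalIntegral.integral_hasDerivAt_right hint hmeas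
        (hψc.continuousAt (hO.mem_nhds (hunit (by simp))))
    have hV : ∀ σ : ℝ, σ ≠ 0 → (((x.1 + (σ : 𝕜) * κ) - x.1) • g (x.1 + (σ : 𝕜) * κ, p.2)) =
        κ • ∫ s in (0 : ℝ)..σ, ψ s := fun σ hσ => by
      have : g (x.1 + (σ : 𝕜) * κ, p.2) = ∫ s in (0 : ℝ)..1, ψ (s * σ) := by
        simp only [hg, ψ, hLapp]
        congr 1
        funext s
        congr 1
        ext
        · simp [mul_assoc]
        · simp
      rw [this, intervalIntegral.integral_comp_mul_right _ hσ]
      simp only [zero_mul, one_mul, add_sub_cancel_left]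
      rw [mul_comm, mul_smul, ← RCLike.real_smul_eq_coe_smul, smul_smul, mul_inv_cancel₀ hσ,
        one_smul]
    have hline : HasDerivAt (fun σ : ℝ => x.1 + (σ : 𝕜) * κ) κ (1 : ℝ) := by
      have h1 : HasDerivAt (fun σ : ℝ => (σ : 𝕜)) 1 (1 : ℝ) := by
        simpa using (RCLike.ofRealCLM (K := 𝕜)).hasDerivAt (x := (1 : ℝ))
      simpa using (h1.mul_const κ).const_add x.1
    have hp1 : x.1 + ((1 : ℝ) : 𝕜) * κ = p.1 := by simp [hκ]
    have hA := HasDerivAt.scomp (𝕜 := ℝ) (𝕜' := 𝕜) (h := fun σ : ℝ => x.1 + (σ : 𝕜) * κ) (1 : ℝ)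
      (hp1.symm ▸ hVd) hline
    have hB : HasDerivAt (fun σ : ℝ => κ • ∫ s in (0 : ℝ)..σ, ψ s) (κ • ψ 1) 1 :=
      hFTC.const_smul κ
    have hAB : (fun σ : ℝ => κ • ∫ s in (0 : ℝ)..σ, ψ s) =ᶠ[𝓝 1]
        ((fun k => (k - x.1) • g (k, p.2)) ∘ fun σ : ℝ => x.1 + (σ : 𝕜) * κ) := by
      filter_upwards [isOpen_ne.mem_nhds (one_ne_zero (α := ℝ))] with σ hσ
      exact (hV σ hσ).symm
    have heq := (hA.congr_of_eventuallyEq hAB).unique hB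
    have := smul_right_injective F hκ0 heq
    rw [hp1] at this
    rw [this] at hVd
    simpa [ψ, hκ] using hVd

end Primitive

/-! ### Analytic dependence of integrals on parameters and end points. -/

section ParametricIntegral

variable {E F : Type*} [NormedAddCommGroup E] [NormedSpace ℝ E]
  [NormedAddCommGroup F] [NormedSpace ℝ F] [CompleteSpace F]

/-- Near a point of analyticity the integral over a short interval is a difference of values of an
analytic function. -/
theorem AnalyticAt.exists_integral_eq_sub {H : ℝ × E → F} {k₀ : ℝ} {e₀ : E}
    (hH : AnalyticAt ℝ H (k₀, e₀)) :
    ∃ (V : ℝ × E → F) (δ : ℝ), 0 < δ ∧ (∀ k, |k - k₀| < δ → AnalyticAt ℝ V (k, e₀)) ∧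
      ∀ k k' e, |k - k₀| < δ → |k' - k₀| < δ → ‖e - e₀‖ < δ →
        IntervalIntegrable (fun s => H (s, e)) MeasureTheory.volume k k' ∧
        ∫ s in k..k', H (s, e) = V (k', e) - V (k, e) := by
  obtain ⟨V, hV, hVd⟩ := hH.exists_primitive_fst
  obtain ⟨δ, hδ, hball⟩ := Metric.eventually_nhds_iff_ball.1
    ((hH.eventually_analyticAt.and hV.eventually_analyticAt).and hVd)
  have hmem : ∀ k e, |k - k₀| < δ → ‖e - e₀‖ < δ → (k, e) ∈ Metric.ball (k₀, e₀) δ :=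
    fun k e hk he => by
      rw [Metric.mem_ball, dist_eq_norm, Prod.norm_def]
      exact max_lt hk he
  refine ⟨V, δ, hδ, fun k hk => (hball _ (hmem k e₀ hk (by simpa using hδ))).1.2, ?_⟩
  intro k k' e hk hk' he
  have hseg : ∀ s ∈ uIcc k k', |s - k₀| < δ := fun s hs => by
    have hconv : Convex ℝ (Metric.ball k₀ δ) := convex_ball k₀ δ
    have := hconv.ordConnected.uIcc_subset (x := k) (y := k')
      (by simpa [Real.dist_eq] using hk) (by simpa [Real.dist_eq] using hk') hs
    simpa [Real.dist_eq] using this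
  have hcont : ContinuousOn (fun s => H (s, e)) (uIcc k k') := fun s hs =>
    ((hball _ (hmem s e (hseg s hs) he)).1.1.continuousAt.comp (f := fun s : ℝ => (s, e))
      (Continuous.prodMk_left e).continuousAt).continuousWithinAt
  refine ⟨hcont.intervalIntegrable, ?_⟩
  exact intervalIntegral.integral_eq_sub_of_hasDerivAt
    (f := fun s => V (s, e)) (fun s hs => (hball _ (hmem s e (hseg s hs) he)).2)
    hcont.intervalIntegrable

/-- The integral of an analytic function over an interval with analytic end points depends
analytically on the parameter. -/
theorem AnalyticAt.parametric_intervalIntegral {H : ℝ × E → F} {a b : E → ℝ} {e₀ : E}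
    (ha : AnalyticAt ℝ a e₀) (hb : AnalyticAt ℝ b e₀)
    (hH : ∀ k ∈ uIcc (a e₀) (b e₀), AnalyticAt ℝ H (k, e₀)) :
    AnalyticAt ℝ (fun e => ∫ k in a e..b e, H (k, e)) e₀ := by
  have hsmall : ∀ δ > 0, ∀ᶠ e in 𝓝 e₀, ‖e - e₀‖ < δ := fun δ hδ => by
    filter_upwards [Metric.ball_mem_nhds e₀ hδ] with e he
    rwa [← dist_eq_norm]
  -- Fixed end points: the property of a pair of end points holds locally by means of a primitive,
  -- and is transitive and symmetric, so it spreads over the connected interval. Integrability is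
  -- carried along because additivity of the integral needs it.
  have key : AnalyticAt ℝ (fun e => ∫ k in a e₀..b e₀, H (k, e)) e₀ ∧
      ∀ᶠ e in 𝓝 e₀, IntervalIntegrable (fun s => H (s, e)) MeasureTheory.volume (a e₀) (b e₀) := by
    refine IsPreconnected.induction₂ (s := uIcc (a e₀) (b e₀)) isPreconnected_uIcc
      (fun x y => AnalyticAt ℝ (fun e => ∫ k in x..y, H (k, e)) e₀ ∧
        ∀ᶠ e in 𝓝 e₀, IntervalIntegrable (fun s => H (s, e)) MeasureTheory.volume x y)
      ?_ ?_ ?_ left_mem_uIcc right_mem_uIcc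
    · intro k₀ hk₀
      obtain ⟨V, δ, hδ, hV, hI⟩ := (hH k₀ hk₀).exists_integral_eq_sub
      have hk0 : |k₀ - k₀| < δ := by simpa using hδ
      have hnear : ∀ᶠ k in 𝓝[uIcc (a e₀) (b e₀)] k₀, |k - k₀| < δ :=
        nhdsWithin_le_nhds (Metric.ball_mem_nhds k₀ hδ)
      filter_upwards [hnear] with k hk
      refine ⟨?_, (hsmall δ hδ).mono fun e he => (hI k₀ k e hk0 hk he).1⟩
      have hdiff : AnalyticAt ℝ (fun e => V (k, e) - V (k₀, e)) e₀ :=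
        ((hV k hk).comp (f := fun e => (k, e)) (analyticAt_const.prod analyticAt_id)).sub
          ((hV k₀ hk0).comp (f := fun e => (k₀, e)) (analyticAt_const.prod analyticAt_id))
      refine hdiff.congr ?_
      exact (hsmall δ hδ).mono fun e he => (hI k₀ k e hk0 hk he).2.symm
    · rintro x y z _ _ _ ⟨h1, h1'⟩ ⟨h2, h2'⟩
      refine ⟨(h1.add h2).congr ?_, ?_⟩
      · filter_upwards [h1', h2'] with e i1 i2
        exact intervalIntegral.integral_add_adjacent_intervals i1 i2
      · filter_upwards [h1', h2'] with e i1 i2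
        exact i1.trans i2
    · rintro x y _ _ ⟨h1, h1'⟩
      refine ⟨h1.neg.congr ?_, h1'.mono fun e i => i.symm⟩
      exact Eventually.of_forall fun e => (intervalIntegral.integral_symm x y).symm
  -- Moving end points: the two short pieces between `a e`, `a e₀` and between `b e₀`, `b e` are
  -- expressed by the local primitives `V` and `W`.
  obtain ⟨V, δ, hδ, hV, hI⟩ := (hH (a e₀) left_mem_uIcc).exists_integral_eq_sub
  obtain ⟨W, η, hη, hW, hJ⟩ := (hH (b e₀) right_mem_uIcc).exists_integral_eq_sub
  have ha0 : |a e₀ - a e₀| < δ := by simpa using hδ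
  have hb0 : |b e₀ - b e₀| < η := by simpa using hη
  have hsum : AnalyticAt ℝ (fun e => (V (a e₀, e) - V (a e, e)) + (∫ k in a e₀..b e₀, H (k, e)) +
      (W (b e, e) - W (b e₀, e))) e₀ := by
    refine ((AnalyticAt.sub ?_ ?_).add key.1).add (AnalyticAt.sub ?_ ?_)
    · exact (hV _ ha0).comp (f := fun e => (a e₀, e)) (analyticAt_const.prod analyticAt_id)
    · exact (hV _ ha0).comp (f := fun e => (a e, e)) (ha.prod analyticAt_id)
    · exact (hW _ hb0).comp (f := fun e => (b e, e)) (hb.prod analyticAt_id)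
    · exact (hW _ hb0).comp (f := fun e => (b e₀, e)) (analyticAt_const.prod analyticAt_id)
  have hae : ∀ᶠ e in 𝓝 e₀, |a e - a e₀| < δ := by
    simpa [Real.dist_eq] using ha.continuousAt.eventually (Metric.ball_mem_nhds (a e₀) hδ)
  have hbe : ∀ᶠ e in 𝓝 e₀, |b e - b e₀| < η := by
    simpa [Real.dist_eq] using hb.continuousAt.eventually (Metric.ball_mem_nhds (b e₀) hη)
  refine hsum.congr ?_
  filter_upwards [key.2, hae, hbe, hsmall δ hδ, hsmall η hη] with e hk h1 h2 h3 h4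
  obtain ⟨i1, e1⟩ := hI (a e) (a e₀) e h1 ha0 h3
  obtain ⟨i2, e2⟩ := hJ (b e₀) (b e) e hb0 h2 h4
  rw [← e1, ← e2, intervalIntegral.integral_add_adjacent_intervals i1 hk,
    intervalIntegral.integral_add_adjacent_intervals (i1.trans hk) i2]

end ParametricIntegral

/-! ### Cauchy's theorem and the winding number for a trapezoid. -/

/-- Coordinates `z = b + s (ℓ + iy)` on a cone with vertex `b`. -/
noncomputable def coneMap (b ℓ : ℝ) (p : ℝ × ℝ) : ℂ :=
  (b : ℂ) + (p.1 : ℂ) * ((ℓ : ℂ) + Complex.I * (p.2 : ℂ))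

@[simp] theorem coneMap_re (b ℓ : ℝ) (p : ℝ × ℝ) : (coneMap b ℓ p).re = b + p.1 * ℓ := by
  simp [coneMap]

@[simp] theorem coneMap_im (b ℓ : ℝ) (p : ℝ × ℝ) : (coneMap b ℓ p).im = p.1 * p.2 := by
  simp [coneMap]

theorem coneMap_mem_closedTriangle {b t ε s y : ℝ} (hbt : b < t) (hs0 : 0 < s) (hs1 : s ≤ 1)
    (hy : |y| ≤ ε) : coneMap b (t - b) (s, y) ∈ closedTriangleMinusVertex b t ε := by
  have hl : 0 < t - b := sub_pos.2 hbt
  refine ⟨?_, ?_, ?_⟩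
  · simp only [coneMap_re]; nlinarith
  · simp only [coneMap_re]; nlinarith
  · simp only [coneMap_re, coneMap_im, abs_mul, abs_of_pos hs0]
    have : s * |y| * (t - b) ≤ s * ε * (t - b) := by gcongr
    linarith

theorem coneMap_mem_openTriangle {b t ε s y : ℝ} (hbt : b < t) (hs0 : 0 < s) (hs1 : s < 1)
    (hy : |y| < ε) : coneMap b (t - b) (s, y) ∈ openTriangle b t ε := by
  have hl : 0 < t - b := sub_pos.2 hbt
  refine ⟨?_, ?_, ?_⟩
  · simp only [coneMap_re]; nlinarith
  · simp only [coneMap_re]; nlinarith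
  · simp only [coneMap_re, coneMap_im, abs_mul, abs_of_pos hs0]
    have : s * |y| * (t - b) < s * ε * (t - b) := by gcongr
    linarith

theorem isOpen_openTriangle (b t ε : ℝ) : IsOpen (openTriangle b t ε) := by
  have h1 : IsOpen {z : ℂ | b < z.re} := isOpen_lt continuous_const Complex.continuous_re
  have h2 : IsOpen {z : ℂ | z.re < t} := isOpen_lt Complex.continuous_re continuous_const
  have h3 : IsOpen {z : ℂ | |z.im| * (t - b) < ε * (z.re - b)} :=
    isOpen_lt (Complex.continuous_im.abs.mul continuous_const)
      (continuous_const.mul (Complex.continuous_re.sub continuous_const))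
  exact h1.inter (h2.inter h3)

theorem openTriangle_subset_closedTriangle (b t ε : ℝ) :
    openTriangle b t ε ⊆ closedTriangleMinusVertex b t ε :=
  fun _ hz => ⟨hz.1, hz.2.1.le, hz.2.2.le⟩

theorem hasFDerivAt_coneMap (b ℓ : ℝ) (p : ℝ × ℝ) :
    HasFDerivAt (coneMap b ℓ)
      ((ContinuousLinearMap.fst ℝ ℝ ℝ).smulRight ((ℓ : ℂ) + Complex.I * (p.2 : ℂ)) +
        (ContinuousLinearMap.snd ℝ ℝ ℝ).smulRight ((p.1 : ℂ) * Complex.I)) p := by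
  have h1 : HasFDerivAt (fun p : ℝ × ℝ => (p.1 : ℂ))
      (Complex.ofRealCLM.comp (ContinuousLinearMap.fst ℝ ℝ ℝ)) p :=
    (Complex.ofRealCLM.comp (ContinuousLinearMap.fst ℝ ℝ ℝ)).hasFDerivAt
  have h2 : HasFDerivAt (fun p : ℝ × ℝ => (p.2 : ℂ))
      (Complex.ofRealCLM.comp (ContinuousLinearMap.snd ℝ ℝ ℝ)) p :=
    (Complex.ofRealCLM.comp (ContinuousLinearMap.snd ℝ ℝ ℝ)).hasFDerivAt
  have h3 := (h1.mul ((h2.const_mul Complex.I).const_add (ℓ : ℂ))).const_add (b : ℂ)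
  refine h3.congr_fderiv ?_
  ext <;> simp

theorem continuous_coneMap (b ℓ : ℝ) : Continuous (coneMap b ℓ) := by
  unfold coneMap
  fun_prop

/-- The signed contour integral (divided by `i`) of `G` over the boundary of the trapezoid cut off
from a triangle by a line parallel to its base. -/
noncomputable def trapezoidIntegral (b ℓ ε d : ℝ) (G : ℂ → ℂ) : ℂ :=
  (∫ y in (-ε)..ε, G (coneMap b ℓ (1, y))) - (∫ y in (-ε)..ε, (d : ℂ) * G (coneMap b ℓ (d, y))) +
    (∫ s in d..1, Complex.I * ((ℓ : ℂ) + Complex.I * (ε : ℂ)) * G (coneMap b ℓ (s, ε))) -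
    ∫ s in d..1, Complex.I * ((ℓ : ℂ) + Complex.I * ((-ε : ℝ) : ℂ)) * G (coneMap b ℓ (s, -ε))

/-- Cauchy's theorem for the trapezoid. -/
theorem trapezoidIntegral_eq_zero {b t ε d : ℝ} (hbt : b < t) (hε : 0 < ε) (hd0 : 0 < d)
    (hd1 : d < 1) {G : ℂ → ℂ} (hG : DifferentiableOn ℂ G (openTriangle b t ε))
    (hGc : ContinuousOn G (closedTriangleMinusVertex b t ε)) :
    trapezoidIntegral b (t - b) ε d G = 0 := by
  set Z := coneMap b (t - b) with hZ
  have hmaps : MapsTo Z (uIcc d 1 ×ˢ uIcc (-ε) ε) (closedTriangleMinusVertex b t ε) := by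
    rintro ⟨s, y⟩ ⟨hs, hy⟩
    rw [uIcc_of_le hd1.le] at hs
    rw [uIcc_of_le (by linarith)] at hy
    exact coneMap_mem_closedTriangle hbt (hd0.trans_le hs.1) hs.2 (abs_le.2 hy)
  have hGZ : ContinuousOn (fun p => G (Z p)) (uIcc d 1 ×ˢ uIcc (-ε) ε) :=
    hGc.comp (continuous_coneMap b (t - b)).continuousOn hmaps
  let Z' : ℝ × ℝ → (ℝ × ℝ →L[ℝ] ℂ) := fun p =>
    (ContinuousLinearMap.fst ℝ ℝ ℝ).smulRight (((t - b : ℝ) : ℂ) + Complex.I * (p.2 : ℂ)) +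
        (ContinuousLinearMap.snd ℝ ℝ ℝ).smulRight ((p.1 : ℂ) * Complex.I)
  -- In cone coordinates `G dz / i` is `s G dy - i (ℓ + iy) G ds`. Closedness of this form is the
  -- vanishing of the divergence of `(s G, i (ℓ + iy) G)`; the divergence theorem asks only for
  -- continuity up to the boundary.
  let f' : ℝ × ℝ → (ℝ × ℝ →L[ℝ] ℂ) := fun p =>
    (p.1 : ℂ) • (deriv G (Z p) • Z' p) +
      G (Z p) • Complex.ofRealCLM.comp (ContinuousLinearMap.fst ℝ ℝ ℝ)
  let g' : ℝ × ℝ → (ℝ × ℝ →L[ℝ] ℂ) := fun p =>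
    (Complex.I * (((t - b : ℝ) : ℂ) + Complex.I * (p.2 : ℂ))) • (deriv G (Z p) • Z' p) +
      G (Z p) • (Complex.I • (Complex.I • Complex.ofRealCLM.comp (ContinuousLinearMap.snd ℝ ℝ ℝ)))
  have hdiv : ∀ p, f' p (1, 0) + g' p (0, 1) = 0 := fun p => by
    simp [f', g', Z']
    linear_combination ((p.1 : ℂ) * deriv G (Z p) * ((t : ℂ) - b + Complex.I * p.2)) *
      Complex.I_mul_I
  have hGd : ∀ p ∈ Ioo (min d 1) (max d 1) ×ˢ Ioo (min (-ε) ε) (max (-ε) ε),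
      HasFDerivAt (fun p => G (Z p)) (deriv G (Z p) • Z' p) p := by
    rintro ⟨s, y⟩ ⟨hs, hy⟩
    rw [min_eq_left hd1.le, max_eq_right hd1.le] at hs
    rw [min_eq_left (by linarith), max_eq_right (by linarith)] at hy
    have hmem := coneMap_mem_openTriangle hbt (hd0.trans hs.1) hs.2 (abs_lt.2 hy)
    have h1 : HasDerivAt G (deriv G (Z (s, y))) (Z (s, y)) :=
      (hG.differentiableAt ((isOpen_openTriangle b t ε).mem_nhds hmem)).hasDerivAt
    exact h1.comp_hasFDerivAt _ (hasFDerivAt_coneMap b (t - b) (s, y))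
  have key := MeasureTheory.integral2_divergence_prod_of_hasFDerivAt
    (fun p : ℝ × ℝ => (p.1 : ℂ) * G (Z p))
    (fun p : ℝ × ℝ => Complex.I * (((t - b : ℝ) : ℂ) + Complex.I * (p.2 : ℂ)) * G (Z p))
    f' g' d (-ε) 1 ε
    (ContinuousOn.mul (by fun_prop) hGZ) (ContinuousOn.mul (by fun_prop) hGZ)
    (fun p hp => by
      have h1 : HasFDerivAt (fun p : ℝ × ℝ => (p.1 : ℂ))
          (Complex.ofRealCLM.comp (ContinuousLinearMap.fst ℝ ℝ ℝ)) p :=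
        (Complex.ofRealCLM.comp (ContinuousLinearMap.fst ℝ ℝ ℝ)).hasFDerivAt
      exact h1.mul (hGd p hp))
    (fun p hp => by
      have h2 : HasFDerivAt (fun p : ℝ × ℝ => (p.2 : ℂ))
          (Complex.ofRealCLM.comp (ContinuousLinearMap.snd ℝ ℝ ℝ)) p :=
        (Complex.ofRealCLM.comp (ContinuousLinearMap.snd ℝ ℝ ℝ)).hasFDerivAt
      exact (((h2.const_mul Complex.I).const_add _).const_mul Complex.I).mul (hGd p hp))
    (by simp only [hdiv]; exact MeasureTheory.integrableOn_zero)
  simp only [hdiv, intervalIntegral.integral_zero, Complex.ofReal_one, one_mul] at key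
  rw [trapezoidIntegral]
  linear_combination -key

theorem Complex.log_neg_eq_sub_of_im_pos {q : ℂ} (hq : 0 < q.im) :
    Complex.log (-q) = Complex.log q - Real.pi * Complex.I := by
  simp only [Complex.log, norm_neg, Complex.arg_neg_eq_arg_sub_pi_of_im_pos hq]
  push_cast
  ring

theorem Complex.log_neg_eq_add_of_im_neg {q : ℂ} (hq : q.im < 0) :
    Complex.log (-q) = Complex.log q + Real.pi * Complex.I := by
  simp only [Complex.log, norm_neg, Complex.arg_neg_eq_arg_add_pi_of_im_neg hq]
  push_cast
  ring

/-- The winding number of the trapezoid around an interior point of the real axis. -/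
theorem trapezoidIntegral_inv_sub {b ℓ ε d x : ℝ} (hε : 0 < ε) (hd0 : 0 < d)
    (hd1 : d < 1) (hx1 : b + d * ℓ < x) (hx2 : x < b + ℓ) :
    trapezoidIntegral b ℓ ε d (fun z => (z - x)⁻¹) = 2 * Real.pi := by
  have hY : ∀ s y : ℝ, HasDerivAt (fun y : ℝ => coneMap b ℓ (s, y) - x) (s * Complex.I) y :=
    fun s y => by
      have h := (((Complex.ofRealCLM.hasDerivAt (x := y)).const_mul Complex.I).const_add
        (ℓ : ℂ)).const_mul (s : ℂ)
      have h' := (h.const_add (b : ℂ)).sub_const (x : ℂ)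
      simpa [coneMap] using h'
  have hS : ∀ s y : ℝ, HasDerivAt (fun s : ℝ => coneMap b ℓ (s, y) - x)
      ((ℓ : ℂ) + Complex.I * y) s := fun s y => by
    have h := (Complex.ofRealCLM.hasDerivAt (x := s)).mul_const ((ℓ : ℂ) + Complex.I * (y : ℂ))
    have h' := (h.const_add (b : ℂ)).sub_const (x : ℂ)
    simpa [coneMap] using h'
  have hc : ∀ s : ℝ, Continuous fun y : ℝ => coneMap b ℓ (s, y) - x := fun s =>
    ((continuous_coneMap b ℓ).comp (Continuous.prodMk_right s)).sub continuous_const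
  have hc' : ∀ y : ℝ, Continuous fun s : ℝ => coneMap b ℓ (s, y) - x := fun y =>
    ((continuous_coneMap b ℓ).comp (Continuous.prodMk_left y)).sub continuous_const
  have hne1 : ∀ y : ℝ, coneMap b ℓ (1, y) - x ∈ Complex.slitPlane := fun y => by
    left; simp; linarith
  have hned : ∀ y : ℝ, -(coneMap b ℓ (d, y) - x) ∈ Complex.slitPlane := fun y => by
    left; simp; linarith
  have hneE : ∀ y : ℝ, y ≠ 0 → ∀ s ∈ uIcc d 1, coneMap b ℓ (s, y) - x ∈ Complex.slitPlane :=
    fun y hy s hs => by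
      rw [uIcc_of_le hd1.le] at hs
      right
      have : s * y ≠ 0 := mul_ne_zero (by linarith [hs.1]) hy
      simpa using this
  have e1 : (∫ y in (-ε)..ε, (coneMap b ℓ (1, y) - x)⁻¹) =
      -Complex.I * Complex.log (coneMap b ℓ (1, ε) - x) -
        -Complex.I * Complex.log (coneMap b ℓ (1, -ε) - x) := by
    refine intervalIntegral.integral_eq_sub_of_hasDerivAt
      (f := fun y : ℝ => -Complex.I * Complex.log (coneMap b ℓ (1, y) - x)) (fun y _ => ?_) ?_
    · have h := ((hY 1 y).clog_real (hne1 y)).const_mul (-Complex.I)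
      refine h.congr_deriv ?_
      simp [← mul_div_assoc]
    · exact (((hc 1).inv₀ fun y => Complex.slitPlane_ne_zero (hne1 y))).intervalIntegrable _ _
  -- On the left side `z - x` has negative real part and crosses the cut of `log`, so `log (x - z)`
  -- serves as the primitive. At the two left corners it differs from `log (z - x)` by `∓πi`; all
  -- other corner values cancel, and these two jumps add up to `2π`.
  have e2 : (∫ y in (-ε)..ε, (d : ℂ) * (coneMap b ℓ (d, y) - x)⁻¹) =
      -Complex.I * Complex.log (-(coneMap b ℓ (d, ε) - x)) -
        -Complex.I * Complex.log (-(coneMap b ℓ (d, -ε) - x)) := by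
    refine intervalIntegral.integral_eq_sub_of_hasDerivAt
      (f := fun y : ℝ => -Complex.I * Complex.log (-(coneMap b ℓ (d, y) - x))) (fun y _ => ?_) ?_
    · have h := ((hY d y).fun_neg.clog_real (hned y)).const_mul (-Complex.I)
      refine h.congr_deriv ?_
      rw [neg_div_neg_eq, ← mul_div_assoc, ← div_eq_mul_inv]
      congr 1
      linear_combination (-d : ℂ) * Complex.I_mul_I
    · exact (continuous_const.mul ((hc d).inv₀ fun y h0 => Complex.slitPlane_ne_zero (hned y)
        (by rw [h0, neg_zero]))).intervalIntegrable _ _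
  have e3 : ∀ y : ℝ, y ≠ 0 → (∫ s in d..1, Complex.I * ((ℓ : ℂ) + Complex.I * (y : ℂ)) *
      (coneMap b ℓ (s, y) - x)⁻¹) = Complex.I * Complex.log (coneMap b ℓ (1, y) - x) -
        Complex.I * Complex.log (coneMap b ℓ (d, y) - x) := fun y hy => by
    refine intervalIntegral.integral_eq_sub_of_hasDerivAt
      (f := fun s : ℝ => Complex.I * Complex.log (coneMap b ℓ (s, y) - x)) (fun s hs => ?_) ?_
    · have h := ((hS s y).clog_real (hneE y hy s hs)).const_mul Complex.I
      refine h.congr_deriv ?_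
      rw [← mul_div_assoc, ← div_eq_mul_inv]
    · exact (continuousOn_const.mul ((hc' y).continuousOn.inv₀ fun s hs =>
        Complex.slitPlane_ne_zero (hneE y hy s hs))).intervalIntegrable
  rw [trapezoidIntegral, e1, e2, e3 ε hε.ne', e3 (-ε) (by linarith)]
  rw [Complex.log_neg_eq_sub_of_im_pos (by simpa using mul_pos hd0 hε),
    Complex.log_neg_eq_add_of_im_neg (by simpa using mul_pos hd0 hε)]
  linear_combination (-2 * Real.pi : ℂ) * Complex.I_mul_I

/-! ### Carleman's formula in a triangle. -/

/-- The damping factor `exp (N (((z - b)/(x - b))^(1/α) - 1))`. -/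
noncomputable def carlemanFactor (N : ℕ) (b x p : ℝ) (z : ℂ) : ℂ :=
  Complex.exp ((N : ℂ) * (((z - b) / ((x - b : ℝ) : ℂ)) ^ (p : ℂ) - 1))

/-- An `N`-th power: where the real part of the power stays below a constant less than `1`, the
factor decays geometrically in `N`. -/
theorem norm_carlemanFactor (N : ℕ) (b x p : ℝ) (z : ℂ) :
    ‖carlemanFactor N b x p z‖ =
      Real.exp ((((z - b) / ((x - b : ℝ) : ℂ)) ^ (p : ℂ)).re - 1) ^ N := by
  rw [carlemanFactor, Complex.norm_exp, ← Real.exp_nat_mul]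
  simp

theorem carlemanFactor_self (N : ℕ) {b x : ℝ} (p : ℝ) (hx : b < x) :
    carlemanFactor N b x p x = 1 := by
  have h : ((x : ℂ) - b) / ((x - b : ℝ) : ℂ) = 1 := by
    rw [← Complex.ofReal_sub]
    exact div_self (by exact_mod_cast (sub_pos.2 hx).ne')
  rw [carlemanFactor, h, Complex.one_cpow]
  simp

theorem differentiableAt_carlemanFactor (N : ℕ) {b x : ℝ} (p : ℝ) (hx : b < x) {z : ℂ}
    (hz : b < z.re) : DifferentiableAt ℂ (carlemanFactor N b x p) z := by
  have hmem : (z - b) / ((x - b : ℝ) : ℂ) ∈ Complex.slitPlane := by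
    left
    rw [Complex.div_ofReal_re]
    have : 0 < (z - b).re := by simpa using hz
    exact div_pos this (sub_pos.2 hx)
  have h1 : DifferentiableAt ℂ (fun z : ℂ => (z - b) / ((x - b : ℝ) : ℂ)) z := by fun_prop
  have h2 : DifferentiableAt ℂ (fun z : ℂ => ((z - b) / ((x - b : ℝ) : ℂ)) ^ (p : ℂ)) z :=
    h1.cpow (differentiableAt_const _) hmem
  exact ((h2.sub_const 1).const_mul (N : ℂ)).cexp

theorem Complex.arg_eq_arctan_of_re_pos {z : ℂ} (hz : 0 < z.re) :
    z.arg = Real.arctan (z.im / z.re) := by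
  have h := abs_lt.1 (Complex.abs_arg_lt_pi_div_two_iff.2 (Or.inl hz))
  rw [← Complex.tan_arg, Real.arctan_tan h.1 h.2]

/-- On the slanted sides of the triangle the power is purely imaginary. -/
theorem re_cpow_slanted_side {b t ε x s y : ℝ} (hbt : b < t) (hε : 0 < ε) (hx : b < x)
    (hs : 0 < s) (hy : |y| = ε) :
    (((coneMap b (t - b) (s, y) - b) / ((x - b : ℝ) : ℂ)) ^
      ((1 / vertexAngleRatio b t ε : ℝ) : ℂ)).re = 0 := by
  have hl : 0 < t - b := sub_pos.2 hbt
  have hxb : 0 < x - b := sub_pos.2 hx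
  set q : ℂ := ((t - b : ℝ) : ℂ) + Complex.I * (y : ℂ) with hq
  have hz : (coneMap b (t - b) (s, y) - b) / ((x - b : ℝ) : ℂ) = ((s / (x - b) : ℝ) : ℂ) * q := by
    simp only [coneMap, hq]
    push_cast
    ring
  have hqre : q.re = t - b := by simp [hq]
  have hqim : q.im = y := by simp [hq]
  have hq0 : q ≠ 0 := fun h => by rw [h] at hqre; simp at hqre; linarith
  have hr : 0 < s / (x - b) := div_pos hs hxb
  have hne : ((s / (x - b) : ℝ) : ℂ) * q ≠ 0 :=
    mul_ne_zero (by exact_mod_cast hr.ne') hq0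
  set A := Real.arctan (ε / (t - b)) with hA
  have hA0 : 0 < A := Real.arctan_pos.2 (div_pos hε hl)
  have harg : |q.arg| = A := by
    rw [Complex.arg_eq_arctan_of_re_pos (by rw [hqre]; exact hl), hqre, hqim, hA]
    rcases abs_eq hε.le |>.1 hy with h | h
    · rw [h]; exact abs_of_pos hA0
    · rw [h, neg_div, Real.arctan_neg, abs_neg]; exact abs_of_pos hA0
  rw [hz, Complex.cpow_def_of_ne_zero hne, Complex.exp_re]
  -- `A` is half the angle at the vertex and `1 / vertexAngleRatio b t ε = π / (2 A)`, so the
  -- argument `±A` of a slanted side becomes `±π/2`.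
  have him : (Complex.log (((s / (x - b) : ℝ) : ℂ) * q) *
      ((1 / vertexAngleRatio b t ε : ℝ) : ℂ)).im = q.arg * (Real.pi / (2 * A)) := by
    rw [Complex.im_mul_ofReal, Complex.log_im, Complex.arg_real_mul _ hr, vertexAngleRatio]
    congr 1
    have := Real.pi_pos
    field_simp
    exact hA
  rw [him]
  have hcos : Real.cos (q.arg * (Real.pi / (2 * A))) = 0 := by
    rw [← Real.cos_abs, abs_mul, harg, abs_of_pos (by have := Real.pi_pos; positivity)]
    have : A * (Real.pi / (2 * A)) = Real.pi / 2 := by field_simp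
    rw [this, Real.cos_pi_div_two]
  rw [hcos, mul_zero]

/-- `h` is bounded on the compact interval, so the integral is at most a constant times `r ^ N`.
This disposes of three sides of the trapezoid. -/
theorem tendsto_integral_mul_of_norm_le_pow {h : ℝ → ℂ} {ψ : ℕ → ℝ → ℂ} {a b r : ℝ}
    (hr0 : 0 ≤ r) (hr1 : r < 1) (hh : ContinuousOn h (uIcc a b))
    (hψ : ∀ N, ∀ s ∈ uIcc a b, ‖ψ N s‖ ≤ r ^ N) :
    Tendsto (fun N => ∫ s in a..b, h s * ψ N s) atTop (𝓝 0) := by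
  obtain ⟨M, hM⟩ := isCompact_uIcc.exists_bound_of_continuousOn hh
  have hM0 : 0 ≤ M := (norm_nonneg _).trans (hM a left_mem_uIcc)
  have hbound : ∀ N, ‖∫ s in a..b, h s * ψ N s‖ ≤ M * r ^ N * |b - a| := fun N => by
    refine intervalIntegral.norm_integral_le_of_norm_le_const fun s hs => ?_
    rw [norm_mul]
    have hs' := uIoc_subset_uIcc hs
    exact mul_le_mul (hM s hs') (hψ N s hs') (norm_nonneg _) hM0
  refine squeeze_zero_norm hbound ?_
  have := ((tendsto_pow_atTop_nhds_zero_of_lt_one hr0 hr1).const_mul M).mul_const |b - a|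
  simpa using this

/-- Carleman's formula for a triangle: the values of a holomorphic function on the axis are limits
of integrals over the side opposite to the vertex. -/
theorem carleman_formula {b t ε x : ℝ} (hε : 0 < ε) (hbx : b < x) (hxt : x < t) {U : ℂ → ℂ}
    (hU : DifferentiableOn ℂ U (openTriangle b t ε))
    (hUc : ContinuousOn U (closedTriangleMinusVertex b t ε)) :
    (∀ N : ℕ, IntervalIntegrable
      (fun y : ℝ => U ((t : ℂ) + Complex.I * (y : ℂ)) * carlemanKernel N b t ε x y)
        MeasureTheory.volume (-ε) ε) ∧
    Tendsto (fun N : ℕ => 1 / (2 * (Real.pi : ℂ)) *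
      ∫ y in (-ε)..ε, U ((t : ℂ) + Complex.I * (y : ℂ)) * carlemanKernel N b t ε x y)
      atTop (𝓝 (U x)) := by
  have hbt : b < t := hbx.trans hxt
  have hl : 0 < t - b := sub_pos.2 hbt
  have hxb : 0 < x - b := sub_pos.2 hbx
  set p : ℝ := 1 / vertexAngleRatio b t ε with hp
  have hp0 : 0 < p := by
    have : 0 < Real.arctan (ε / (t - b)) := Real.arctan_pos.2 (div_pos hε hl)
    have := Real.pi_pos
    rw [hp, vertexAngleRatio]; positivity
  set Z := coneMap b (t - b) with hZ
  have hZ1 : ∀ y : ℝ, Z (1, y) = (t : ℂ) + Complex.I * (y : ℂ) := fun y => by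
    simp only [hZ, coneMap]; push_cast; ring
  have hker : ∀ (N : ℕ) (y : ℝ), carlemanKernel N b t ε x y =
      carlemanFactor N b x p (Z (1, y)) * (Z (1, y) - x)⁻¹ := fun N y => by
    rw [carlemanKernel, carlemanFactor, hZ1, ← hp, div_eq_mul_inv]
    push_cast
    congr 3
    · ring_nf
    · ring
  have hconeNe : ∀ s y : ℝ, 0 < s → (s ≠ (x - b) / (t - b) ∨ y ≠ 0) → Z (s, y) - x ≠ 0 :=
    fun s y hs h h0 => by
      have hre := congrArg Complex.re h0
      have him := congrArg Complex.im h0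
      simp [hZ] at hre him
      rcases h with h | h
      · exact h (by rw [eq_div_iff hl.ne']; linarith)
      · rcases him with h1 | h1
        · linarith
        · exact h h1
  have hs1 : (1 : ℝ) ≠ (x - b) / (t - b) := by
    rw [ne_eq, eq_div_iff hl.ne']; intro h; linarith
  have hfacCont : ∀ N, ContinuousOn (carlemanFactor N b x p) (closedTriangleMinusVertex b t ε) :=
    fun N z hz => (differentiableAt_carlemanFactor N p hbx hz.1).continuousAt.continuousWithinAt
  have hsegY : ∀ s, 0 < s → s ≤ 1 → MapsTo (fun y => Z (s, y)) (uIcc (-ε) ε)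
      (closedTriangleMinusVertex b t ε) := fun s h0 h1 y hy => by
    rw [uIcc_of_le (by linarith)] at hy
    exact coneMap_mem_closedTriangle hbt h0 h1 (abs_le.2 hy)
  have hcY : ∀ s, Continuous fun y => Z (s, y) := fun s =>
    (continuous_coneMap b (t - b)).comp (Continuous.prodMk_right s)
  have hcS : ∀ y, Continuous fun s => Z (s, y) := fun y =>
    (continuous_coneMap b (t - b)).comp (Continuous.prodMk_left y)
  refine ⟨fun N => ?_, ?_⟩
  · refine ContinuousOn.intervalIntegrable ?_
    simp only [hker, ← hZ1]
    refine (hUc.comp (hcY 1).continuousOn (hsegY 1 one_pos le_rfl)).mul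
      (((hfacCont N).comp (hcY 1).continuousOn (hsegY 1 one_pos le_rfl)).mul ?_)
    exact ((hcY 1).sub continuous_const).continuousOn.inv₀ fun y _ =>
      hconeNe 1 y one_pos (Or.inl hs1)
  set R : ℝ := ‖((t - b : ℝ) : ℂ)‖ + ε with hR
  have hRpos : 0 < R := by positivity
  -- `R` bounds `|ℓ + iy|` for `ℓ = t - b`, `|y| ≤ ε`. With `d = (x - b) / (2R)` the left side
  -- satisfies `|z - b| ≤ (x - b) / 2` and lies to the left of `x`.
  obtain ⟨d, hd0, hd1, hdx, hdR⟩ : ∃ d : ℝ, 0 < d ∧ d < 1 ∧ d * (t - b) < x - b ∧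
      d * R ≤ (x - b) / 2 := by
    refine ⟨(x - b) / (2 * R), by positivity, ?_, ?_, le_of_eq (by field_simp)⟩
    · rw [div_lt_one (by positivity)]
      have : t - b ≤ R := by
        rw [hR, Complex.norm_real, Real.norm_of_nonneg hl.le]; linarith
      linarith
    · have : t - b ≤ R := by
        rw [hR, Complex.norm_real, Real.norm_of_nonneg hl.le]; linarith
      calc (x - b) / (2 * R) * (t - b) ≤ (x - b) / (2 * R) * R := by gcongr
        _ = (x - b) / 2 := by field_simp
        _ < x - b := by linarith
  have hds : d ≠ (x - b) / (t - b) := by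
    rw [ne_eq, eq_div_iff hl.ne']; intro h; linarith
  set θ : ℝ := (1 / 2 : ℝ) ^ p with hθ
  have hθ1 : θ < 1 := Real.rpow_lt_one (by norm_num) (by norm_num) hp0
  have hθ0 : 0 ≤ θ := Real.rpow_nonneg (by norm_num) _
  -- One ratio for three sides: the real part of the power is at most `θ = (1/2)^p` on the left side
  -- and is `0 ≤ θ` on the slanted sides.
  set r : ℝ := Real.exp (θ - 1) with hr
  have hr0 : 0 ≤ r := (Real.exp_pos _).le
  have hr1 : r < 1 := (Real.exp_lt_exp.2 (by linarith : θ - 1 < 0)).trans_eq Real.exp_zero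
  have hleft : ∀ N, ∀ y ∈ uIcc (-ε) ε, ‖carlemanFactor N b x p (Z (d, y))‖ ≤ r ^ N :=
    fun N y hy => by
      rw [uIcc_of_le (by linarith)] at hy
      rw [norm_carlemanFactor]
      refine pow_le_pow_left₀ (Real.exp_pos _).le (Real.exp_le_exp.2 (sub_le_sub_right ?_ 1)) N
      refine (Complex.re_le_norm _).trans ?_
      rw [Complex.norm_cpow_real]
      refine Real.rpow_le_rpow (norm_nonneg _) ?_ hp0.le
      rw [norm_div, Complex.norm_real, Real.norm_of_nonneg hxb.le, div_le_iff₀ hxb]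
      have e : Z (d, y) - b = (d : ℂ) * (((t - b : ℝ) : ℂ) + Complex.I * (y : ℂ)) := by
        simp [hZ, coneMap]
      rw [e, norm_mul, Complex.norm_real, Real.norm_of_nonneg hd0.le]
      have h2 : ‖((t - b : ℝ) : ℂ) + Complex.I * (y : ℂ)‖ ≤ R := by
        refine (norm_add_le _ _).trans ?_
        rw [hR, norm_mul, Complex.norm_I, one_mul, Complex.norm_real y, Real.norm_eq_abs]
        gcongr
        exact abs_le.2 hy
      calc d * _ ≤ d * R := by gcongr
        _ ≤ 1 / 2 * (x - b) := by linarith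
  have hslant : ∀ N, ∀ y, |y| = ε → ∀ s ∈ uIcc d 1,
      ‖carlemanFactor N b x p (Z (s, y))‖ ≤ r ^ N := fun N y hy s hs => by
    rw [uIcc_of_le hd1.le] at hs
    rw [norm_carlemanFactor, hp, hZ,
      re_cpow_slanted_side hbt hε hbx (hd0.trans_le hs.1) hy]
    refine pow_le_pow_left₀ (Real.exp_pos _).le (Real.exp_le_exp.2 (by linarith)) N
  have hxmem : openTriangle b t ε ∈ 𝓝 (x : ℂ) :=
    (isOpen_openTriangle b t ε).mem_nhds
      ⟨by simpa using hbx, by simpa using hxt, by simpa using mul_pos hε hxb⟩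
  have hxmem' : closedTriangleMinusVertex b t ε ∈ 𝓝 (x : ℂ) :=
    mem_of_superset hxmem (openTriangle_subset_closedTriangle b t ε)
  have hmid : ∀ N : ℕ, (∫ y in (-ε)..ε, U ((t : ℂ) + Complex.I * (y : ℂ)) *
      carlemanKernel N b t ε x y) = 2 * Real.pi * U x +
      ((∫ y in (-ε)..ε, ((d : ℂ) * (U (Z (d, y)) * (Z (d, y) - x)⁻¹)) *
          carlemanFactor N b x p (Z (d, y))) -
        (∫ s in d..1, (Complex.I * (((t - b : ℝ) : ℂ) + Complex.I * (ε : ℂ)) *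
          (U (Z (s, ε)) * (Z (s, ε) - x)⁻¹)) * carlemanFactor N b x p (Z (s, ε))) +
        ∫ s in d..1, (Complex.I * (((t - b : ℝ) : ℂ) + Complex.I * ((-ε : ℝ) : ℂ)) *
          (U (Z (s, -ε)) * (Z (s, -ε) - x)⁻¹)) * carlemanFactor N b x p (Z (s, -ε))) := fun N => by
    set Φ : ℂ → ℂ := fun z => U z * carlemanFactor N b x p z with hΦ
    have hΦx : Φ x = U x := by rw [hΦ]; simp [carlemanFactor_self N p hbx]
    have hΦd : DifferentiableOn ℂ Φ (openTriangle b t ε) := hU.mul fun z hz =>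
      (differentiableAt_carlemanFactor N p hbx hz.1).differentiableWithinAt
    have hΦc : ContinuousOn Φ (closedTriangleMinusVertex b t ε) := hUc.mul (hfacCont N)
    -- `dslope Φ x` has no pole at `x`, so Cauchy's theorem applies to it. Off `x` it equals `Φ z /
    -- (z - x) - U x / (z - x)`, and the winding number turns the second part into `2π U x`.
    have hzero := trapezoidIntegral_eq_zero hbt hε hd0 hd1
      ((Complex.differentiableOn_dslope hxmem).2 hΦd)
      ((continuousOn_dslope hxmem').2 ⟨hΦc, hΦd.differentiableAt hxmem⟩)
    have hwind := trapezoidIntegral_inv_sub (b := b) (ℓ := t - b) (x := x) hε hd0 hd1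
      (by linarith) (by linarith)
    have hval : ∀ z : ℂ, z - x ≠ 0 → dslope Φ (x : ℂ) z =
        Φ z * (z - x)⁻¹ - U x * (z - x)⁻¹ := fun z hz => by
      rw [dslope_of_ne _ (sub_ne_zero.1 hz), slope_def_field, hΦx, div_eq_mul_inv, sub_mul]
    have hYint : ∀ s, 0 < s → s ≤ 1 → s ≠ (x - b) / (t - b) → ∀ c : ℂ, ∀ G : ℂ → ℂ,
        ContinuousOn G (closedTriangleMinusVertex b t ε) →
        IntervalIntegrable (fun y => c * (G (Z (s, y)) * (Z (s, y) - x)⁻¹))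
          MeasureTheory.volume (-ε) ε := fun s h0 h1 h2 c G hG =>
      (continuousOn_const.mul ((hG.comp (hcY s).continuousOn (hsegY s h0 h1)).mul
        (((hcY s).sub continuous_const).continuousOn.inv₀ fun y _ =>
          hconeNe s y h0 (Or.inl h2)))).intervalIntegrable
    have hSint : ∀ y, |y| = ε → ∀ c : ℂ, ∀ G : ℂ → ℂ,
        ContinuousOn G (closedTriangleMinusVertex b t ε) →
        IntervalIntegrable (fun s => c * (G (Z (s, y)) * (Z (s, y) - x)⁻¹))
          MeasureTheory.volume d 1 := fun y hy c G hG => by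
      have hy0 : y ≠ 0 := fun h => by rw [h, abs_zero] at hy; linarith
      refine (continuousOn_const.mul ((hG.comp (hcS y).continuousOn ?_).mul
        (((hcS y).sub continuous_const).continuousOn.inv₀ fun s hs =>
          hconeNe s y ?_ (Or.inr hy0)))).intervalIntegrable
      · intro s hs
        rw [uIcc_of_le hd1.le] at hs
        exact coneMap_mem_closedTriangle hbt (hd0.trans_le hs.1) hs.2 hy.le
      · rw [uIcc_of_le hd1.le] at hs
        exact hd0.trans_le hs.1
    have hEpos : |ε| = ε := abs_of_pos hε
    have hEneg : |-ε| = ε := by rw [abs_neg, hEpos]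
    have hKc : ContinuousOn (fun _ : ℂ => U x) (closedTriangleMinusVertex b t ε) :=
      continuousOn_const
    have split1 : (∫ y in (-ε)..ε, dslope Φ (x : ℂ) (Z (1, y))) =
        (∫ y in (-ε)..ε, Φ (Z (1, y)) * (Z (1, y) - x)⁻¹) -
          U x * ∫ y in (-ε)..ε, (Z (1, y) - x)⁻¹ := by
      rw [← intervalIntegral.integral_const_mul, ← intervalIntegral.integral_sub
        (by simpa using hYint 1 one_pos le_rfl hs1 1 Φ hΦc)
        (by simpa using hYint 1 one_pos le_rfl hs1 1 _ hKc)]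
      exact intervalIntegral.integral_congr fun y _ =>
        hval _ (hconeNe 1 y one_pos (Or.inl hs1))
    have splitd : (∫ y in (-ε)..ε, (d : ℂ) * dslope Φ (x : ℂ) (Z (d, y))) =
        (∫ y in (-ε)..ε, (d : ℂ) * (Φ (Z (d, y)) * (Z (d, y) - x)⁻¹)) -
          U x * ∫ y in (-ε)..ε, (d : ℂ) * (Z (d, y) - x)⁻¹ := by
      rw [← intervalIntegral.integral_const_mul, ← intervalIntegral.integral_sub
        (hYint d hd0 hd1.le hds d Φ hΦc)
        (by simpa [mul_left_comm] using hYint d hd0 hd1.le hds d _ hKc)]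
      refine intervalIntegral.integral_congr fun y _ => ?_
      simp only [hval _ (hconeNe d y hd0 (Or.inl hds))]
      ring
    have splits : ∀ (y : ℝ) (c : ℂ), |y| = ε →
        (∫ s in d..1, c * dslope Φ (x : ℂ) (Z (s, y))) =
        (∫ s in d..1, c * (Φ (Z (s, y)) * (Z (s, y) - x)⁻¹)) -
          U x * ∫ s in d..1, c * (Z (s, y) - x)⁻¹ := fun y c hy => by
      have hy0 : y ≠ 0 := fun h => by rw [h, abs_zero] at hy; linarith
      rw [← intervalIntegral.integral_const_mul, ← intervalIntegral.integral_sub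
        (hSint y hy c Φ hΦc)
        (by simpa [mul_left_comm] using hSint y hy c _ hKc)]
      refine intervalIntegral.integral_congr fun s hs => ?_
      rw [uIcc_of_le hd1.le] at hs
      simp only [hval _ (hconeNe s y (hd0.trans_le hs.1) (Or.inr hy0))]
      ring
    rw [trapezoidIntegral, ← hZ, split1, splitd, splits ε _ hEpos, splits (-ε) _ hEneg] at hzero
    rw [trapezoidIntegral, ← hZ] at hwind
    have hvert : (∫ y in (-ε)..ε, U ((t : ℂ) + Complex.I * (y : ℂ)) *
        carlemanKernel N b t ε x y) = ∫ y in (-ε)..ε, Φ (Z (1, y)) * (Z (1, y) - x)⁻¹ := by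
      refine intervalIntegral.integral_congr fun y _ => ?_
      simp only [hker, hΦ, ← hZ1]
      ring
    have hre : ∀ (c z : ℂ), c * (U z * (z - x)⁻¹) * carlemanFactor N b x p z =
        c * (Φ z * (z - x)⁻¹) := fun c z => by rw [hΦ]; ring
    simp only [hre]
    rw [hvert]
    linear_combination hzero + U x * hwind
  have lim1 : Tendsto (fun N : ℕ => ∫ y in (-ε)..ε, ((d : ℂ) * (U (Z (d, y)) *
      (Z (d, y) - x)⁻¹)) * carlemanFactor N b x p (Z (d, y))) atTop (𝓝 0) := by
    refine tendsto_integral_mul_of_norm_le_pow hr0 hr1 ?_ hleft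
    exact continuousOn_const.mul ((hUc.comp (hcY d).continuousOn (hsegY d hd0 hd1.le)).mul
        (((hcY d).sub continuous_const).continuousOn.inv₀ fun y _ =>
          hconeNe d y hd0 (Or.inl hds)))
  have lim2 : ∀ (y : ℝ) (c : ℂ), |y| = ε → Tendsto (fun N : ℕ => ∫ s in d..1, (c * (U (Z (s, y)) *
      (Z (s, y) - x)⁻¹)) * carlemanFactor N b x p (Z (s, y))) atTop (𝓝 0) := fun y c hy => by
    have hy0 : y ≠ 0 := fun h => by rw [h, abs_zero] at hy; linarith
    refine tendsto_integral_mul_of_norm_le_pow hr0 hr1 ?_ fun N s hs => hslant N y hy s hs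
    refine continuousOn_const.mul ((hUc.comp (hcS y).continuousOn ?_).mul
        (((hcS y).sub continuous_const).continuousOn.inv₀ fun s hs =>
          hconeNe s y ?_ (Or.inr hy0)))
    · intro s hs
      rw [uIcc_of_le hd1.le] at hs
      exact coneMap_mem_closedTriangle hbt (hd0.trans_le hs.1) hs.2 hy.le
    · rw [uIcc_of_le hd1.le] at hs
      exact hd0.trans_le hs.1
  simp only [hmid]
  have hlim := ((((lim1.sub (lim2 ε (Complex.I * (((t - b : ℝ) : ℂ) + Complex.I * (ε : ℂ)))
    (abs_of_pos hε))).add (lim2 (-ε) (Complex.I * (((t - b : ℝ) : ℂ) +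
      Complex.I * ((-ε : ℝ) : ℂ))) (by rw [abs_neg, abs_of_pos hε]))).const_add
        (2 * Real.pi * U x)).const_mul (1 / (2 * (Real.pi : ℂ))))
  convert hlim using 2
  have : (Real.pi : ℂ) ≠ 0 := by exact_mod_cast Real.pi_ne_zero
  field_simp
  ring

/-! ### Identity theorem and boundary values on a side. -/

/-- Two holomorphic functions on a connected open set which agree near a point of a line agree. -/
theorem eqOn_of_eventuallyEq_line {G₁ G₂ : ℂ → ℂ} {O : Set ℂ} (hO : IsOpen O)
    (hconn : IsPreconnected O) (h₁ : DifferentiableOn ℂ G₁ O) (h₂ : DifferentiableOn ℂ G₂ O)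
    {γ : ℝ → ℂ} {s : ℝ} (hγ : ContinuousAt γ s) (hinj : Function.Injective γ) (hs : γ s ∈ O)
    (h : ∀ᶠ r in 𝓝 s, G₁ (γ r) = G₂ (γ r)) : EqOn G₁ G₂ O := by
  refine (h₁.analyticOnNhd hO).eqOn_of_preconnected_of_frequently_eq (h₂.analyticOnNhd hO) hconn hs ?_
  have ht : Tendsto γ (𝓝[≠] s) (𝓝[≠] (γ s)) :=
    tendsto_nhdsWithin_iff.2 ⟨hγ.tendsto.mono_left nhdsWithin_le_nhds,
      eventually_nhdsWithin_of_forall fun r hr => hinj.ne hr⟩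
  have h' : ∀ᶠ r in 𝓝[≠] s, G₁ (γ r) = G₂ (γ r) := nhdsWithin_le_nhds h
  exact ht.frequently h'.frequently

/-- Convexity makes the intersections of the triangle with discs connected, as the identity theorem
requires. -/
theorem convex_openTriangle (b t ε : ℝ) (hbt : b < t) : Convex ℝ (openTriangle b t ε) := by
  have hl : 0 < t - b := sub_pos.2 hbt
  intro z hz w hw α β hα hβ hαβ
  obtain ⟨z1, z2, z3⟩ := hz
  obtain ⟨w1, w2, w3⟩ := hw
  have hβ' : β = 1 - α := by linarith
  have hre : (α • z + β • w).re = α * z.re + β * w.re := by simp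
  have him : (α • z + β • w).im = α * z.im + β * w.im := by simp
  have hcomb : ∀ {p q : ℝ}, 0 < p → 0 < q → 0 < α * p + β * q := fun {p q} hp hq => by
    rcases hα.eq_or_lt with h | h
    · have : β = 1 := by linarith
      rw [← h, this]; linarith
    · have := mul_nonneg hβ hq.le
      have := mul_pos h hp
      linarith
  subst hβ'
  refine ⟨?_, ?_, ?_⟩
  · rw [hre]
    have := hcomb (sub_pos.2 z1) (sub_pos.2 w1)
    nlinarith
  · rw [hre]
    have := hcomb (sub_pos.2 z2) (sub_pos.2 w2)
    nlinarith
  · rw [hre, him]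
    have h1 : |α * z.im + (1 - α) * w.im| ≤ α * |z.im| + (1 - α) * |w.im| := by
      refine (abs_add_le _ _).trans ?_
      rw [abs_mul, abs_mul, abs_of_nonneg hα, abs_of_nonneg hβ]
    have h2 := hcomb (sub_pos.2 z3) (sub_pos.2 w3)
    have h3 := mul_le_mul_of_nonneg_right h1 hl.le
    nlinarith

/-- The ray from the vertex through a point of the open side approaches it from inside; limits
within the triangle are therefore unique there. -/
theorem mem_closure_openTriangle {b t ε y : ℝ} (hbt : b < t) (hy : |y| < ε) :
    (t : ℂ) + Complex.I * (y : ℂ) ∈ closure (openTriangle b t ε) := by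
  have hlim : Tendsto (fun s : ℝ => coneMap b (t - b) (s, y)) (𝓝[<] 1)
      (𝓝 ((t : ℂ) + Complex.I * (y : ℂ))) := by
    have hc : Continuous fun s : ℝ => coneMap b (t - b) (s, y) :=
      (continuous_coneMap b (t - b)).comp (Continuous.prodMk_left y)
    have h1 : coneMap b (t - b) (1, y) = (t : ℂ) + Complex.I * (y : ℂ) := by
      simp only [coneMap]; push_cast; ring
    rw [← h1]
    exact (hc.tendsto 1).mono_left nhdsWithin_le_nhds
  refine mem_closure_of_tendsto hlim ?_
  filter_upwards [Ioo_mem_nhdsLT (zero_lt_one' ℝ)] with s hs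
  exact coneMap_mem_openTriangle hbt hs.1 hs.2 hy

theorem edge_injective (t : ℝ) : Function.Injective fun y : ℝ => (t : ℂ) + Complex.I * (y : ℂ) :=
  fun y y' h => by
    have := congrArg Complex.im h
    simpa using this

theorem continuous_edge (t : ℝ) : Continuous fun y : ℝ => (t : ℂ) + Complex.I * (y : ℂ) := by
  fun_prop

/-- An analytic function on an interval of the line `Re z = t` has local holomorphic extensions. -/
theorem AnalyticAt.exists_edge_extension {Ψ : ℝ → ℂ} {y : ℝ} (t : ℝ) (h : AnalyticAt ℝ Ψ y) :
    ∃ G : ℂ → ℂ, AnalyticAt ℂ G ((t : ℂ) + Complex.I * (y : ℂ)) ∧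
      ∀ᶠ r : ℝ in 𝓝 y, G ((t : ℂ) + Complex.I * (r : ℂ)) = Ψ r := by
  obtain ⟨K, hK, hKe⟩ := h.exists_complexification_real
  have hrot : ∀ r : ℝ, -Complex.I * ((t : ℂ) + Complex.I * (r : ℂ) - t) = r := fun r => by
    linear_combination (-(r : ℂ)) * Complex.I_mul_I
  refine ⟨fun z => K (-Complex.I * (z - t)), ?_, ?_⟩
  · refine AnalyticAt.comp (g := K) ?_ (by fun_prop)
    rw [hrot]
    exact hK
  · filter_upwards [hKe] with r hr
    rw [hrot, hr]

/-- If a function which is holomorphic in a triangle and continuous up to the side `Re z = t`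
agrees near the middle of this side with a holomorphic extension of an analytic function on the
side, then its boundary values are that function. -/
theorem eq_on_edge_of_eventuallyEq {b t ε : ℝ} (hbt : b < t) (hε : 0 < ε) {U G : ℂ → ℂ} {Ψ : ℝ → ℂ}
    (hU : DifferentiableOn ℂ U (openTriangle b t ε))
    (hUc : ContinuousOn U (closedTriangleMinusVertex b t ε))
    (hΨ : ∀ y, |y| < ε → AnalyticAt ℝ Ψ y)
    (hG : AnalyticAt ℂ G t) (hGΨ : ∀ᶠ y : ℝ in 𝓝 0, G ((t : ℂ) + Complex.I * (y : ℂ)) = Ψ y)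
    (hUG : ∀ᶠ z in 𝓝[openTriangle b t ε] (t : ℂ), U z = G z) :
    ∀ y : ℝ, |y| < ε → U ((t : ℂ) + Complex.I * (y : ℂ)) = Ψ y := by
  set T := openTriangle b t ε with hT
  have hTo : IsOpen T := isOpen_openTriangle b t ε
  set w : ℝ → ℂ := fun y => (t : ℂ) + Complex.I * (y : ℂ) with hw
  have hwc : Continuous w := continuous_edge t
  -- Points of the side at which one holomorphic germ continues both `Ψ` along the side and `U` from
  -- inside. This set is open and contains `0`; it remains to see that it is relatively closed in
  -- `(-ε, ε)`.
  let A : Set ℝ := {y | ∃ K : ℂ → ℂ, AnalyticAt ℂ K (w y) ∧ (∀ᶠ r in 𝓝 y, K (w r) = Ψ r) ∧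
    ∀ᶠ z in 𝓝[T] (w y), U z = K z}
  have hA0 : (0 : ℝ) ∈ A := by
    refine ⟨G, ?_, hGΨ, ?_⟩ <;> simpa [hw]
  have hAo : IsOpen A := by
    rw [isOpen_iff_mem_nhds]
    rintro y ⟨K, h1, h2, h3⟩
    have h3' : ∀ᶠ p in 𝓝 (w y), ∀ᶠ z in 𝓝[T] p, U z = K z := by
      rw [eventually_nhdsWithin_iff] at h3
      filter_upwards [h3.eventually_nhds] with p hp
      exact eventually_nhdsWithin_iff.2 hp
    filter_upwards [hwc.continuousAt.eventually h1.eventually_analyticAt, h2.eventually_nhds,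
      hwc.continuousAt.eventually h3'] with r a1 a2 a3
    exact ⟨K, a1, a2, a3⟩
  have hsub : Ioo (-ε) ε ⊆ A := by
    refine isPreconnected_Ioo.subset_of_closure_inter_subset hAo ⟨0, ⟨by linarith, hε⟩, hA0⟩ ?_
    rintro y₀ ⟨hcl, hy₀⟩
    have hy₀' : |y₀| < ε := abs_lt.2 hy₀
    -- At a limit point `y₀` let `K₀` continue `Ψ`. At a nearby `y ∈ A` the germ `K` agrees with
    -- `K₀` on the side, hence near `w y`; so `U = K₀` near some interior point `z₁` of the
    -- triangle, and then on the whole convex intersection with the disc around `w y₀`.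
    obtain ⟨K₀, hK₀, hK₀Ψ⟩ := (hΨ y₀ hy₀').exists_edge_extension t
    obtain ⟨ρ, hρ, hball⟩ := Metric.eventually_nhds_iff_ball.1 hK₀.eventually_analyticAt
    have hK₀d : DifferentiableOn ℂ K₀ (Metric.ball (w y₀) ρ) := fun z hz =>
      (hball z hz).differentiableAt.differentiableWithinAt
    have hnear : ∀ᶠ y in 𝓝 y₀, |y| < ε ∧ w y ∈ Metric.ball (w y₀) ρ ∧ ∀ᶠ r in 𝓝 y, K₀ (w r) = Ψ r := by
      filter_upwards [(continuous_abs.continuousAt (x := y₀)).eventually (gt_mem_nhds hy₀'),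
        hwc.continuousAt.eventually (Metric.ball_mem_nhds (w y₀) hρ), hK₀Ψ.eventually_nhds]
        with y a1 a2 a3
      exact ⟨a1, a2, a3⟩
    obtain ⟨y, ⟨hyε, hyball, hyΨ⟩, K, hK, hKΨ, hKU⟩ := (mem_closure_iff_nhds.1 hcl) _ hnear
    obtain ⟨η, hη, hηball⟩ := Metric.eventually_nhds_iff_ball.1
      (hK.eventually_analyticAt.and (Metric.isOpen_ball.mem_nhds hyball))
    have hKK : EqOn K K₀ (Metric.ball (w y) η) :=
      eqOn_of_eventuallyEq_line Metric.isOpen_ball (convex_ball _ _).isPreconnected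
        (fun z hz => (hηball z hz).1.differentiableAt.differentiableWithinAt)
        (fun z hz => (hball z (hηball z hz).2).differentiableAt.differentiableWithinAt)
        hwc.continuousAt (edge_injective t) (Metric.mem_ball_self hη)
        (by filter_upwards [hKΨ, hyΨ] with r a1 a2; rw [a1, a2])
    have hev : ∀ᶠ z in 𝓝[T] (w y), z ∈ T ∧ z ∈ Metric.ball (w y₀) ρ ∧ U z = K₀ z := by
      filter_upwards [hKU, self_mem_nhdsWithin,
        nhdsWithin_le_nhds (Metric.ball_mem_nhds (w y) hη)] with z a1 a2 a3
      exact ⟨a2, (hηball z a3).2, a1.trans (hKK a3)⟩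
    have hne : (𝓝[T] (w y)).NeBot :=
      mem_closure_iff_nhdsWithin_neBot.1 (mem_closure_openTriangle hbt hyε)
    rw [eventually_nhdsWithin_iff] at hev
    obtain ⟨z₁, hz₁T, hz₁⟩ : ∃ z₁ ∈ T, ∀ᶠ z in 𝓝 z₁, z ∈ T → z ∈ T ∧ z ∈ Metric.ball (w y₀) ρ ∧
        U z = K₀ z := by
      have : ∀ᶠ z₁ in 𝓝[T] (w y), z₁ ∈ T ∧ ∀ᶠ z in 𝓝 z₁, z ∈ T → z ∈ T ∧
          z ∈ Metric.ball (w y₀) ρ ∧ U z = K₀ z :=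
        (eventually_mem_nhdsWithin).and (nhdsWithin_le_nhds hev.eventually_nhds)
      obtain ⟨z₁, h⟩ := this.exists
      exact ⟨z₁, h⟩
    have hz₁' : ∀ᶠ z in 𝓝 z₁, U z = K₀ z := by
      filter_upwards [hz₁, hTo.mem_nhds hz₁T] with z a1 a2
      exact (a1 a2).2.2
    have hEq : EqOn U K₀ (T ∩ Metric.ball (w y₀) ρ) := by
      have hO : IsOpen (T ∩ Metric.ball (w y₀) ρ) := hTo.inter Metric.isOpen_ball
      refine AnalyticOnNhd.eqOn_of_preconnected_of_eventuallyEq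
        ((hU.mono inter_subset_left).analyticOnNhd hO)
        ((hK₀d.mono inter_subset_right).analyticOnNhd hO)
        ((convex_openTriangle b t ε hbt).inter (convex_ball _ _)).isPreconnected
        ⟨hz₁T, (hz₁.self_of_nhds hz₁T).2.1⟩ hz₁'
    refine ⟨K₀, hK₀, hK₀Ψ, ?_⟩
    filter_upwards [self_mem_nhdsWithin, nhdsWithin_le_nhds (Metric.ball_mem_nhds (w y₀) hρ)]
      with z a1 a2
    exact hEq ⟨a1, a2⟩
  intro y hy
  obtain ⟨K, h1, h2, h3⟩ := hsub (abs_lt.1 hy)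
  have hne : (𝓝[T] (w y)).NeBot :=
    mem_closure_iff_nhdsWithin_neBot.1 (mem_closure_openTriangle hbt hy)
  have hmem : w y ∈ closedTriangleMinusVertex b t ε := by
    have := coneMap_mem_closedTriangle hbt one_pos le_rfl hy.le
    have h1 : coneMap b (t - b) (1, y) = w y := by
      simp only [coneMap, hw]; push_cast; ring
    rwa [h1] at this
  -- Both `U` and the germ `K` are continuous at the point of the side, so their limits from inside
  -- coincide.
  have lim1 : Tendsto U (𝓝[T] (w y)) (𝓝 (U (w y))) :=
    ((hUc (w y) hmem).mono (openTriangle_subset_closedTriangle b t ε)).tendsto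
  have lim2 : Tendsto K (𝓝[T] (w y)) (𝓝 (K (w y))) :=
    h1.continuousAt.tendsto.mono_left nhdsWithin_le_nhds
  have := tendsto_nhds_unique (lim1.congr' h3) lim2
  exact this.trans h2.self_of_nhds

/-! ### D'Alembert's formula for the complexified equation. -/

/-- The partial derivatives of a function of two complex variables. -/
noncomputable def partialFst (G : ℂ × ℂ → ℂ) (p : ℂ × ℂ) : ℂ := fderiv ℂ G p (1, 0)

/-- The partial derivative in the second variable. -/
noncomputable def partialSnd (G : ℂ × ℂ → ℂ) (p : ℂ × ℂ) : ℂ := fderiv ℂ G p (0, 1)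

theorem AnalyticAt.partialFst {G : ℂ × ℂ → ℂ} {p : ℂ × ℂ} (h : AnalyticAt ℂ G p) :
    AnalyticAt ℂ (partialFst G) p :=
  ((ContinuousLinearMap.apply ℂ ℂ ((1 : ℂ), (0 : ℂ))).analyticAt _).comp h.fderiv

theorem AnalyticAt.partialSnd {G : ℂ × ℂ → ℂ} {p : ℂ × ℂ} (h : AnalyticAt ℂ G p) :
    AnalyticAt ℂ (partialSnd G) p :=
  ((ContinuousLinearMap.apply ℂ ℂ ((0 : ℂ), (1 : ℂ))).analyticAt _).comp h.fderiv

theorem fderiv_apply_eq_partials {G : ℂ × ℂ → ℂ} {p : ℂ × ℂ} (α β : ℂ) :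
    fderiv ℂ G p (α, β) = α * partialFst G p + β * partialSnd G p := by
  have : ((α, β) : ℂ × ℂ) = α • ((1 : ℂ), (0 : ℂ)) + β • ((0 : ℂ), (1 : ℂ)) := by simp
  rw [this, map_add, map_smul, map_smul]
  rfl

/-- Chain rule along a real path. -/
theorem AnalyticAt.hasDerivAt_comp_path {G : ℂ × ℂ → ℂ} {γ₁ γ₂ : ℝ → ℂ} {α β : ℂ} {s : ℝ}
    (h : AnalyticAt ℂ G (γ₁ s, γ₂ s)) (h₁ : HasDerivAt γ₁ α s) (h₂ : HasDerivAt γ₂ β s) :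
    HasDerivAt (fun r => G (γ₁ r, γ₂ r))
      (α * _root_.partialFst G (γ₁ s, γ₂ s) + β * _root_.partialSnd G (γ₁ s, γ₂ s)) s := by
  rw [← fderiv_apply_eq_partials]
  have h3 := (h.differentiableAt.hasFDerivAt.restrictScalars ℝ).comp_hasDerivAt s (h₁.prodMk h₂)
  exact h3

theorem AnalyticAt.hasDerivAt_fst {G : ℂ × ℂ → ℂ} {z w : ℂ} (h : AnalyticAt ℂ G (z, w)) :
    HasDerivAt (fun z => G (z, w)) (_root_.partialFst G (z, w)) z :=
  h.differentiableAt.hasFDerivAt.comp_hasDerivAt z ((hasDerivAt_id z).prodMk (hasDerivAt_const z w))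

theorem AnalyticAt.hasDerivAt_snd {G : ℂ × ℂ → ℂ} {z w : ℂ} (h : AnalyticAt ℂ G (z, w)) :
    HasDerivAt (fun w => G (z, w)) (_root_.partialSnd G (z, w)) w :=
  h.differentiableAt.hasFDerivAt.comp_hasDerivAt w ((hasDerivAt_const w z).prodMk (hasDerivAt_id w))

theorem AnalyticAt.partialFst_partialSnd_comm {G : ℂ × ℂ → ℂ} {p : ℂ × ℂ} (h : AnalyticAt ℂ G p) :
    _root_.partialFst (_root_.partialSnd G) p = _root_.partialSnd (_root_.partialFst G) p := by
  have hs : IsSymmSndFDerivAt ℂ G p :=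
    (h.contDiffAt (n := 2)).isSymmSndFDerivAt (by simp)
  have hd : DifferentiableAt ℂ (fderiv ℂ G) p := h.fderiv.differentiableAt
  have key : ∀ v w : ℂ × ℂ, fderiv ℂ (fun q => fderiv ℂ G q v) p w = fderiv ℂ (fderiv ℂ G) p w v :=
    fun v w => by
      rw [fderiv_clm_apply hd (differentiableAt_const v)]
      simp
  have e1 := key (0, 1) (1, 0)
  have e2 := key (1, 0) (0, 1)
  rw [hs.eq] at e1
  exact e1.trans e2.symm

theorem Filter.EventuallyEq.partialSnd_eq {G K : ℂ × ℂ → ℂ} {p : ℂ × ℂ} (h : G =ᶠ[𝓝 p] K) :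
    _root_.partialSnd G p = _root_.partialSnd K p := by
  rw [_root_.partialSnd, _root_.partialSnd, h.fderiv_eq]

theorem Filter.EventuallyEq.partialFst_eq {G K : ℂ × ℂ → ℂ} {p : ℂ × ℂ} (h : G =ᶠ[𝓝 p] K) :
    _root_.partialFst G p = _root_.partialFst K p := by
  rw [_root_.partialFst, _root_.partialFst, h.fderiv_eq]

theorem AnalyticAt.exists_partialFst_primitive {G : ℂ × ℂ → ℂ} {p : ℂ × ℂ} (h : AnalyticAt ℂ G p) :
    ∃ V : ℂ × ℂ → ℂ, AnalyticAt ℂ V p ∧ _root_.partialFst V =ᶠ[𝓝 p] G := by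
  obtain ⟨V, hV, hVd⟩ := h.exists_primitive_fst
  refine ⟨V, hV, ?_⟩
  filter_upwards [hVd, hV.eventually_analyticAt] with q hq hq'
  exact (AnalyticAt.hasDerivAt_fst (z := q.1) (w := q.2) hq').unique hq

/-- D'Alembert's formula with a source term, for a function of two complex variables satisfying the
complexified Poisson equation. -/
theorem eventually_eq_dAlembert {v : ℂ × ℂ → ℂ} {F : ℝ × ℂ → ℂ} {u₀ u₁ : ℝ × ℝ → ℝ} {x₁ t : ℝ}
    (hv : AnalyticAt ℂ v ((x₁ : ℂ), (t : ℂ)))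
    (hpde : ∀ᶠ q in 𝓝 ((x₁ : ℝ), (t : ℂ)), partialFst (partialFst v) ((q.1 : ℂ), q.2) +
      partialSnd (partialSnd v) ((q.1 : ℂ), q.2) = F q)
    (h₀ : ∀ᶠ r : ℝ in 𝓝 x₁, v ((r : ℂ), (t : ℂ)) = (u₀ (r, t) : ℂ))
    (h₁ : ∀ᶠ r : ℝ in 𝓝 x₁, partialSnd v ((r : ℂ), (t : ℂ)) = (u₁ (r, t) : ℂ)) :
    ∀ᶠ y : ℝ in 𝓝 0, v ((x₁ : ℂ), (t : ℂ) + Complex.I * (y : ℂ)) =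
      sourceTerm F x₁ t y + dAlembertTerm u₀ u₁ x₁ t y := by
  -- With `∂₁A = ∂₂v` and `M = ∂₁v + ∂₂A`, symmetry of second derivatives gives `∂₁M = ∂₁²v + ∂₂²v =
  -- F`. So the integrals of `u₁` and of `F` over horizontal segments are differences of `A` and of
  -- `M`.
  obtain ⟨A, hA, hAv⟩ := hv.partialSnd.exists_partialFst_primitive
  set M : ℂ × ℂ → ℂ := fun p => partialFst v p + partialSnd A p with hM
  have hMa : AnalyticAt ℂ M ((x₁ : ℂ), (t : ℂ)) := hv.partialFst.add hA.partialSnd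
  have hgood : ∀ᶠ p in 𝓝 ((x₁ : ℂ), (t : ℂ)), AnalyticAt ℂ v p ∧ AnalyticAt ℂ A p ∧
      AnalyticAt ℂ M p ∧ partialFst A p = partialSnd v p ∧
      partialFst M p = partialFst (partialFst v) p + partialSnd (partialSnd v) p := by
    filter_upwards [hv.eventually_analyticAt, hA.eventually_analyticAt,
      hMa.eventually_analyticAt, hAv.eventuallyEq_nhds] with p a1 a2 a3 a4
    refine ⟨a1, a2, a3, a4.self_of_nhds, ?_⟩
    have e1 : partialFst M p = partialFst (partialFst v) p + partialFst (partialSnd A) p := by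
      change fderiv ℂ (fun q => partialFst v q + partialSnd A q) p (1, 0) = _
      rw [fderiv_fun_add a1.partialFst.differentiableAt a2.partialSnd.differentiableAt]
      rfl
    rw [e1, a2.partialFst_partialSnd_comm, a4.partialSnd_eq]
  obtain ⟨δ₁, hδ₁, hb₁⟩ := Metric.eventually_nhds_iff_ball.1 hgood
  obtain ⟨δ₂, hδ₂, hb₂⟩ := Metric.eventually_nhds_iff_ball.1 hpde
  obtain ⟨δ₃, hδ₃, hb₃⟩ := Metric.eventually_nhds_iff_ball.1 (h₀.and h₁)
  set δ := min δ₁ (min δ₂ δ₃) with hδ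
  have hδ0 : 0 < δ := lt_min hδ₁ (lt_min hδ₂ hδ₃)
  have hI : ∀ y : ℝ, ‖Complex.I * (y : ℂ)‖ = |y| := fun y => by simp
  have good : ∀ r y : ℝ, |r - x₁| < δ → |y| < δ →
      AnalyticAt ℂ v ((r : ℂ), (t : ℂ) + Complex.I * (y : ℂ)) ∧
      AnalyticAt ℂ A ((r : ℂ), (t : ℂ) + Complex.I * (y : ℂ)) ∧
      AnalyticAt ℂ M ((r : ℂ), (t : ℂ) + Complex.I * (y : ℂ)) ∧
      partialFst A ((r : ℂ), (t : ℂ) + Complex.I * (y : ℂ)) =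
        partialSnd v ((r : ℂ), (t : ℂ) + Complex.I * (y : ℂ)) ∧
      partialFst M ((r : ℂ), (t : ℂ) + Complex.I * (y : ℂ)) =
        F (r, (t : ℂ) + Complex.I * (y : ℂ)) := fun r y hr hy => by
    have m1 : ((r : ℂ), (t : ℂ) + Complex.I * (y : ℂ)) ∈ Metric.ball ((x₁ : ℂ), (t : ℂ)) δ₁ := by
      rw [Metric.mem_ball, dist_eq_norm, Prod.norm_def]
      refine max_lt ?_ ?_
      · simp only [Prod.fst_sub]
        rw [← Complex.ofReal_sub, Complex.norm_real, Real.norm_eq_abs]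
        exact hr.trans_le (min_le_left _ _)
      · simp only [Prod.snd_sub, add_sub_cancel_left]
        rw [hI]
        exact hy.trans_le (min_le_left _ _)
    have m2 : (r, (t : ℂ) + Complex.I * (y : ℂ)) ∈ Metric.ball (x₁, (t : ℂ)) δ₂ := by
      rw [Metric.mem_ball, dist_eq_norm, Prod.norm_def]
      refine max_lt ?_ ?_
      · simp only [Prod.fst_sub]
        rw [Real.norm_eq_abs]
        exact hr.trans_le ((min_le_right _ _).trans (min_le_left _ _))
      · simp only [Prod.snd_sub, add_sub_cancel_left]
        rw [hI]
        exact hy.trans_le ((min_le_right _ _).trans (min_le_left _ _))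
    obtain ⟨a1, a2, a3, a4, a5⟩ := hb₁ _ m1
    exact ⟨a1, a2, a3, a4, a5.trans (hb₂ _ m2)⟩
  have hret : ∀ r y : ℝ, HasDerivAt (fun r : ℝ => (r : ℂ)) 1 r := fun r _ =>
    Complex.ofRealCLM.hasDerivAt
  filter_upwards [Metric.ball_mem_nhds (0 : ℝ) hδ0] with y hy
  have hyδ : |y| < δ := by simpa using hy
  have hseg : ∀ s ∈ uIcc 0 y, |s| ≤ |y| ∧ |y - s| ≤ |y| := fun s hs => by
    have h1 := abs_sub_left_of_mem_uIcc hs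
    have h2 := abs_sub_right_of_mem_uIcc hs
    simp only [sub_zero] at h1 h2
    exact ⟨h1, h2⟩
  have hline : ∀ r y' : ℝ, |y'| < δ → |r - x₁| < δ → ∀ G H : ℂ × ℂ → ℂ,
      (∀ r' : ℝ, |r' - x₁| < δ → AnalyticAt ℂ G ((r' : ℂ), (t : ℂ) + Complex.I * (y' : ℂ)) ∧
        partialFst G ((r' : ℂ), (t : ℂ) + Complex.I * (y' : ℂ)) =
          H ((r' : ℂ), (t : ℂ) + Complex.I * (y' : ℂ))) →
      HasDerivAt (fun r : ℝ => G ((r : ℂ), (t : ℂ) + Complex.I * (y' : ℂ)))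
        (H ((r : ℂ), (t : ℂ) + Complex.I * (y' : ℂ))) r := fun r y' hy' hr G H h => by
    have := AnalyticAt.hasDerivAt_comp_path (γ₁ := fun r : ℝ => (r : ℂ))
      (γ₂ := fun _ => (t : ℂ) + Complex.I * (y' : ℂ)) (h r hr).1 (hret r 0) (hasDerivAt_const r _)
    rw [(h r hr).2] at this
    simpa using this
  have hsymm : ∀ s : ℝ, |s| < δ → ∀ r ∈ uIcc (x₁ - s) (x₁ + s), |r - x₁| < δ := fun s hs r hr => by
    have h1 : |r - x₁| ≤ |s| := by
      rw [mem_uIcc] at hr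
      rw [abs_le]
      have := neg_abs_le s
      have := le_abs_self s
      rcases hr with ⟨a, b⟩ | ⟨a, b⟩ <;> constructor <;> linarith
    linarith
  have hA_int : ∫ r in (x₁ - y)..(x₁ + y), (u₁ (r, t) : ℂ) =
      A (((x₁ + y : ℝ) : ℂ), (t : ℂ)) - A (((x₁ - y : ℝ) : ℂ), (t : ℂ)) := by
    have hd : ∀ r ∈ uIcc (x₁ - y) (x₁ + y),
        HasDerivAt (fun r : ℝ => A ((r : ℂ), (t : ℂ))) (partialSnd v ((r : ℂ), (t : ℂ))) r :=
      fun r hr => by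
        have := hline r 0 (by simpa using hδ0) (hsymm y hyδ r hr) A (partialSnd v)
          (fun r' hr' => ⟨(good r' 0 hr' (by simpa using hδ0)).2.1,
            (good r' 0 hr' (by simpa using hδ0)).2.2.2.1⟩)
        simpa using this
    have hcont : ContinuousOn (fun r : ℝ => partialSnd v ((r : ℂ), (t : ℂ)))
        (uIcc (x₁ - y) (x₁ + y)) := fun r hr => by
      have h1 := (good r 0 (hsymm y hyδ r hr) (by simpa using hδ0)).1.partialSnd.continuousAt
      simp only [Complex.ofReal_zero, mul_zero, add_zero] at h1
      exact (ContinuousAt.comp (f := fun r : ℝ => ((r : ℂ), (t : ℂ))) h1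
        (by fun_prop)).continuousWithinAt
    have heq : ∀ r ∈ uIcc (x₁ - y) (x₁ + y), (u₁ (r, t) : ℂ) = partialSnd v ((r : ℂ), (t : ℂ)) :=
      fun r hr => ((hb₃ r (by
        rw [Metric.mem_ball, Real.dist_eq]
        exact (hsymm y hyδ r hr).trans_le ((min_le_right _ _).trans (min_le_right _ _)))).2).symm
    rw [intervalIntegral.integral_congr heq]
    exact intervalIntegral.integral_eq_sub_of_hasDerivAt hd hcont.intervalIntegrable
  have hM_int : ∀ s ∈ uIcc 0 y, ∫ r in (x₁ - s)..(x₁ + s),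
      F (r, (t : ℂ) + Complex.I * ((y - s : ℝ) : ℂ)) =
      M (((x₁ + s : ℝ) : ℂ), (t : ℂ) + Complex.I * ((y - s : ℝ) : ℂ)) -
        M (((x₁ - s : ℝ) : ℂ), (t : ℂ) + Complex.I * ((y - s : ℝ) : ℂ)) := fun s hs => by
    have hsδ : |s| < δ := (hseg s hs).1.trans_lt hyδ
    have hysδ : |y - s| < δ := (hseg s hs).2.trans_lt hyδ
    have hd : ∀ r ∈ uIcc (x₁ - s) (x₁ + s), HasDerivAt
        (fun r : ℝ => M ((r : ℂ), (t : ℂ) + Complex.I * ((y - s : ℝ) : ℂ)))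
        (partialFst M ((r : ℂ), (t : ℂ) + Complex.I * ((y - s : ℝ) : ℂ))) r := fun r hr =>
      hline r (y - s) hysδ (hsymm s hsδ r hr) M (partialFst M)
        (fun r' hr' => ⟨(good r' _ hr' hysδ).2.2.1, rfl⟩)
    have hcont : ContinuousOn (fun r : ℝ => partialFst M ((r : ℂ), (t : ℂ) +
        Complex.I * ((y - s : ℝ) : ℂ))) (uIcc (x₁ - s) (x₁ + s)) := fun r hr =>
      (ContinuousAt.comp (f := fun r : ℝ => ((r : ℂ), (t : ℂ) + Complex.I * ((y - s : ℝ) : ℂ)))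
        (good r _ (hsymm s hsδ r hr) hysδ).2.2.1.partialFst.continuousAt
        (by fun_prop)).continuousWithinAt
    rw [← intervalIntegral.integral_eq_sub_of_hasDerivAt hd hcont.intervalIntegrable]
    exact intervalIntegral.integral_congr fun r hr =>
      ((good r _ (hsymm s hsδ r hr) hysδ).2.2.2.2).symm
  -- The two characteristics, for `σ = ±1`, which start at `(x₁, t + iy)` for `s = 0` and reach `(x₁
  -- ± y, t)` for `s = y`.
  let P : ℝ → ℝ → ℂ × ℂ := fun σ s => (((x₁ + σ * s : ℝ) : ℂ), (t : ℂ) + Complex.I * ((y - s : ℝ) : ℂ))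
  have hP1 : ∀ σ s : ℝ, HasDerivAt (fun s : ℝ => ((x₁ + σ * s : ℝ) : ℂ)) (σ : ℂ) s := fun σ s => by
    have := (((hasDerivAt_id s).const_mul σ).const_add x₁).ofReal_comp
    simpa using this
  have hP2 : ∀ s : ℝ, HasDerivAt (fun s : ℝ => (t : ℂ) + Complex.I * ((y - s : ℝ) : ℂ))
      (-Complex.I) s := fun s => by
    have := ((((hasDerivAt_id s).const_sub y).ofReal_comp).const_mul Complex.I).const_add (t : ℂ)
    simpa using this
  have hPc : ∀ σ, Continuous (P σ) := fun σ => by fun_prop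
  have hgoodP : ∀ σ : ℝ, |σ| = 1 → ∀ s ∈ uIcc 0 y, AnalyticAt ℂ v (P σ s) ∧ AnalyticAt ℂ A (P σ s) ∧
      AnalyticAt ℂ M (P σ s) ∧ partialFst A (P σ s) = partialSnd v (P σ s) := fun σ hσ s hs => by
    have h1 : |x₁ + σ * s - x₁| < δ := by
      rw [add_sub_cancel_left, abs_mul, hσ, one_mul]
      exact (hseg s hs).1.trans_lt hyδ
    obtain ⟨a1, a2, a3, a4, _⟩ := good (x₁ + σ * s) (y - s) h1 ((hseg s hs).2.trans_lt hyδ)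
    exact ⟨a1, a2, a3, a4⟩
  have hone : |(1 : ℝ)| = 1 := abs_one
  have hneg : |(-1 : ℝ)| = 1 := by simp
  -- `Q` interpolates between `v (x₁, t + iy)` at `s = 0` and the d'Alembert term at `s = y`. In
  -- `Q'` the terms with `∂₂v = ∂₁A` cancel, which leaves `(M (P 1 s) - M (P (-1) s)) / 2`, half of
  -- the inner integral of the source.
  let Q : ℝ → ℂ := fun s => (v (P 1 s) + v (P (-1) s)) / 2 +
    Complex.I / 2 * (A (P 1 s) - A (P (-1) s))
  have hQ : ∀ s ∈ uIcc 0 y, HasDerivAt Q ((1 / 2 : ℂ) * (M (P 1 s) - M (P (-1) s))) s :=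
    fun s hs => by
      obtain ⟨a1, a2, _, a4⟩ := hgoodP 1 hone s hs
      obtain ⟨b1, b2, _, b4⟩ := hgoodP (-1) hneg s hs
      have d1 := a1.hasDerivAt_comp_path (hP1 1 s) (hP2 s)
      have d2 := b1.hasDerivAt_comp_path (hP1 (-1) s) (hP2 s)
      have d3 := a2.hasDerivAt_comp_path (hP1 1 s) (hP2 s)
      have d4 := b2.hasDerivAt_comp_path (hP1 (-1) s) (hP2 s)
      have h := ((d1.add d2).div_const 2).add ((d3.sub d4).const_mul (Complex.I / 2))
      refine h.congr_deriv ?_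
      change _ = (1 / 2 : ℂ) * ((partialFst v (P 1 s) + partialSnd A (P 1 s)) -
        (partialFst v (P (-1) s) + partialSnd A (P (-1) s)))
      change ((((1 : ℝ) : ℂ) * partialFst v (P 1 s) + -Complex.I * partialSnd v (P 1 s)) +
        (((-1 : ℝ) : ℂ) * partialFst v (P (-1) s) + -Complex.I * partialSnd v (P (-1) s))) / 2 +
        Complex.I / 2 * ((((1 : ℝ) : ℂ) * partialFst A (P 1 s) + -Complex.I * partialSnd A (P 1 s))
        - (((-1 : ℝ) : ℂ) * partialFst A (P (-1) s) + -Complex.I * partialSnd A (P (-1) s))) = _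
      rw [a4, b4]
      push_cast
      linear_combination (-(partialSnd A (P 1 s) - partialSnd A (P (-1) s)) / 2) * Complex.I_mul_I
  have hQc : ContinuousOn (fun s => (1 / 2 : ℂ) * (M (P 1 s) - M (P (-1) s))) (uIcc 0 y) :=
    continuousOn_const.mul (ContinuousOn.sub
      (fun s hs => ((hgoodP 1 hone s hs).2.2.1.continuousAt.comp
        (hPc 1).continuousAt).continuousWithinAt)
      (fun s hs => ((hgoodP (-1) hneg s hs).2.2.1.continuousAt.comp
        (hPc (-1)).continuousAt).continuousWithinAt))
  have hFTC := intervalIntegral.integral_eq_sub_of_hasDerivAt hQ hQc.intervalIntegrable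
  have hsrc : sourceTerm F x₁ t y = -∫ s in (0 : ℝ)..y, (1 / 2 : ℂ) * (M (P 1 s) - M (P (-1) s)) := by
    rw [sourceTerm, intervalIntegral.integral_const_mul, neg_mul]
    congr 2
    refine intervalIntegral.integral_congr fun s hs => ?_
    rw [hM_int s hs]
    simp only [P, one_mul, neg_one_mul, sub_eq_add_neg]
  have hQ0 : Q 0 = v ((x₁ : ℂ), (t : ℂ) + Complex.I * (y : ℂ)) := by
    simp [Q, P]
  have hQy : Q y = dAlembertTerm u₀ u₁ x₁ t y := by
    have hmem : ∀ r : ℝ, |r - x₁| < δ → r ∈ Metric.ball x₁ δ₃ := fun r hr => by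
      rw [Metric.mem_ball, Real.dist_eq]
      exact hr.trans_le ((min_le_right _ _).trans (min_le_right _ _))
    have e1 := (hb₃ (x₁ + y) (hmem _ (by simpa using hyδ))).1
    have e2 := (hb₃ (x₁ - y) (hmem _ (by simpa using hyδ))).1
    rw [dAlembertTerm, hA_int, ← e1, ← e2]
    simp [Q, P, sub_eq_add_neg]
  rw [hsrc, hFTC, hQ0, hQy]
  ring

/-! ### From the real equation to the complexified one. -/

theorem AnalyticAt.real_slice_fst {g : ℝ × ℝ → ℝ} {p : ℝ × ℝ} (h : AnalyticAt ℝ g p) :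
    HasDerivAt (fun s => g (s, p.2)) (fderiv ℝ g p (1, 0)) p.1 :=
  HasFDerivAt.comp_hasDerivAt (f := fun s : ℝ => (s, p.2)) p.1 h.differentiableAt.hasFDerivAt
    ((hasDerivAt_id p.1).prodMk (hasDerivAt_const p.1 p.2))

theorem AnalyticAt.real_slice_snd {g : ℝ × ℝ → ℝ} {p : ℝ × ℝ} (h : AnalyticAt ℝ g p) :
    HasDerivAt (fun s => g (p.1, s)) (fderiv ℝ g p (0, 1)) p.2 :=
  HasFDerivAt.comp_hasDerivAt (f := fun s : ℝ => (p.1, s)) p.2 h.differentiableAt.hasFDerivAt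
    ((hasDerivAt_const p.2 p.1).prodMk (hasDerivAt_id p.2))

theorem AnalyticAt.real_partial {g : ℝ × ℝ → ℝ} {p : ℝ × ℝ} (h : AnalyticAt ℝ g p) (w : ℝ × ℝ) :
    AnalyticAt ℝ (fun q => fderiv ℝ g q w) p :=
  ((ContinuousLinearMap.apply ℝ ℝ w).analyticAt _).comp h.fderiv

theorem partialTwo_eq_fderiv {u : ℝ × ℝ → ℝ} {p : ℝ × ℝ} (h : AnalyticAt ℝ u p) :
    partialTwo u p = fderiv ℝ u p (0, 1) :=
  h.real_slice_snd.deriv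

theorem eventually_slice_fst {P : ℝ × ℝ → Prop} {p : ℝ × ℝ} (h : ∀ᶠ q in 𝓝 p, P q) :
    ∀ᶠ s in 𝓝 p.1, P (s, p.2) :=
  ((Continuous.prodMk_left p.2).tendsto p.1).eventually h

theorem eventually_slice_snd {P : ℝ × ℝ → Prop} {p : ℝ × ℝ} (h : ∀ᶠ q in 𝓝 p, P q) :
    ∀ᶠ s in 𝓝 p.2, P (p.1, s) :=
  ((Continuous.prodMk_right p.1).tendsto p.2).eventually h

theorem planarLaplacian_eq_fderiv {u : ℝ × ℝ → ℝ} {p : ℝ × ℝ} (h : AnalyticAt ℝ u p) :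
    planarLaplacian u p = fderiv ℝ (fun q => fderiv ℝ u q (1, 0)) p (1, 0) +
      fderiv ℝ (fun q => fderiv ℝ u q (0, 1)) p (0, 1) := by
  rw [planarLaplacian, iteratedDeriv_succ, iteratedDeriv_one, iteratedDeriv_succ, iteratedDeriv_one]
  congr 1
  · rw [← (h.real_partial (1, 0)).real_slice_fst.deriv]
    refine Filter.EventuallyEq.deriv_eq ?_
    filter_upwards [eventually_slice_fst h.eventually_analyticAt] with s hs
    exact hs.real_slice_fst.deriv
  · rw [← (h.real_partial (0, 1)).real_slice_snd.deriv]
    refine Filter.EventuallyEq.deriv_eq ?_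
    filter_upwards [eventually_slice_snd h.eventually_analyticAt] with s hs
    exact hs.real_slice_snd.deriv

/-- Partial derivatives commute with complexification. -/
theorem eventually_partialFst_eq {G : ℂ × ℂ → ℂ} {g : ℝ × ℝ → ℝ} {p : ℝ × ℝ}
    (hG : AnalyticAt ℂ G ((p.1 : ℂ), (p.2 : ℂ))) (hg : AnalyticAt ℝ g p)
    (h : ∀ᶠ q in 𝓝 p, G ((q.1 : ℂ), (q.2 : ℂ)) = (g q : ℂ)) :
    ∀ᶠ q in 𝓝 p, partialFst G ((q.1 : ℂ), (q.2 : ℂ)) = ((fderiv ℝ g q (1, 0) : ℝ) : ℂ) := by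
  have hc : Continuous fun q : ℝ × ℝ => ((q.1 : ℂ), (q.2 : ℂ)) := by fun_prop
  filter_upwards [h.eventually_nhds, hg.eventually_analyticAt,
    hc.continuousAt.eventually hG.eventually_analyticAt] with q a1 a2 a3
  have d1 := a3.hasDerivAt_comp_path (γ₁ := fun s : ℝ => (s : ℂ)) (γ₂ := fun _ => (q.2 : ℂ))
    Complex.ofRealCLM.hasDerivAt (hasDerivAt_const q.1 _)
  have d2 := a2.real_slice_fst.ofReal_comp
  have heq : (fun s : ℝ => G ((s : ℂ), (q.2 : ℂ))) =ᶠ[𝓝 q.1] fun s => ((g (s, q.2) : ℝ) : ℂ) :=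
    eventually_slice_fst a1
  have := (d2.congr_of_eventuallyEq heq).unique d1
  simpa using this.symm

theorem eventually_partialSnd_eq {G : ℂ × ℂ → ℂ} {g : ℝ × ℝ → ℝ} {p : ℝ × ℝ}
    (hG : AnalyticAt ℂ G ((p.1 : ℂ), (p.2 : ℂ))) (hg : AnalyticAt ℝ g p)
    (h : ∀ᶠ q in 𝓝 p, G ((q.1 : ℂ), (q.2 : ℂ)) = (g q : ℂ)) :
    ∀ᶠ q in 𝓝 p, partialSnd G ((q.1 : ℂ), (q.2 : ℂ)) = ((fderiv ℝ g q (0, 1) : ℝ) : ℂ) := by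
  have hc : Continuous fun q : ℝ × ℝ => ((q.1 : ℂ), (q.2 : ℂ)) := by fun_prop
  filter_upwards [h.eventually_nhds, hg.eventually_analyticAt,
    hc.continuousAt.eventually hG.eventually_analyticAt] with q a1 a2 a3
  have d1 := a3.hasDerivAt_comp_path (γ₁ := fun _ => (q.1 : ℂ)) (γ₂ := fun s : ℝ => (s : ℂ))
    (hasDerivAt_const q.2 _) Complex.ofRealCLM.hasDerivAt
  have d2 := a2.real_slice_snd.ofReal_comp
  have heq : (fun s : ℝ => G ((q.1 : ℂ), (s : ℂ))) =ᶠ[𝓝 q.2] fun s => ((g (q.1, s) : ℝ) : ℂ) :=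
    eventually_slice_snd a1
  have := (d2.congr_of_eventuallyEq heq).unique d1
  simpa using this.symm

theorem eventually_laplacian_eq {G : ℂ × ℂ → ℂ} {g : ℝ × ℝ → ℝ} {p : ℝ × ℝ}
    (hG : AnalyticAt ℂ G ((p.1 : ℂ), (p.2 : ℂ))) (hg : AnalyticAt ℝ g p)
    (h : ∀ᶠ q in 𝓝 p, G ((q.1 : ℂ), (q.2 : ℂ)) = (g q : ℂ)) :
    ∀ᶠ q in 𝓝 p, partialFst (partialFst G) ((q.1 : ℂ), (q.2 : ℂ)) +
      partialSnd (partialSnd G) ((q.1 : ℂ), (q.2 : ℂ)) = ((planarLaplacian g q : ℝ) : ℂ) := by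
  filter_upwards [eventually_partialFst_eq hG.partialFst (hg.real_partial (1, 0))
      (eventually_partialFst_eq hG hg h),
    eventually_partialSnd_eq hG.partialSnd (hg.real_partial (0, 1))
      (eventually_partialSnd_eq hG hg h), hg.eventually_analyticAt] with q a1 a2 a3
  rw [planarLaplacian_eq_fderiv a3, a1, a2]
  push_cast
  rfl

theorem isOpen_stripDomain {a c : ℝ} {bot top : ℝ → ℝ} (hbot : ContinuousOn bot (Ioo a c))
    (htop : ContinuousOn top (Ioo a c)) : IsOpen (stripDomain a c bot top) := by
  rw [isOpen_iff_mem_nhds]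
  rintro p ⟨h1, h2, h3⟩
  have hn : Ioo a c ∈ 𝓝 p.1 := isOpen_Ioo.mem_nhds h1
  have hb : ContinuousAt (fun q : ℝ × ℝ => bot q.1) p :=
    ContinuousAt.comp (g := bot) (hbot.continuousAt hn) continuousAt_fst
  have ht : ContinuousAt (fun q : ℝ × ℝ => top q.1) p :=
    ContinuousAt.comp (g := top) (htop.continuousAt hn) continuousAt_fst
  filter_upwards [continuousAt_fst.eventually hn, hb.eventually_lt continuousAt_snd h2,
    continuousAt_snd.eventually_lt ht h3] with q a1 a2 a3
  exact ⟨a1, a2, a3⟩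

/-- The complexified Poisson equation extends from real points below a boundary point to a full
complex neighbourhood of it. -/
theorem eventually_complex_poisson {v : ℂ × ℂ → ℂ} {F : ℝ × ℂ → ℂ} {X : Set (ℝ × ℝ)}
    {f u : ℝ × ℝ → ℝ} {x₁ t : ℝ} (hX : IsOpen X)
    (hXt : ∃ᶠ s in 𝓝 t, (x₁, s) ∈ X)
    (hv : AnalyticAt ℂ v ((x₁ : ℂ), (t : ℂ))) (hu : AnalyticAt ℝ u (x₁, t))
    (hvu : ∀ᶠ q in 𝓝 ((x₁, t) : ℝ × ℝ), v ((q.1 : ℂ), (q.2 : ℂ)) = (u q : ℂ))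
    (heq : ∀ x ∈ X, planarLaplacian u x = f x)
    (hF : ∀ᶠ q in 𝓝 ((x₁ : ℝ), (t : ℂ)), DifferentiableAt ℂ (fun z : ℂ => F (q.1, z)) q.2)
    (hFf : ∀ᶠ x in 𝓝 ((x₁, t) : ℝ × ℝ), F (x.1, (x.2 : ℂ)) = (f x : ℂ)) :
    ∀ᶠ q in 𝓝 ((x₁ : ℝ), (t : ℂ)), partialFst (partialFst v) ((q.1 : ℂ), q.2) +
      partialSnd (partialSnd v) ((q.1 : ℂ), q.2) = F q := by
  have hLap := eventually_laplacian_eq (p := (x₁, t)) hv hu hvu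
  have hcast : Continuous fun q : ℝ × ℂ => ((q.1 : ℂ), q.2) := by fun_prop
  have hva : ∀ᶠ q in 𝓝 ((x₁ : ℝ), (t : ℂ)), AnalyticAt ℂ v ((q.1 : ℂ), q.2) :=
    (hcast.continuousAt (x := ((x₁ : ℝ), (t : ℂ)))).eventually hv.eventually_analyticAt
  obtain ⟨δ, hδ, hball⟩ := Metric.eventually_nhds_iff_ball.1 (hva.and hF)
  obtain ⟨η, hη, hηball⟩ := Metric.eventually_nhds_iff_ball.1 (hLap.and hFf)
  have hmin : 0 < min δ η := lt_min hδ hη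
  obtain ⟨s, hsX, hs⟩ : ∃ s, (x₁, s) ∈ X ∧ |s - t| < min δ η := by
    have h1 : ∀ᶠ s in 𝓝 t, |s - t| < min δ η := Metric.ball_mem_nhds t hmin
    exact (hXt.and_eventually h1).exists
  obtain ⟨κ, hκ, hκX⟩ := Metric.isOpen_iff.1 hX _ hsX
  have hr : ∀ᶠ q : ℝ × ℂ in 𝓝 (x₁, (t : ℂ)), |q.1 - x₁| < min κ (min δ η) ∧ ‖q.2 - t‖ < δ := by
    have h1 : ∀ᶠ r in 𝓝 x₁, |r - x₁| < min κ (min δ η) := Metric.ball_mem_nhds x₁ (lt_min hκ hmin)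
    have h2 : ∀ᶠ z : ℂ in 𝓝 (t : ℂ), ‖z - t‖ < δ := by
      filter_upwards [Metric.ball_mem_nhds (t : ℂ) hδ] with z hz
      exact mem_ball_iff_norm.1 hz
    exact h1.prod_nhds h2
  filter_upwards [hr] with q hq
  obtain ⟨r, z⟩ := q
  obtain ⟨hr1, hz⟩ := hq
  simp only at hr1 hz ⊢
  have hrκ := hr1.trans_le (min_le_left _ _)
  have hrδ := hr1.trans_le ((min_le_right _ _).trans (min_le_left _ _))
  have hrη := hr1.trans_le ((min_le_right _ _).trans (min_le_right _ _))
  have hmem : ∀ w ∈ Metric.ball (t : ℂ) δ, (r, w) ∈ Metric.ball (x₁, (t : ℂ)) δ := fun w hw => by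
    rw [Metric.mem_ball, dist_eq_norm, Prod.norm_def]
    exact max_lt hrδ (mem_ball_iff_norm.1 hw)
  -- The real equation is known only on `X`, which need not contain `(x₁, t)`. For each fixed real
  -- `r` near `x₁` both sides are holomorphic in `w` on a disc around `t` and agree at real points
  -- near `s`, where `(r, s)` lies in `X`; hence they agree on the disc.
  have key : EqOn (fun w => partialFst (partialFst v) ((r : ℂ), w) +
      partialSnd (partialSnd v) ((r : ℂ), w)) (fun w => F (r, w)) (Metric.ball (t : ℂ) δ) := by
    refine eqOn_of_eventuallyEq_line (γ := fun s : ℝ => (s : ℂ)) (s := s) Metric.isOpen_ball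
      (convex_ball _ _).isPreconnected (fun w hw => ?_) (fun w hw => ?_)
      Complex.continuous_ofReal.continuousAt Complex.ofReal_injective ?_ ?_
    · have ha := (hball _ (hmem w hw)).1
      exact (ha.partialFst.partialFst.hasDerivAt_snd.differentiableAt.add
        ha.partialSnd.partialSnd.hasDerivAt_snd.differentiableAt).differentiableWithinAt
    · exact (hball _ (hmem w hw)).2.differentiableWithinAt
    · rw [mem_ball_iff_norm, ← Complex.ofReal_sub, Complex.norm_real]
      exact hs.trans_le (min_le_left _ _)
    · have h1 : ∀ᶠ s' in 𝓝 s, |s' - s| < κ := Metric.ball_mem_nhds s hκ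
      have h2 : ∀ᶠ s' in 𝓝 s, |s' - t| < η :=
        (Metric.isOpen_ball (x := t) (ε := η)).mem_nhds (hs.trans_le (min_le_right _ _))
      filter_upwards [h1, h2] with s' a1 a2
      have m1 : (r, s') ∈ X := hκX (by
        rw [Metric.mem_ball, dist_eq_norm, Prod.norm_def]; exact max_lt hrκ a1)
      have m2 : (r, s') ∈ Metric.ball (x₁, t) η := by
        rw [Metric.mem_ball, dist_eq_norm, Prod.norm_def]; exact max_lt hrη a2
      have m3 := hηball _ m2
      rw [m3.1, m3.2, heq _ m1]
  exact key (mem_ball_iff_norm.2 hz)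

/-! ### Boundary values of the extension. -/

/-- Analyticity on all of `|y| < ε` is what allows the formula, first known near `y = 0`, to
propagate along the side. -/
theorem analyticAt_dAlembertTerm {u₀ u₁ : ℝ × ℝ → ℝ} {x₁ t ε y : ℝ} (hy : |y| < ε)
    (h₀ : ∀ r, |r - x₁| < ε → AnalyticAt ℝ u₀ (r, t))
    (h₁ : ∀ r, |r - x₁| < ε → AnalyticAt ℝ u₁ (r, t)) :
    AnalyticAt ℝ (fun y => dAlembertTerm u₀ u₁ x₁ t y) y := by
  have hof : ∀ {E : Type} [NormedAddCommGroup E] [NormedSpace ℝ E] {g : E → ℝ} {e : E},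
      AnalyticAt ℝ g e → AnalyticAt ℝ (fun e => (g e : ℂ)) e := fun hg =>
    (Complex.ofRealCLM.analyticAt _).comp hg
  have hp : AnalyticAt ℝ (fun y : ℝ => x₁ + y) y := by fun_prop
  have hm : AnalyticAt ℝ (fun y : ℝ => x₁ - y) y := by fun_prop
  have e1 : AnalyticAt ℝ (fun y => u₀ (x₁ + y, t)) y :=
    AnalyticAt.comp (f := fun y => (x₁ + y, t)) (h₀ (x₁ + y) (by simpa using hy))
      (hp.prod analyticAt_const)
  have e2 : AnalyticAt ℝ (fun y => u₀ (x₁ - y, t)) y :=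
    AnalyticAt.comp (f := fun y => (x₁ - y, t)) (h₀ (x₁ - y) (by simpa using hy))
      (hm.prod analyticAt_const)
  have e3 : AnalyticAt ℝ (fun y => ∫ r in (x₁ - y)..(x₁ + y), (u₁ (r, t) : ℂ)) y := by
    refine AnalyticAt.parametric_intervalIntegral (H := fun p : ℝ × ℝ => (u₁ (p.1, t) : ℂ)) hm hp
      fun r hr => hof (AnalyticAt.comp (f := fun p : ℝ × ℝ => (p.1, t)) (h₁ r ?_)
        (analyticAt_fst.prod analyticAt_const))
    refine lt_of_le_of_lt ?_ hy
    have := neg_abs_le y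
    have := le_abs_self y
    rw [abs_le]
    rcases mem_uIcc.1 hr with ⟨a, b⟩ | ⟨a, b⟩ <;> constructor <;> linarith
  exact (((hof e1).add (hof e2)).div analyticAt_const two_ne_zero).add (analyticAt_const.mul e3)

/-- For `s` between `0` and `y` one has `|s| + |y - s| = |y| < ε`, so the inner segment stays in the
characteristic square. The parametric integral lemma is then used twice, for the inner and the outer
integral. -/
theorem analyticAt_sourceTerm {F : ℝ × ℂ → ℂ} {x₁ t ε y : ℝ} (hy : |y| < ε)
    (hF : AnalyticOnNhd ℝ F (characteristicSquare x₁ t ε)) :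
    AnalyticAt ℝ (fun y => sourceTerm F x₁ t y) y := by
  have inner : ∀ s ∈ uIcc 0 y, AnalyticAt ℝ (fun p : ℝ × ℝ => ∫ r in (x₁ - p.1)..(x₁ + p.1),
      F (r, (t : ℂ) + Complex.I * ((p.2 - p.1 : ℝ) : ℂ))) (s, y) := fun s hs => by
    have hsy : |s| + |y - s| ≤ |y| := by
      rcases le_total 0 y with h | h
      · rw [uIcc_of_le h] at hs
        rw [abs_of_nonneg h, abs_of_nonneg hs.1, abs_of_nonneg (by linarith [hs.2])]
        linarith
      · rw [uIcc_of_ge h] at hs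
        rw [abs_of_nonpos h, abs_of_nonpos hs.2, abs_of_nonpos (by linarith [hs.1])]
        linarith
    refine AnalyticAt.parametric_intervalIntegral
      (H := fun q : ℝ × (ℝ × ℝ) => F (q.1, (t : ℂ) + Complex.I * ((q.2.2 - q.2.1 : ℝ) : ℂ)))
      (analyticAt_const.sub analyticAt_fst) (analyticAt_const.add analyticAt_fst) fun r hr => ?_
    have hmem : (r, (t : ℂ) + Complex.I * ((y - s : ℝ) : ℂ)) ∈ characteristicSquare x₁ t ε := by
      refine ⟨by simp, ?_⟩
      have h1 : |r - x₁| ≤ |s| := by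
        have := neg_abs_le s
        have := le_abs_self s
        rw [abs_le]
        rcases mem_uIcc.1 hr with ⟨a, b⟩ | ⟨a, b⟩ <;> simp only at a b <;> constructor <;> linarith
      have h2 : ((t : ℂ) + Complex.I * ((y - s : ℝ) : ℂ)).im = y - s := by simp
      simp only [h2]
      linarith
    have hin : AnalyticAt ℝ (fun q : ℝ × (ℝ × ℝ) =>
        (q.1, (t : ℂ) + Complex.I * ((q.2.2 - q.2.1 : ℝ) : ℂ))) (r, (s, y)) := by
      have h21 : AnalyticAt ℝ (fun q : ℝ × (ℝ × ℝ) => q.2.2 - q.2.1) (r, (s, y)) :=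
        (((ContinuousLinearMap.snd ℝ ℝ ℝ).comp (ContinuousLinearMap.snd ℝ ℝ (ℝ × ℝ))).analyticAt
          _).sub (((ContinuousLinearMap.fst ℝ ℝ ℝ).comp
            (ContinuousLinearMap.snd ℝ ℝ (ℝ × ℝ))).analyticAt _)
      exact analyticAt_fst.prod (analyticAt_const.add (analyticAt_const.mul
        ((Complex.ofRealCLM.analyticAt _).comp h21)))
    exact AnalyticAt.comp (g := F) (hF _ hmem) hin
  have outer := AnalyticAt.parametric_intervalIntegral
    (H := fun p : ℝ × ℝ => ∫ r in (x₁ - p.1)..(x₁ + p.1),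
      F (r, (t : ℂ) + Complex.I * ((p.2 - p.1 : ℝ) : ℂ))) (a := fun _ : ℝ => (0 : ℝ))
      (b := fun y => y) (e₀ := y) analyticAt_const analyticAt_id inner
  exact analyticAt_const.mul outer

/-- The boundary values of the holomorphic extension are given by d'Alembert's formula. -/
theorem IsTriangleExtension.eq_dAlembert {X S : Set (ℝ × ℝ)} {f u₀ u₁ u : ℝ × ℝ → ℝ}
    {x₁ b t ε : ℝ} {U : ℂ → ℂ} {F : ℝ × ℂ → ℂ} (hX : IsOpen X) (hbt : b < t) (hε : 0 < ε)
    (hXt : ∀ s ∈ Ioo b t, (x₁, s) ∈ X) (hS : (x₁, t) ∈ S)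
    (hu : IsAnalyticCauchySolution X S f u₀ u₁ u)
    (hU : IsTriangleExtension (fun s => u (x₁, s)) b t ε U)
    (hF : IsContinuedData f u₀ u₁ F x₁ t ε) {y : ℝ} (hy : |y| < ε) :
    U ((t : ℂ) + Complex.I * (y : ℂ)) = sourceTerm F x₁ t y + dAlembertTerm u₀ u₁ x₁ t y := by
  have hua : AnalyticAt ℝ u (x₁, t) := hu.analytic _ (Or.inr hS)
  have huc : AnalyticAt ℝ (fun p => (u p : ℂ)) (x₁, t) := (Complex.ofRealCLM.analyticAt _).comp hua
  obtain ⟨v, hv, hvu⟩ := huc.exists_complexification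
  have hfreq : ∃ᶠ s in 𝓝 t, (x₁, s) ∈ X := by
    have h1 : ∀ᶠ s in 𝓝[<] t, (x₁, s) ∈ X := by
      filter_upwards [Ioo_mem_nhdsLT hbt] with s hs
      exact hXt s hs
    exact h1.frequently.filter_mono nhdsWithin_le_nhds
  have hsq : ((x₁ : ℝ), (t : ℂ)) ∈ characteristicSquare x₁ t ε := by
    refine ⟨by simp, by simpa using hε⟩
  have hpde := eventually_complex_poisson hX hfreq hv hua hvu hu.equation
    (hF.holomorphic_source _ hsq) hF.extends_source
  have h₀ : ∀ᶠ r : ℝ in 𝓝 x₁, v ((r : ℂ), (t : ℂ)) = (u₀ (r, t) : ℂ) := by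
    filter_upwards [eventually_slice_fst (p := (x₁, t)) hvu,
      eventually_slice_fst (p := (x₁, t)) (hu.value _ hS)] with r a1 a2
    rw [a1, a2]
  have h₁ : ∀ᶠ r : ℝ in 𝓝 x₁, partialSnd v ((r : ℂ), (t : ℂ)) = (u₁ (r, t) : ℂ) := by
    filter_upwards [eventually_slice_fst (p := (x₁, t)) (eventually_partialSnd_eq hv hua hvu),
      eventually_slice_fst (p := (x₁, t)) (hu.slope _ hS),
      eventually_slice_fst (p := (x₁, t)) hua.eventually_analyticAt] with r a1 a2 a3
    rw [a1, ← a2, partialTwo_eq_fderiv a3]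
  have hloc := eventually_eq_dAlembert hv hpde h₀ h₁
  have hGa : AnalyticAt ℂ (fun z => v ((x₁ : ℂ), z)) (t : ℂ) :=
    AnalyticAt.comp (g := v) (f := fun z : ℂ => ((x₁ : ℂ), z)) hv (by fun_prop)
  refine eq_on_edge_of_eventuallyEq (Ψ := fun y => sourceTerm F x₁ t y + dAlembertTerm u₀ u₁ x₁ t y)
    hbt hε hU.holomorphic hU.continuous (fun y hy => ?_) hGa hloc ?_ y hy
  · exact (analyticAt_sourceTerm hy hF.analytic_source).add
      (analyticAt_dAlembertTerm hy hF.analytic_value hF.analytic_slope)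
  · obtain ⟨ρ, hρ, hball⟩ := Metric.eventually_nhds_iff_ball.1 hGa.eventually_analyticAt
    obtain ⟨η, hη, hηball⟩ := Metric.eventually_nhds_iff_ball.1
      (eventually_slice_snd (p := (x₁, t)) hvu)
    obtain ⟨s, hs1, hs2⟩ : ∃ s, s ∈ Ioo b t ∧ t - min ρ η < s := by
      have hm : 0 < min ρ η := lt_min hρ hη
      obtain ⟨s, h1, h2⟩ := exists_between (max_lt hbt (by linarith : t - min ρ η < t))
      exact ⟨s, ⟨(le_max_left _ _).trans_lt h1, h2⟩, (le_max_right _ _).trans_lt h1⟩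
    have hdist : |s - t| < min ρ η := by
      rw [abs_lt]; constructor <;> linarith [hs1.2, lt_min hρ hη]
    -- Both functions continue `u (x₁, ·)` from the real segment just below `t`, and the part of the
    -- triangle in the disc is convex.
    have hEq : EqOn U (fun z => v ((x₁ : ℂ), z)) (openTriangle b t ε ∩ Metric.ball (t : ℂ) ρ) := by
      refine eqOn_of_eventuallyEq_line (γ := fun s : ℝ => (s : ℂ)) (s := s)
        ((isOpen_openTriangle b t ε).inter Metric.isOpen_ball)
        ((convex_openTriangle b t ε hbt).inter (convex_ball _ _)).isPreconnected
        (hU.holomorphic.mono inter_subset_left)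
        (fun z hz => (hball z hz.2).differentiableAt.differentiableWithinAt)
        Complex.continuous_ofReal.continuousAt Complex.ofReal_injective ⟨?_, ?_⟩ ?_
      · refine ⟨by simpa using hs1.1, by simpa using hs1.2, ?_⟩
        simpa using mul_pos hε (sub_pos.2 hs1.1)
      · rw [mem_ball_iff_norm, ← Complex.ofReal_sub, Complex.norm_real]
        exact hdist.trans_le (min_le_left _ _)
      · filter_upwards [isOpen_Ioo.mem_nhds hs1, (Metric.isOpen_ball (x := t) (ε := η)).mem_nhds
          (hdist.trans_le (min_le_right _ _))] with r a1 a2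
        rw [hU.extends_real r a1, hηball r a2]
    filter_upwards [self_mem_nhdsWithin, nhdsWithin_le_nhds (Metric.ball_mem_nhds (t : ℂ) hρ)]
      with z a1 a2
    exact hEq ⟨a1, a2⟩

/-! ### Gluing discs to a triangle. -/

/-- `g` extends holomorphically to the disc of radius `ρ` around the real point `s`. -/
def ExtendsToDisc (g : ℝ → ℝ) (s ρ : ℝ) : Prop :=
  ∃ E : ℂ → ℂ, DifferentiableOn ℂ E (Metric.ball (s : ℂ) ρ) ∧
    ∀ r : ℝ, |r - s| < ρ → E (r : ℂ) = (g r : ℂ)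

theorem ofReal_mem_ball {s ρ r : ℝ} : (r : ℂ) ∈ Metric.ball (s : ℂ) ρ ↔ |r - s| < ρ := by
  rw [mem_ball_iff_norm, ← Complex.ofReal_sub, Complex.norm_real, Real.norm_eq_abs]

theorem ExtendsToDisc.of_ball_subset {g : ℝ → ℝ} {s ρ s' ρ' : ℝ} (h : ExtendsToDisc g s ρ)
    (hs : |s' - s| + ρ' ≤ ρ) : ExtendsToDisc g s' ρ' := by
  obtain ⟨E, h1, h2⟩ := h
  refine ⟨E, h1.mono (Metric.ball_subset_ball' ?_), fun r hr => h2 r ?_⟩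
  · rw [dist_eq_norm, ← Complex.ofReal_sub, Complex.norm_real, Real.norm_eq_abs]
    linarith
  · have := abs_sub_le r s' s
    linarith

theorem AnalyticAt.exists_extendsToDisc {g : ℝ → ℝ} {s : ℝ} (h : AnalyticAt ℝ g s) :
    ∃ ρ > 0, ExtendsToDisc g s ρ := by
  have hc : AnalyticAt ℝ (fun r => (g r : ℂ)) s := (Complex.ofRealCLM.analyticAt _).comp h
  obtain ⟨E, hE, hEg⟩ := hc.exists_complexification_real
  obtain ⟨ρ₁, h1, hb1⟩ := Metric.eventually_nhds_iff_ball.1 hE.eventually_analyticAt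
  obtain ⟨ρ₂, h2, hb2⟩ := Metric.eventually_nhds_iff_ball.1 hEg
  refine ⟨min ρ₁ ρ₂, lt_min h1 h2, E, fun z hz => ?_, fun r hr => ?_⟩
  · exact (hb1 z (Metric.ball_subset_ball (min_le_left _ _) hz)).differentiableAt.differentiableWithinAt
  · exact hb2 r (hr.trans_le (min_le_right _ _))

/-- The real part of a holomorphic function on the real axis extends holomorphically. -/
theorem ExtendsToDisc.of_re {g : ℝ → ℝ} {s ρ : ℝ} {K : ℂ → ℂ}
    (hK : DifferentiableOn ℂ K (Metric.ball (s : ℂ) ρ))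
    (hg : ∀ r : ℝ, |r - s| < ρ → (K (r : ℂ)).re = g r) : ExtendsToDisc g s ρ := by
  -- Schwarz symmetrization: `conj (K (conj z))` is again holomorphic, and on the real axis the mean
  -- with `K` is `Re K`.
  refine ⟨fun z => (K z + (starRingEnd ℂ) (K ((starRingEnd ℂ) z))) / 2, fun z hz => ?_,
    fun r hr => ?_⟩
  · have hz' : (starRingEnd ℂ) z ∈ Metric.ball (s : ℂ) ρ := by
      rw [mem_ball_iff_norm] at hz ⊢
      have : (starRingEnd ℂ) z - s = (starRingEnd ℂ) (z - s) := by simp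
      rwa [this, RCLike.norm_conj]
    have h1 := hK.differentiableAt (Metric.isOpen_ball.mem_nhds hz)
    have h2 := (hK.differentiableAt (Metric.isOpen_ball.mem_nhds hz')).conj_conj
    rw [Complex.conj_conj] at h2
    exact ((h1.add h2).div_const 2).differentiableWithinAt
  · simp only [Complex.conj_ofReal]
    rw [Complex.add_conj, ← hg r hr]
    push_cast
    ring

/-- Extensions to discs whose radii decrease linearly towards `b` give an extension to a
triangle. -/
theorem exists_isTriangleExtension {g : ℝ → ℝ} {b t κ ε : ℝ} (hbt : b < t) (hκ : 0 < κ)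
    (hεκ : ε < κ * (t - b)) (h : ∀ s ∈ Ioc b t, ExtendsToDisc g s (κ * (s - b))) :
    ∃ U : ℂ → ℂ, IsTriangleExtension g b t ε U := by
  have hl : 0 < t - b := sub_pos.2 hbt
  have h' : ∀ s : ℝ, ∃ E : ℂ → ℂ, s ∈ Ioc b t →
      DifferentiableOn ℂ E (Metric.ball (s : ℂ) (κ * (s - b))) ∧
      ∀ r : ℝ, |r - s| < κ * (s - b) → E (r : ℂ) = (g r : ℂ) := fun s => by
    by_cases hs : s ∈ Ioc b t
    · obtain ⟨E, hE⟩ := h s hs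
      exact ⟨E, fun _ => hE⟩
    · exact ⟨0, fun hs' => absurd hs' hs⟩
  choose E hE using h'
  set C := closedTriangleMinusVertex b t ε with hC
  have hpos : ∀ s ∈ Ioc b t, 0 < κ * (s - b) := fun s hs => mul_pos hκ (sub_pos.2 hs.1)
  have hball : ∀ z ∈ C, z.re ∈ Ioc b t ∧ z ∈ Metric.ball (z.re : ℂ) (κ * (z.re - b)) := fun z hz => by
    obtain ⟨h1, h2, h3⟩ := hz
    refine ⟨⟨h1, h2⟩, ?_⟩
    have hd : z - (z.re : ℂ) = (z.im : ℂ) * Complex.I := by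
      apply Complex.ext <;> simp
    rw [mem_ball_iff_norm, hd, norm_mul, Complex.norm_I, mul_one, Complex.norm_real,
      Real.norm_eq_abs]
    have h4 : 0 < z.re - b := sub_pos.2 h1
    have h5 : ε * (z.re - b) < κ * (t - b) * (z.re - b) := by gcongr
    have h6 : |z.im| * (t - b) < (κ * (z.re - b)) * (t - b) := by linarith
    exact lt_of_mul_lt_mul_right h6 hl.le
  -- The glued function is `z ↦ E z.re z`; the bound `ε < κ (t - b)` puts `z` in the disc around its
  -- real part. Near `z₀` it coincides with the single function `E z₀.re`, since both extend `g` and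
  -- the intersection of two discs is connected.
  have key : ∀ z₀ ∈ C, DifferentiableWithinAt ℂ (fun z => E z.re z) C z₀ := fun z₀ hz₀ => by
    obtain ⟨hs₀, hm₀⟩ := hball z₀ hz₀
    have hd : DifferentiableAt ℂ (E z₀.re) z₀ :=
      (hE _ hs₀).1.differentiableAt (Metric.isOpen_ball.mem_nhds hm₀)
    refine hd.differentiableWithinAt.congr_of_eventuallyEq ?_ rfl
    have hre : ∀ᶠ z : ℂ in 𝓝 z₀, |z.re - z₀.re| < κ * (z₀.re - b) := by
      have hc : Continuous fun z : ℂ => |z.re - z₀.re| :=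
        (Complex.continuous_re.sub continuous_const).abs
      exact hc.continuousAt.eventually (gt_mem_nhds (by simpa using hpos _ hs₀))
    filter_upwards [self_mem_nhdsWithin, nhdsWithin_le_nhds hre,
      nhdsWithin_le_nhds (Metric.isOpen_ball.mem_nhds hm₀)] with z hz hz1 hz2
    obtain ⟨hs, hm⟩ := hball z hz
    have hEq : EqOn (E z.re) (E z₀.re) (Metric.ball (z.re : ℂ) (κ * (z.re - b)) ∩
        Metric.ball (z₀.re : ℂ) (κ * (z₀.re - b))) := by
      refine eqOn_of_eventuallyEq_line (γ := fun s : ℝ => (s : ℂ)) (s := z.re)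
        (Metric.isOpen_ball.inter Metric.isOpen_ball)
        ((convex_ball _ _).inter (convex_ball _ _)).isPreconnected
        ((hE _ hs).1.mono inter_subset_left) ((hE _ hs₀).1.mono inter_subset_right)
        Complex.continuous_ofReal.continuousAt Complex.ofReal_injective
        ⟨Metric.mem_ball_self (hpos _ hs), ofReal_mem_ball.2 hz1⟩ ?_
      filter_upwards [Metric.ball_mem_nhds z.re (hpos _ hs),
        (Metric.isOpen_ball (x := z₀.re) (ε := κ * (z₀.re - b))).mem_nhds hz1] with r a1 a2
      rw [(hE _ hs).2 r a1, (hE _ hs₀).2 r a2]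
    exact hEq ⟨hm, hz2⟩
  refine ⟨fun z => E z.re z, fun z hz => ?_, fun z hz => (key z hz).continuousWithinAt,
    fun s hs => ?_⟩
  · exact (key z (openTriangle_subset_closedTriangle b t ε hz)).mono
      (openTriangle_subset_closedTriangle b t ε)
  · have hs' : s ∈ Ioc b t := ⟨hs.1, hs.2.le⟩
    have := (hE s hs').2 s (by simpa using hpos s hs')
    simpa using this

/-- Away from the vertex the radii of the discs are bounded below by compactness. -/
theorem exists_linear_radius {g : ℝ → ℝ} {b t κ δ : ℝ} (hbt : b < t) (hκ : 0 < κ) (hδ : 0 < δ)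
    (hg : ∀ s ∈ Ioc b t, AnalyticAt ℝ g s)
    (hb : ∀ s ∈ Ioo b (b + δ), ExtendsToDisc g s (κ * (s - b))) :
    ∃ κ' > 0, ∀ s ∈ Ioc b t, ExtendsToDisc g s (κ' * (s - b)) := by
  have hcomp : ∃ ρ > 0, ∀ s ∈ Icc (b + δ / 2) t, ExtendsToDisc g s ρ := by
    refine isCompact_Icc.induction_on (p := fun S => ∃ ρ > 0, ∀ s ∈ S, ExtendsToDisc g s ρ)
      ⟨1, one_pos, by simp⟩ ?_ ?_ ?_
    · rintro S S' hSS ⟨ρ, hρ, h⟩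
      exact ⟨ρ, hρ, fun s hs => h s (hSS hs)⟩
    · rintro S S' ⟨ρ, hρ, h⟩ ⟨ρ', hρ', h'⟩
      refine ⟨min ρ ρ', lt_min hρ hρ', ?_⟩
      rintro s (hs | hs)
      · exact (h s hs).of_ball_subset (by simp)
      · exact (h' s hs).of_ball_subset (by simp)
    · intro s hs
      obtain ⟨ρ, hρ, h⟩ := (hg s ⟨by linarith [hs.1], hs.2⟩).exists_extendsToDisc
      refine ⟨Metric.ball s (ρ / 2), nhdsWithin_le_nhds (Metric.ball_mem_nhds s (half_pos hρ)),
        ρ / 2, half_pos hρ, fun r hr => h.of_ball_subset ?_⟩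
      rw [Metric.mem_ball, Real.dist_eq] at hr
      linarith
  obtain ⟨ρ, hρ, hK⟩ := hcomp
  have hl : 0 < t - b := sub_pos.2 hbt
  -- A fixed radius `ρ` dominates the linear one, since `(ρ / (t - b)) (s - b) ≤ ρ` for `s ≤ t`.
  refine ⟨min κ (ρ / (t - b)), lt_min hκ (div_pos hρ hl), fun s hs => ?_⟩
  have hsb : 0 < s - b := sub_pos.2 hs.1
  rcases lt_or_ge s (b + δ) with h | h
  · refine (hb s ⟨hs.1, h⟩).of_ball_subset ?_
    rw [sub_self, abs_zero, zero_add]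
    exact mul_le_mul_of_nonneg_right (min_le_left _ _) hsb.le
  · refine (hK s ⟨by linarith, hs.2⟩).of_ball_subset ?_
    rw [sub_self, abs_zero, zero_add]
    calc min κ (ρ / (t - b)) * (s - b) ≤ ρ / (t - b) * (t - b) := by
          apply mul_le_mul (min_le_right _ _) _ hsb.le (by positivity)
          linarith [hs.2]
      _ = ρ := by field_simp

/-! ### Local solutions of the complexified Poisson equation. -/

theorem AnalyticAt.exists_partialSnd_primitive {G : ℂ × ℂ → ℂ} {p : ℂ × ℂ} (h : AnalyticAt ℂ G p) :
    ∃ V : ℂ × ℂ → ℂ, AnalyticAt ℂ V p ∧ _root_.partialSnd V =ᶠ[𝓝 p] G := by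
  have hsw : ∀ q : ℂ × ℂ, AnalyticAt ℂ (fun q : ℂ × ℂ => (q.2, q.1)) q := fun q =>
    analyticAt_snd.prod analyticAt_fst
  have hH : AnalyticAt ℂ (fun q : ℂ × ℂ => G (q.2, q.1)) (p.2, p.1) :=
    AnalyticAt.comp (g := G) (f := fun q : ℂ × ℂ => (q.2, q.1)) h (hsw (p.2, p.1))
  obtain ⟨V, hV, hVd⟩ := hH.exists_primitive_fst
  have hWa : AnalyticAt ℂ (fun q : ℂ × ℂ => V (q.2, q.1)) p :=
    AnalyticAt.comp (g := V) (f := fun q : ℂ × ℂ => (q.2, q.1)) hV (hsw p)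
  refine ⟨fun q => V (q.2, q.1), hWa, ?_⟩
  have hsc : Continuous fun q : ℂ × ℂ => (q.2, q.1) := by fun_prop
  filter_upwards [(hsc.tendsto p).eventually hVd, hWa.eventually_analyticAt] with q hq hq'
  exact (AnalyticAt.hasDerivAt_snd (z := q.1) (w := q.2) hq').unique hq

/-- The isotropic coordinates `(z₁ + i z₂, z₁ - i z₂)`. -/
noncomputable def isotropic : ℂ × ℂ →L[ℂ] ℂ × ℂ :=
  (ContinuousLinearMap.fst ℂ ℂ ℂ + Complex.I • ContinuousLinearMap.snd ℂ ℂ ℂ).prod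
    (ContinuousLinearMap.fst ℂ ℂ ℂ - Complex.I • ContinuousLinearMap.snd ℂ ℂ ℂ)

theorem isotropic_apply (p : ℂ × ℂ) :
    isotropic p = (p.1 + Complex.I * p.2, p.1 - Complex.I * p.2) := by
  simp [isotropic]

/-- The chain rule in isotropic coordinates `ζ, ω`: `∂₁ = ∂_ζ + ∂_ω` and `∂₂ = i (∂_ζ - ∂_ω)`, hence
`∂₁² + ∂₂² = 4 ∂_ζ ∂_ω`. -/
theorem AnalyticAt.partials_comp_isotropic {W : ℂ × ℂ → ℂ} {q : ℂ × ℂ}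
    (h : AnalyticAt ℂ W (isotropic q)) :
    _root_.partialFst (W ∘ isotropic) q = _root_.partialFst W (isotropic q) + _root_.partialSnd W (isotropic q) ∧
    _root_.partialSnd (W ∘ isotropic) q =
      Complex.I * (_root_.partialFst W (isotropic q) - _root_.partialSnd W (isotropic q)) := by
  have hf : fderiv ℂ (W ∘ isotropic) q = (fderiv ℂ W (isotropic q)).comp isotropic :=
    (h.differentiableAt.hasFDerivAt.comp q isotropic.hasFDerivAt).fderiv
  constructor
  · change fderiv ℂ (W ∘ isotropic) q (1, 0) = _
    rw [hf, ContinuousLinearMap.comp_apply, isotropic_apply (1, 0), fderiv_apply_eq_partials]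
    simp
  · change fderiv ℂ (W ∘ isotropic) q (0, 1) = _
    rw [hf, ContinuousLinearMap.comp_apply, isotropic_apply (0, 1), fderiv_apply_eq_partials]
    simp
    ring

/-- The complexified Poisson equation has local analytic solutions. -/
theorem AnalyticAt.exists_complex_poisson_solution {G : ℂ × ℂ → ℂ} {p : ℂ × ℂ}
    (hG : AnalyticAt ℂ G p) : ∃ v : ℂ × ℂ → ℂ, AnalyticAt ℂ v p ∧
      ∀ᶠ q in 𝓝 p, _root_.partialFst (_root_.partialFst v) q +
        _root_.partialSnd (_root_.partialSnd v) q = G q := by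
  -- `J` inverts `isotropic`. In these coordinates the equation reads `4 ∂_ζ ∂_ω V = G ∘ J`, which
  -- two successive primitives solve.
  let J : ℂ × ℂ → ℂ × ℂ := fun q => ((q.1 + q.2) / 2, (q.1 - q.2) / (2 * Complex.I))
  have hJ : ∀ q, J (isotropic q) = q := fun q => by
    rw [isotropic_apply]
    ext
    · simp [J]
    · simp only [J]
      field_simp
      ring
  have hJa : AnalyticAt ℂ J (isotropic p) :=
    ((analyticAt_fst.add analyticAt_snd).div analyticAt_const two_ne_zero).prod
      ((analyticAt_fst.sub analyticAt_snd).div analyticAt_const (by simp))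
  have hg : AnalyticAt ℂ (fun q => G (J q) / 4) (isotropic p) :=
    (AnalyticAt.comp (g := G) (by rwa [hJ]) hJa).div analyticAt_const (by norm_num)
  obtain ⟨V₁, hV₁, hV₁g⟩ := hg.exists_partialFst_primitive
  obtain ⟨V, hV, hVV₁⟩ := hV₁.exists_partialSnd_primitive
  have hLa : AnalyticAt ℂ isotropic p := isotropic.analyticAt p
  refine ⟨V ∘ isotropic, hV.comp hLa, ?_⟩
  have hLc : Tendsto isotropic (𝓝 p) (𝓝 (isotropic p)) := isotropic.continuous.tendsto p
  have hVp : ∀ᶠ q in 𝓝 p, AnalyticAt ℂ V (isotropic q) := hLc.eventually hV.eventually_analyticAt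
  filter_upwards [hVp.eventually_nhds, hLc.eventually (hVV₁.eventuallyEq_nhds),
    hLc.eventually hV₁g] with q a1 a2 a3
  set W₁ : ℂ × ℂ → ℂ := fun r => _root_.partialFst V r + _root_.partialSnd V r with hW₁
  set W₂ : ℂ × ℂ → ℂ := fun r => Complex.I * (_root_.partialFst V r - _root_.partialSnd V r) with hW₂
  have hVq := a1.self_of_nhds
  have e1 : _root_.partialFst (V ∘ isotropic) =ᶠ[𝓝 q] W₁ ∘ isotropic := by
    filter_upwards [a1] with r hr
    exact hr.partials_comp_isotropic.1
  have e2 : _root_.partialSnd (V ∘ isotropic) =ᶠ[𝓝 q] W₂ ∘ isotropic := by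
    filter_upwards [a1] with r hr
    exact hr.partials_comp_isotropic.2
  have hW₁a : AnalyticAt ℂ W₁ (isotropic q) := hVq.partialFst.add hVq.partialSnd
  have hW₂a : AnalyticAt ℂ W₂ (isotropic q) :=
    analyticAt_const.mul (hVq.partialFst.sub hVq.partialSnd)
  have d1 := hVq.partialFst.differentiableAt
  have d2 := hVq.partialSnd.differentiableAt
  have f1 : fderiv ℂ W₁ (isotropic q) = fderiv ℂ (_root_.partialFst V) (isotropic q) +
      fderiv ℂ (_root_.partialSnd V) (isotropic q) := fderiv_fun_add d1 d2
  have f2 : fderiv ℂ W₂ (isotropic q) = Complex.I • (fderiv ℂ (_root_.partialFst V) (isotropic q) -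
      fderiv ℂ (_root_.partialSnd V) (isotropic q)) := by
    rw [← fderiv_fun_sub d1 d2]
    exact fderiv_const_mul (d1.sub d2) Complex.I
  have hsymm := hVq.partialFst_partialSnd_comm
  have hval : _root_.partialFst (_root_.partialSnd V) (isotropic q) = G q / 4 := by
    rw [a2.partialFst_eq, a3, hJ]
  rw [e1.partialFst_eq, e2.partialSnd_eq, hW₁a.partials_comp_isotropic.1,
    hW₂a.partials_comp_isotropic.2]
  have g1 : _root_.partialFst W₁ (isotropic q) =
      _root_.partialFst (_root_.partialFst V) (isotropic q) +
        _root_.partialFst (_root_.partialSnd V) (isotropic q) := by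
    change fderiv ℂ W₁ (isotropic q) (1, 0) = _
    rw [f1]; rfl
  have g2 : _root_.partialSnd W₁ (isotropic q) =
      _root_.partialSnd (_root_.partialFst V) (isotropic q) +
        _root_.partialSnd (_root_.partialSnd V) (isotropic q) := by
    change fderiv ℂ W₁ (isotropic q) (0, 1) = _
    rw [f1]; rfl
  have g3 : _root_.partialFst W₂ (isotropic q) =
      Complex.I * (_root_.partialFst (_root_.partialFst V) (isotropic q) -
        _root_.partialFst (_root_.partialSnd V) (isotropic q)) := by
    change fderiv ℂ W₂ (isotropic q) (1, 0) = _
    rw [f2]; rfl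
  have g4 : _root_.partialSnd W₂ (isotropic q) =
      Complex.I * (_root_.partialSnd (_root_.partialFst V) (isotropic q) -
        _root_.partialSnd (_root_.partialSnd V) (isotropic q)) := by
    change fderiv ℂ W₂ (isotropic q) (0, 1) = _
    rw [f2]; rfl
  rw [g1, g2, g3, g4, ← hsymm, hval]
  linear_combination (_root_.partialFst (_root_.partialFst V) (isotropic q) - G q / 4 - G q / 4 +
    _root_.partialSnd (_root_.partialSnd V) (isotropic q)) * Complex.I_mul_I

/-! ### Extension to discs by harmonic functions. -/

/-- The Laplacian on `ℂ` of a function of two real variables. -/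
theorem laplacian_comp_re_im {g : ℝ × ℝ → ℝ} {w : ℂ} (h : AnalyticAt ℝ g (w.re, w.im)) :
    Laplacian.laplacian (fun z : ℂ => g (z.re, z.im)) w = planarLaplacian g (w.re, w.im) := by
  let R : ℂ →L[ℝ] ℝ × ℝ := Complex.reCLM.prod Complex.imCLM
  have hR : ∀ z, R z = (z.re, z.im) := fun z => by simp [R]
  have first : ∀ {k : ℝ × ℝ → ℝ} {z : ℂ}, AnalyticAt ℝ k (z.re, z.im) → ∀ e : ℂ,
      fderiv ℝ (fun z : ℂ => k (z.re, z.im)) z e = fderiv ℝ k (z.re, z.im) (e.re, e.im) :=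
    fun {k z} hk e => by
      have h1 : HasFDerivAt (fun z : ℂ => k (z.re, z.im)) ((fderiv ℝ k (z.re, z.im)).comp R) z :=
        HasFDerivAt.comp (f := fun z : ℂ => (z.re, z.im)) z hk.differentiableAt.hasFDerivAt
          R.hasFDerivAt
      rw [h1.fderiv]
      rfl
  have hRc : Continuous fun z : ℂ => (z.re, z.im) := R.continuous
  have hRa : AnalyticAt ℝ (fun z : ℂ => (z.re, z.im)) w := R.analyticAt w
  have hk : AnalyticAt ℝ (fun z : ℂ => g (z.re, z.im)) w :=
    AnalyticAt.comp (g := g) (f := fun z : ℂ => (z.re, z.im)) h hRa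
  have second : ∀ e : ℂ, fderiv ℝ (fderiv ℝ (fun z : ℂ => g (z.re, z.im))) w e e =
      fderiv ℝ (fun q => fderiv ℝ g q (e.re, e.im)) (w.re, w.im) (e.re, e.im) := fun e => by
    have h1 : fderiv ℝ (fun z => fderiv ℝ (fun z : ℂ => g (z.re, z.im)) z e) w e =
        fderiv ℝ (fderiv ℝ (fun z : ℂ => g (z.re, z.im))) w e e := by
      rw [fderiv_clm_apply hk.fderiv.differentiableAt (differentiableAt_const e)]
      simp
    rw [← h1, ← first (h.real_partial (e.re, e.im)) e]
    have heq : (fun z => fderiv ℝ (fun z : ℂ => g (z.re, z.im)) z e) =ᶠ[𝓝 w]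
        fun z => fderiv ℝ g (z.re, z.im) (e.re, e.im) := by
      filter_upwards [(hRc.tendsto w).eventually h.eventually_analyticAt] with z hz
      exact first hz e
    rw [heq.fderiv_eq]
  rw [InnerProductSpace.laplacian_eq_iteratedFDeriv_complexPlane, planarLaplacian_eq_fderiv h]
  simp only [iteratedFDeriv_two_apply, Matrix.cons_val_zero, Matrix.cons_val_one]
  rw [second, second]
  simp

theorem AnalyticAt.re_comp_ofReal {v : ℂ × ℂ → ℂ} {q : ℝ × ℝ}
    (h : AnalyticAt ℂ v ((q.1 : ℂ), (q.2 : ℂ))) :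
    AnalyticAt ℝ (fun q : ℝ × ℝ => (v ((q.1 : ℂ), (q.2 : ℂ))).re) q ∧
      ∀ α β : ℝ, fderiv ℝ (fun q : ℝ × ℝ => (v ((q.1 : ℂ), (q.2 : ℂ))).re) q (α, β) =
        (fderiv ℂ v ((q.1 : ℂ), (q.2 : ℂ)) ((α : ℂ), (β : ℂ))).re := by
  let R : ℝ × ℝ →L[ℝ] ℂ × ℂ := Complex.ofRealCLM.prodMap Complex.ofRealCLM
  constructor
  · have h1 : AnalyticAt ℝ (fun q : ℝ × ℝ => v ((q.1 : ℂ), (q.2 : ℂ))) q :=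
      AnalyticAt.comp (g := v) (f := fun q : ℝ × ℝ => ((q.1 : ℂ), (q.2 : ℂ)))
        h.restrictScalars (R.analyticAt q)
    exact (Complex.reCLM.analyticAt _).comp h1
  · intro α β
    have h1 : HasFDerivAt (fun q : ℝ × ℝ => v ((q.1 : ℂ), (q.2 : ℂ)))
        (((fderiv ℂ v ((q.1 : ℂ), (q.2 : ℂ))).restrictScalars ℝ).comp R) q :=
      HasFDerivAt.comp (f := fun q : ℝ × ℝ => ((q.1 : ℂ), (q.2 : ℂ))) q
        (h.differentiableAt.hasFDerivAt.restrictScalars ℝ) R.hasFDerivAt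
    have h2 : HasFDerivAt (fun q : ℝ × ℝ => (v ((q.1 : ℂ), (q.2 : ℂ))).re)
        (Complex.reCLM.comp (((fderiv ℂ v ((q.1 : ℂ), (q.2 : ℂ))).restrictScalars ℝ).comp R)) q :=
      Complex.reCLM.hasFDerivAt.comp q h1
    rw [h2.fderiv]
    rfl

/-- Passing to the real part removes any need for `v` to be real at real points. -/
theorem planarLaplacian_re_comp_ofReal {v : ℂ × ℂ → ℂ} {q : ℝ × ℝ}
    (h : AnalyticAt ℂ v ((q.1 : ℂ), (q.2 : ℂ))) :
    planarLaplacian (fun q : ℝ × ℝ => (v ((q.1 : ℂ), (q.2 : ℂ))).re) q =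
      (partialFst (partialFst v) ((q.1 : ℂ), (q.2 : ℂ)) +
        partialSnd (partialSnd v) ((q.1 : ℂ), (q.2 : ℂ))).re := by
  have hc : Continuous fun q : ℝ × ℝ => ((q.1 : ℂ), (q.2 : ℂ)) := by fun_prop
  have hev := (hc.tendsto q).eventually h.eventually_analyticAt
  rw [planarLaplacian_eq_fderiv h.re_comp_ofReal.1, Complex.add_re]
  congr 1
  · have heq : (fun q' : ℝ × ℝ => fderiv ℝ (fun q : ℝ × ℝ => (v ((q.1 : ℂ), (q.2 : ℂ))).re) q' (1, 0))
        =ᶠ[𝓝 q] fun q => (partialFst v ((q.1 : ℂ), (q.2 : ℂ))).re := by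
      filter_upwards [hev] with r hr
      rw [hr.re_comp_ofReal.2]
      simp [partialFst]
    rw [heq.fderiv_eq, h.partialFst.re_comp_ofReal.2]
    simp [partialFst]
  · have heq : (fun q' : ℝ × ℝ => fderiv ℝ (fun q : ℝ × ℝ => (v ((q.1 : ℂ), (q.2 : ℂ))).re) q' (0, 1))
        =ᶠ[𝓝 q] fun q => (partialSnd v ((q.1 : ℂ), (q.2 : ℂ))).re := by
      filter_upwards [hev] with r hr
      rw [hr.re_comp_ofReal.2]
      simp [partialSnd]
    rw [heq.fderiv_eq, h.partialSnd.re_comp_ofReal.2]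
    simp [partialSnd]

/-- A solution of the Poisson equation on a disc extends holomorphically in the second variable
to a complex disc of the same radius, if the equation has a complexified solution there. -/
theorem extendsToDisc_of_poisson {u : ℝ × ℝ → ℝ} {v : ℂ × ℂ → ℂ} {x₁ s ρ : ℝ}
    (hu : ∀ w ∈ Metric.ball ((x₁ : ℂ) + Complex.I * (s : ℂ)) ρ, AnalyticAt ℝ u (w.re, w.im))
    (hv : ∀ w ∈ Metric.ball ((x₁ : ℂ) + Complex.I * (s : ℂ)) ρ,
      AnalyticAt ℂ v ((w.re : ℂ), (w.im : ℂ)))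
    (heq : ∀ w ∈ Metric.ball ((x₁ : ℂ) + Complex.I * (s : ℂ)) ρ, planarLaplacian u (w.re, w.im) =
      (partialFst (partialFst v) ((w.re : ℂ), (w.im : ℂ)) +
        partialSnd (partialSnd v) ((w.re : ℂ), (w.im : ℂ))).re)
    (hvz : ∀ z ∈ Metric.ball (s : ℂ) ρ, AnalyticAt ℂ v ((x₁ : ℂ), z)) :
    ExtendsToDisc (fun r => u (x₁, r)) s ρ := by
  set D := Metric.ball ((x₁ : ℂ) + Complex.I * (s : ℂ)) ρ with hD
  let g : ℝ × ℝ → ℝ := fun q => (v ((q.1 : ℂ), (q.2 : ℂ))).re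
  have hRa : ∀ w, AnalyticAt ℝ (fun z : ℂ => (z.re, z.im)) w := fun w =>
    (Complex.reCLM.prod Complex.imCLM).analyticAt w
  have ha : ∀ w ∈ D, AnalyticAt ℝ g (w.re, w.im) := fun w hw =>
    AnalyticAt.re_comp_ofReal (q := (w.re, w.im)) (hv w hw)
      |>.1
  have hku : ∀ w ∈ D, ContDiffAt ℝ 2 (fun z : ℂ => u (z.re, z.im)) w := fun w hw =>
    (AnalyticAt.comp (g := u) (f := fun z : ℂ => (z.re, z.im)) (hu w hw) (hRa w)).contDiffAt
  have hkg : ∀ w ∈ D, ContDiffAt ℝ 2 (fun z : ℂ => g (z.re, z.im)) w := fun w hw =>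
    (AnalyticAt.comp (g := g) (f := fun z : ℂ => (z.re, z.im)) (ha w hw) (hRa w)).contDiffAt
  -- `u` and `Re v` have the same Laplacian on the disc, so their difference is the real part of a
  -- holomorphic `H` on the same disc.
  have hharm : InnerProductSpace.HarmonicOnNhd
      ((fun z : ℂ => u (z.re, z.im)) - fun z : ℂ => g (z.re, z.im)) D := fun w hw => by
    refine ⟨(hku w hw).sub (hkg w hw), ?_⟩
    filter_upwards [Metric.isOpen_ball.mem_nhds hw] with w' hw'
    rw [(hku w' hw').laplacian_sub (hkg w' hw'), laplacian_comp_re_im (hu w' hw'),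
      laplacian_comp_re_im (ha w' hw'), heq w' hw',
      planarLaplacian_re_comp_ofReal (q := (w'.re, w'.im)) (hv w' hw')]
    simp
  obtain ⟨H, hH, hHre⟩ := hharm.exists_analyticOnNhd_ball_re_eq
  have hmaps : ∀ z : ℂ, z ∈ Metric.ball (s : ℂ) ρ → (x₁ : ℂ) + Complex.I * z ∈ D := fun z hz => by
    rw [hD, mem_ball_iff_norm]
    have : (x₁ : ℂ) + Complex.I * z - ((x₁ : ℂ) + Complex.I * (s : ℂ)) = Complex.I * (z - s) := by
      ring
    rw [this, norm_mul, Complex.norm_I, one_mul]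
    exact mem_ball_iff_norm.1 hz
  -- The point `(x₁, r)` corresponds to `x₁ + i r`. Replacing `r` by a complex `z` rotates the disc
  -- around `s` onto the disc of harmonicity, with no loss of radius.
  refine ExtendsToDisc.of_re (K := fun z => H ((x₁ : ℂ) + Complex.I * z) + v ((x₁ : ℂ), z))
    (fun z hz => ?_) (fun r hr => ?_)
  · have h1 : DifferentiableAt ℂ (fun z => H ((x₁ : ℂ) + Complex.I * z)) z :=
      DifferentiableAt.comp (f := fun z : ℂ => (x₁ : ℂ) + Complex.I * z) z
        (hH _ (hmaps z hz)).differentiableAt (by fun_prop)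
    exact (h1.add (hvz z hz).hasDerivAt_snd.differentiableAt).differentiableWithinAt
  · have h1 := hHre (hmaps r (ofReal_mem_ball.2 hr))
    simp only [Pi.sub_apply, g] at h1
    rw [Complex.add_re, h1]
    simp

/-! ### Discs near the bottom curve. -/

/-- Near a point of the bottom curve, at which the source is analytic, the radii of the discs
decrease linearly. -/
theorem exists_linear_radius_bottom {X : Set (ℝ × ℝ)} {f u : ℝ × ℝ → ℝ} {a c x₁ : ℝ}
    {bot top : ℝ → ℝ} (hX : X = stripDomain a c bot top) (hx : x₁ ∈ Ioo a c)
    (hbot : DifferentiableAt ℝ bot x₁) (htop : ContinuousAt top x₁) (hlt : bot x₁ < top x₁)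
    (hf : AnalyticAt ℝ f (x₁, bot x₁)) (hu : ∀ x ∈ X, AnalyticAt ℝ u x)
    (heq : ∀ x ∈ X, planarLaplacian u x = f x) :
    ∃ κ > 0, ∃ δ > 0, ∀ s ∈ Ioo (bot x₁) (bot x₁ + δ),
      ExtendsToDisc (fun r => u (x₁, r)) s (κ * (s - bot x₁)) := by
  set b := bot x₁ with hb
  have hfc : AnalyticAt ℝ (fun p => (f p : ℂ)) (x₁, b) := (Complex.ofRealCLM.analyticAt _).comp hf
  obtain ⟨G, hG, hGf⟩ := hfc.exists_complexification
  obtain ⟨v, hv, hvG⟩ := hG.exists_complex_poisson_solution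
  obtain ⟨r₀, hr₀, hball⟩ := Metric.eventually_nhds_iff_ball.1 (hv.eventually_analyticAt.and hvG)
  obtain ⟨r₁, hr₁, hball₁⟩ := Metric.eventually_nhds_iff_ball.1 hGf
  obtain ⟨L, hL0, hL⟩ := hbot.isBigO_sub.exists_pos
  have hLb := hL.bound
  have hgt : ∀ᶠ r in 𝓝 x₁, (b + top x₁) / 2 < top r :=
    htop.eventually (lt_mem_nhds (by linarith))
  obtain ⟨η, hη, hηb⟩ := Metric.eventually_nhds_iff_ball.1
    ((hLb.and hgt).and (isOpen_Ioo.mem_nhds hx : ∀ᶠ r in 𝓝 x₁, r ∈ Ioo a c))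
  -- `L` bounds the slope of `bot` from `x₁`. On a disc of radius `κσ` around height `b + σ` the
  -- curve stays below `b + Lκσ` and the disc above `b + σ - κσ`; these bounds coincide for `κ = 1 /
  -- (1 + L)`.
  have hκ0 : (0 : ℝ) < 1 / (1 + L) := by positivity
  have hκ1 : 1 / (1 + L) ≤ 1 := by rw [div_le_one (by positivity)]; linarith
  have hκL : L * (1 / (1 + L)) = 1 - 1 / (1 + L) := by field_simp; ring
  set κ : ℝ := 1 / (1 + L) with hκ
  -- The discs reach at most height `b + 2δ`. The bounds on `δ` keep them within the neighbourhoods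
  -- where `v` and `G` are controlled, and below `(b + top x₁) / 2`, which `top` exceeds near `x₁`.
  obtain ⟨δ, hδ, hδη, hδr₀, hδr₁, hδt⟩ : ∃ δ > 0, δ ≤ η ∧ 2 * δ ≤ r₀ ∧ 2 * δ ≤ r₁ ∧
      2 * δ ≤ (top x₁ - b) / 2 := by
    have h1 : 0 < top x₁ - b := sub_pos.2 hlt
    refine ⟨min (min η (r₀ / 2)) (min (r₁ / 2) ((top x₁ - b) / 4)), by positivity, ?_, ?_, ?_, ?_⟩
    · exact (min_le_left _ _).trans (min_le_left _ _)
    · have := (min_le_left (min η (r₀ / 2)) (min (r₁ / 2) ((top x₁ - b) / 4))).trans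
        (min_le_right _ _)
      linarith
    · have := (min_le_right (min η (r₀ / 2)) (min (r₁ / 2) ((top x₁ - b) / 4))).trans
        (min_le_left _ _)
      linarith
    · have := (min_le_right (min η (r₀ / 2)) (min (r₁ / 2) ((top x₁ - b) / 4))).trans
        (min_le_right _ _)
      linarith
  refine ⟨κ, hκ0, δ, hδ, fun s hs => ?_⟩
  set σ := s - b with hσ
  have hσ0 : 0 < σ := sub_pos.2 hs.1
  have hσδ : σ < δ := by linarith [hs.2]
  have hκσ : κ * σ ≤ σ := mul_le_of_le_one_left hσ0.le hκ1
  have hpt : ∀ w ∈ Metric.ball ((x₁ : ℂ) + Complex.I * (s : ℂ)) (κ * σ),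
      |w.re - x₁| < κ * σ ∧ |w.im - s| < κ * σ := fun w hw => by
    rw [mem_ball_iff_norm] at hw
    have h1 := (Complex.abs_re_le_norm _).trans_lt hw
    have h2 := (Complex.abs_im_le_norm _).trans_lt hw
    simp at h1 h2
    exact ⟨h1, h2⟩
  have hnear : ∀ w ∈ Metric.ball ((x₁ : ℂ) + Complex.I * (s : ℂ)) (κ * σ),
      |w.re - x₁| < δ ∧ |w.im - b| < 2 * δ := fun w hw => by
    obtain ⟨h1, h2⟩ := hpt w hw
    refine ⟨by linarith, ?_⟩
    have h3 := abs_sub_le w.im s b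
    rw [← hσ, abs_of_pos hσ0] at h3
    linarith
  have hmem : ∀ w ∈ Metric.ball ((x₁ : ℂ) + Complex.I * (s : ℂ)) (κ * σ), (w.re, w.im) ∈ X :=
    fun w hw => by
      obtain ⟨h1, h2⟩ := hpt w hw
      obtain ⟨h3, h4⟩ := hnear w hw
      obtain ⟨⟨h5, h6⟩, h7⟩ := hηb w.re (by rw [Metric.mem_ball, Real.dist_eq]; linarith)
      rw [Real.norm_eq_abs, Real.norm_eq_abs] at h5
      rw [hX]
      refine ⟨h7, ?_, ?_⟩
      · have h8 : L * |w.re - x₁| ≤ L * (κ * σ) := by gcongr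
        have h9 : L * (κ * σ) = σ - κ * σ := by rw [← mul_assoc, hκL]; ring
        have h10 := (le_abs_self _).trans h5
        have h11 := (abs_lt.1 h2).1
        change bot w.re < w.im
        rw [← hb] at h10
        linarith
      · have h8 := (abs_lt.1 h4).2
        change w.im < top w.re
        linarith
  have hcast : ∀ w ∈ Metric.ball ((x₁ : ℂ) + Complex.I * (s : ℂ)) (κ * σ),
      ((w.re : ℂ), (w.im : ℂ)) ∈ Metric.ball ((x₁ : ℂ), (b : ℂ)) r₀ := fun w hw => by
    obtain ⟨h3, h4⟩ := hnear w hw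
    rw [Metric.mem_ball, dist_eq_norm, Prod.norm_def]
    refine max_lt ?_ ?_
    · simp only [Prod.fst_sub]
      rw [← Complex.ofReal_sub, Complex.norm_real, Real.norm_eq_abs]
      linarith
    · simp only [Prod.snd_sub]
      rw [← Complex.ofReal_sub, Complex.norm_real, Real.norm_eq_abs]
      linarith
  refine extendsToDisc_of_poisson (v := v) (fun w hw => hu _ (hmem w hw))
    (fun w hw => (hball _ (hcast w hw)).1) (fun w hw => ?_) (fun z hz => ?_)
  · obtain ⟨h3, h4⟩ := hnear w hw
    have h5 := hball₁ (w.re, w.im) (by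
      rw [Metric.mem_ball, dist_eq_norm, Prod.norm_def]
      refine max_lt ?_ ?_
      · simp only [Prod.fst_sub, Real.norm_eq_abs]; linarith
      · simp only [Prod.snd_sub, Real.norm_eq_abs]; linarith)
    rw [(hball _ (hcast w hw)).2, h5, heq _ (hmem w hw), Complex.ofReal_re]
  · refine (hball _ ?_).1
    rw [Metric.mem_ball, dist_eq_norm, Prod.norm_def]
    refine max_lt (by simpa using hr₀) ?_
    simp only [Prod.snd_sub]
    have h1 : ‖z - (s : ℂ)‖ < κ * σ := mem_ball_iff_norm.1 hz
    have h2 : ‖(s : ℂ) - (b : ℂ)‖ = σ := by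
      rw [← Complex.ofReal_sub, Complex.norm_real, Real.norm_of_nonneg hσ0.le]
    have h3 := norm_sub_le_norm_sub_add_norm_sub z (s : ℂ) (b : ℂ)
    linarith

/-! ### Continuation of the data and the main theorem. -/

/-- The data continue analytically to small characteristic squares. -/
theorem exists_isContinuedData {X S : Set (ℝ × ℝ)} {f u₀ u₁ u : ℝ × ℝ → ℝ} {x₁ t : ℝ}
    (hS : (x₁, t) ∈ S) (hf : AnalyticAt ℝ f (x₁, t))
    (hu : IsAnalyticCauchySolution X S f u₀ u₁ u) :
    ∃ δ > 0, ∃ F : ℝ × ℂ → ℂ, ∀ ε ≤ δ, IsContinuedData f u₀ u₁ F x₁ t ε := by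
  have hua : AnalyticAt ℝ u (x₁, t) := hu.analytic _ (Or.inr hS)
  -- The initial conditions hold in a full neighbourhood of the point, so `u₀` and `u₁` inherit
  -- analyticity from `u`.
  have h₀ : AnalyticAt ℝ u₀ (x₁, t) := hua.congr (hu.value _ hS)
  have h₁ : AnalyticAt ℝ u₁ (x₁, t) := by
    refine (hua.real_partial (0, 1)).congr ?_
    filter_upwards [hu.slope _ hS, hua.eventually_analyticAt] with p a1 a2
    rw [← a1, partialTwo_eq_fderiv a2]
  have hfc : AnalyticAt ℝ (fun p => (f p : ℂ)) (x₁, t) := (Complex.ofRealCLM.analyticAt _).comp hf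
  obtain ⟨G, hG, hGf⟩ := hfc.exists_complexification
  obtain ⟨δ₁, hδ₁, hb₁⟩ := Metric.eventually_nhds_iff_ball.1
    (eventually_slice_fst (p := (x₁, t)) (h₀.eventually_analyticAt.and h₁.eventually_analyticAt))
  obtain ⟨δ₂, hδ₂, hb₂⟩ := Metric.eventually_nhds_iff_ball.1 hG.eventually_analyticAt
  have hcast : Continuous fun q : ℝ × ℂ => ((q.1 : ℂ), q.2) := by fun_prop
  have hsq : ∀ ε ≤ min δ₁ δ₂, ∀ p ∈ characteristicSquare x₁ t ε, AnalyticAt ℂ G ((p.1 : ℂ), p.2) := by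
    rintro ε hε p ⟨h1, h2⟩
    refine hb₂ _ ?_
    have hp1 := abs_nonneg (p.1 - x₁)
    have hp2 := abs_nonneg p.2.im
    have hε' : ε ≤ δ₂ := hε.trans (min_le_right _ _)
    rw [Metric.mem_ball, dist_eq_norm, Prod.norm_def]
    refine max_lt ?_ ?_
    · simp only [Prod.fst_sub]
      rw [← Complex.ofReal_sub, Complex.norm_real, Real.norm_eq_abs]
      linarith
    · have hd : p.2 - (t : ℂ) = (p.2.im : ℂ) * Complex.I := by
        apply Complex.ext <;> simp [h1]
      simp only [Prod.snd_sub]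
      rw [hd, norm_mul, Complex.norm_I, mul_one, Complex.norm_real, Real.norm_eq_abs]
      linarith
  refine ⟨min δ₁ δ₂, lt_min hδ₁ hδ₂, fun q => G ((q.1 : ℂ), q.2), fun ε hε => ?_⟩
  have hεδ₁ : ε ≤ δ₁ := hε.trans (min_le_left _ _)
  refine ⟨fun r hr => (hb₁ r (hr.trans_le hεδ₁)).1, fun r hr => (hb₁ r (hr.trans_le hεδ₁)).2,
    fun p hp => ?_, fun p hp => ?_, hGf⟩
  · let R : ℝ × ℂ →L[ℝ] ℂ × ℂ := Complex.ofRealCLM.prodMap (ContinuousLinearMap.id ℝ ℂ)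
    exact AnalyticAt.comp (g := G) (f := fun q : ℝ × ℂ => ((q.1 : ℂ), q.2))
      (hsq ε hε p hp).restrictScalars (R.analyticAt p)
  · filter_upwards [(hcast.tendsto p).eventually (hsq ε hε p hp).eventually_analyticAt] with q hq
    exact hq.hasDerivAt_snd.differentiableAt

theorem halfWidth_pos {a c x₁ : ℝ} (hx : x₁ ∈ Ioo a c) : 0 < halfWidth a c x₁ := by
  rw [halfWidth, sub_pos, abs_lt]
  constructor <;> linarith [hx.1, hx.2]

theorem theoremt (a c : ℝ) (hac : a < c) (bot top : ℝ → ℝ)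
    (hbot : ContDiffOn ℝ (⊤ : ℕ∞) bot (Ioo a c))
    (htop : ContDiffOn ℝ (⊤ : ℕ∞) top (Ioo a c))
    (hlt : ∀ x₁ ∈ Ioo a c, bot x₁ < top x₁)
    (f u₀ u₁ u : ℝ × ℝ → ℝ)
    (hf : AnalyticOnNhd ℝ f (stripDomain a c bot top ∪ graphOver a c top ∪ graphOver a c bot))
    (hu : IsAnalyticCauchySolution (stripDomain a c bot top) (graphOver a c top) f u₀ u₁ u) :
    ∀ x₁ ∈ Ioo a c,
      -- the holomorphic extension and the continued data exist on some triangle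
      (∃ ε₀ ∈ Ioc 0 (halfWidth a c x₁), ∀ ε ∈ Ioc 0 ε₀, ∃ (U : ℂ → ℂ) (F : ℝ × ℂ → ℂ),
        IsTriangleExtension (fun s => u (x₁, s)) (bot x₁) (top x₁) ε U ∧
        IsContinuedData f u₀ u₁ F x₁ (top x₁) ε) ∧
      -- wherever the extension exists, `ε = ε(x₁)` included:
      (∀ ε ∈ Ioc 0 (halfWidth a c x₁), ∀ U : ℂ → ℂ,
        IsTriangleExtension (fun s => u (x₁, s)) (bot x₁) (top x₁) ε U →
        -- it is given on the side `Re z₂ = top x₁` by d'Alembert's formula with a source term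
        (∀ F : ℝ × ℂ → ℂ, IsContinuedData f u₀ u₁ F x₁ (top x₁) ε →
          ∀ y : ℝ, |y| < ε →
            U ((top x₁ : ℂ) + Complex.I * (y : ℂ)) =
              sourceTerm F x₁ (top x₁) y + dAlembertTerm u₀ u₁ x₁ (top x₁) y) ∧
        -- and the solution is the limit of the Carleman integrals
        (∀ x₂ : ℝ, (x₁, x₂) ∈ stripDomain a c bot top →
          (∀ N : ℕ, IntervalIntegrable
            (fun y : ℝ => U ((top x₁ : ℂ) + Complex.I * (y : ℂ)) *
              carlemanKernel N (bot x₁) (top x₁) ε x₂ y) MeasureTheory.volume (-ε) ε) ∧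
          Tendsto
            (fun N : ℕ => 1 / (2 * (Real.pi : ℂ)) *
              ∫ y in (-ε)..ε, U ((top x₁ : ℂ) + Complex.I * (y : ℂ)) *
                carlemanKernel N (bot x₁) (top x₁) ε x₂ y)
            atTop (𝓝 (u (x₁, x₂) : ℂ)))) := by

  intro x₁ hx
  have hn : Ioo a c ∈ 𝓝 x₁ := isOpen_Ioo.mem_nhds hx
  have hbt := hlt x₁ hx
  have hX : IsOpen (stripDomain a c bot top) :=
    isOpen_stripDomain hbot.continuousOn htop.continuousOn
  have hS : (x₁, top x₁) ∈ graphOver a c top := ⟨hx, rfl⟩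
  have hXt : ∀ s ∈ Ioo (bot x₁) (top x₁), (x₁, s) ∈ stripDomain a c bot top :=
    fun s hs => ⟨hx, hs.1, hs.2⟩
  refine ⟨?_, ?_⟩
  · have hbd : DifferentiableAt ℝ bot x₁ :=
      (hbot.differentiableOn (by simp)).differentiableAt hn
    obtain ⟨κ₀, hκ₀, δ₀, hδ₀, hnear⟩ := exists_linear_radius_bottom rfl hx hbd
      (htop.continuousOn.continuousAt hn) hbt
      (hf (x₁, bot x₁) (Or.inr ⟨hx, rfl⟩)) (fun x hxX => hu.analytic x (Or.inl hxX)) hu.equation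
    have hg : ∀ s ∈ Ioc (bot x₁) (top x₁), AnalyticAt ℝ (fun r => u (x₁, r)) s := fun s hs => by
      have hua : AnalyticAt ℝ u (x₁, s) := by
        rcases hs.2.eq_or_lt with h | h
        · exact hu.analytic _ (Or.inr (h ▸ hS))
        · exact hu.analytic _ (Or.inl (hXt s ⟨hs.1, h⟩))
      exact AnalyticAt.comp (g := u) (f := fun r => (x₁, r)) hua
        (analyticAt_const.prod analyticAt_id)
    obtain ⟨κ, hκ, hdisc⟩ := exists_linear_radius hbt hκ₀ hδ₀ hg hnear
    obtain ⟨δ, hδ, F, hF⟩ := exists_isContinuedData hS (hf _ (Or.inl (Or.inr hS))) hu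
    have hκt : 0 < κ * (top x₁ - bot x₁) := mul_pos hκ (sub_pos.2 hbt)
    -- The division by `2` provides the strict inequality `ε < κ (top x₁ - bot x₁)` needed for
    -- gluing.
    refine ⟨min (halfWidth a c x₁) (min δ (κ * (top x₁ - bot x₁) / 2)),
      ⟨lt_min (halfWidth_pos hx) (lt_min hδ (half_pos hκt)), min_le_left _ _⟩, fun ε hε => ?_⟩
    have h1 : ε ≤ δ := hε.2.trans ((min_le_right _ _).trans (min_le_left _ _))
    have h2 : ε ≤ κ * (top x₁ - bot x₁) / 2 :=
      hε.2.trans ((min_le_right _ _).trans (min_le_right _ _))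
    obtain ⟨U, hU⟩ := exists_isTriangleExtension hbt hκ (by linarith) hdisc
    exact ⟨U, F, hU, hF ε h1⟩
  · intro ε hε U hU
    refine ⟨fun F hF y hy => hU.eq_dAlembert hX hbt hε.1 hXt hS hu hF hy, fun x₂ hx₂ => ?_⟩
    have h := carleman_formula (x := x₂) hε.1 hx₂.2.1 hx₂.2.2 hU.holomorphic hU.continuous
    rw [hU.extends_real x₂ ⟨hx₂.2.1, hx₂.2.2⟩] at h
    exact h
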